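/- Let $\aleph=i/2\pi$ and $d^c=\aleph(\bar\partial-\partial)$, so that $dd^c=2\aleph\,\partial\bar\partial$. Let $X$ be a complex manifold and $0\to S\xrightarrow{j}E\xrightarrow{g}Q\to0$ a short exact sequence of holomorphic vector bundles over $X$, where $E$ has rank $m$ and a smooth Hermitian metric, and $S$ and $Q$ carry the induced metrics. Let $D_E,D_S,D_Q$ be the Chern connections, $c(D)=\det(\aleph D^2+I)$ the Chern forms, and $\Theta=D_E^2$. Let $j^*$ be the adjoint of $j$ and $\gamma_b=D'_{\mathrm{End}\,E}(jj^*)$, where $D'_{\mathrm{End}\,E}$ is the $(1,0)$-part of the connection induced by $D_E$ on $\mathrm{End}\,E$. If $e_1,\dots,e_m$ is a local holomorphic frame of $E$ with dual frame $e_1^*,\dots,e_m^*$ and $a=\sum a_{jk}\otimes e_j\otimes e_k^*$ is a form with values in $\mathrm{End}\,E$, put $\tilde a=\sum_{j,k}a_{jk}\wedge e_j\wedge e_k^*$, a section of $\Lambda(T^*X\oplus E\oplus E^*)$, and $\bar\partial\tilde a=\sum_{j,k}\bar\partial a_{jk}\wedge e_j\wedge e_k^*$; write $I$ for the identity of $E$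 and $\omega_k=\omega^k/k!$. Every section of $\Lambda(T^*X\oplus E\oplus E^*)$ is uniquely $\omega=\omega'\wedge\tilde I_m+\omega''$ with $\omega'$ a scalar-valued form and $\omega''$ of lower degree in the $e_j,e_k^*$; put $\int_e\omega=\omega'$. Define $$v=\sum_{\ell=1}^{m-1}\frac{(-1)^\ell}{2\ell}\int_e\widetilde{jj^*}\wedge(\tilde I+\aleph\tilde\Theta-\aleph\bar\partial\tilde\gamma_b)_{m-\ell-1}\wedge(-\aleph\bar\partial\tilde\gamma_b)_\ell,$$ $$b=\int_0^1\int_e\aleph\tilde\gamma_b\wedge e^{\tilde I+\aleph\tilde\Theta-t\aleph\bar\partial\tilde\gamma_b}\,dt.$$ Then $v$ is a smooth form in $\bigoplus_k\mathcal E_{k,k}(X)$, $b$ is a smooth form on $X$, and $$2\aleph\,\partial v=b,\qquad -dd^cv=c(D_E)-c(D_S)\wedge c(D_Q).$$ The Chern forms $c(D_E),c(D_S),c(D_Q)$ are smooth closed forms in $\bigoplus_k\mathcal E_{k,k}(X)$, and if $\hat c(E)$ denotes the Bott–Chern class of $E$, that is, the class of $c(D_E)$ in $\bigl(\bigoplus_k\mathcal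 E_{k,k}(X)\cap\operatorname{Ker}d\bigr)/\bigoplus_k dd^c\mathcal E_{k,k}(X)$ (and likewise for $S$, $Q$), then $\hat c(E)=\hat c(S)\,\hat c(Q)$, where the product of classes is induced by the wedge product. -/

import Mathlib

open scoped Manifold ContDiff Matrix
open Bundle

noncomputable section

namespace BottChern

/-! ## Exterior algebra of complex valued forms on a complex vector space -/

section Algebra

variable (V : Type*) [NormedAddCommGroup V] [NormedSpace ℂ V]

/-- The complexified real cotangent space `T^* ⊗ ℂ`: real-linear maps `V → ℂ`. -/
abbrev Covec := V →L[ℝ] ℂ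

/-- The algebra `Λ^•(T^* ⊗ ℂ)` of complex valued alternating forms; the product is the wedge
product. -/
abbrev Form := ExteriorAlgebra ℂ (Covec V)

variable {V}

/-- Pullback of covectors along a real-linear map. -/
def pullCovec (T : V →L[ℝ] V) : Covec V →ₗ[ℂ] Covec V where
  toFun α := α.comp T
  map_add' _ _ := rfl
  map_smul' _ _ := rfl

/-- Pullback of forms along a real-linear map. -/
def pullForm (T : V →L[ℝ] V) : Form V →ₐ[ℂ] Form V := ExteriorAlgebra.map (pullCovec T)

variable (V) in
/-- Multiplication by `i`, as a real-linear map. -/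
def mulI : V →L[ℝ] V := (Complex.I • ContinuousLinearMap.id ℂ V).restrictScalars ℝ

/-- The `(1,0)`-part (complex-linear part) of a covector. -/
def covec10 : Covec V →ₗ[ℂ] Covec V :=
  (1 / 2 : ℂ) • (LinearMap.id - Complex.I • pullCovec (mulI V))

/-- The `(0,1)`-part (conjugate-linear part) of a covector. -/
def covec01 : Covec V →ₗ[ℂ] Covec V :=
  (1 / 2 : ℂ) • (LinearMap.id + Complex.I • pullCovec (mulI V))

variable (V) in
/-- The space `Λ^{p,q}`: the span of wedge products of `p` covectors of type `(1,0)` and `q`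
covectors of type `(0,1)`. -/
def bidegree (p q : ℕ) : Submodule ℂ (Form V) :=
  (LinearMap.range (covec10 (V := V))).map (ExteriorAlgebra.ι ℂ) ^ p *
    (LinearMap.range (covec01 (V := V))).map (ExteriorAlgebra.ι ℂ) ^ q

/-- Determinant of a matrix whose entries are forms, by the Leibniz formula.  (It is used for
entries of even degree, which commute, so that the order of the factors is irrelevant.) -/
def formDet {m : ℕ} (A : Matrix (Fin m) (Fin m) (Form V)) : Form V :=
  ∑ σ : Equiv.Perm (Fin m),
    ((Equiv.Perm.sign σ : ℤ) : ℂ) • (List.ofFn fun i => A (σ i) i).prod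

instance finite_covec [FiniteDimensional ℂ V] : Module.Finite ℂ (Covec V) := by
  have : FiniteDimensional ℝ V := FiniteDimensional.complexToReal V
  exact Module.Finite.of_restrictScalars_finite ℝ ℂ (Covec V)

variable (V) in
/-- A basis of the exterior algebra, used to differentiate and integrate form valued functions
coefficientwise. -/
def formBasis [FiniteDimensional ℂ V] :
    Module.Basis (Finset (Fin (Module.finrank ℂ (Covec V)))) ℂ (Form V) :=
  (Module.finBasis ℂ (Covec V)).ExteriorAlgebra

/-- The integral over `[0,1]` of a form valued function, taken coefficientwise. -/
def formIntegral [FiniteDimensional ℂ V] (f : ℝ → Form V) : Form V :=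
  ∑ s, (∫ t in (0 : ℝ)..1, (formBasis V).repr (f t) s) • formBasis V s

end Algebra

/-! ## The algebra `Λ(T^* ⊕ E ⊕ E^*)` in a frame, and the integral `∫_e` -/

section Berezin

variable (V : Type*) [NormedAddCommGroup V] [NormedSpace ℂ V] (m : ℕ)

/-- `Λ(T^* ⊕ E ⊕ E^*)` for `E` of rank `m` with a given frame. -/
abbrev BigForm := ExteriorAlgebra ℂ (Covec V × (Fin m → ℂ) × (Fin m → ℂ))

variable {V m}

/-- Inclusion of the scalar valued forms. -/
def incl : Form V →ₐ[ℂ] BigForm V m :=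
  ExteriorAlgebra.map (LinearMap.inl ℂ (Covec V) ((Fin m → ℂ) × (Fin m → ℂ)))

/-- The projection onto scalar valued forms which sends all `e_j`, `e_j^*` to zero. -/
def scalarPart : BigForm V m →ₐ[ℂ] Form V :=
  ExteriorAlgebra.map (LinearMap.fst ℂ (Covec V) ((Fin m → ℂ) × (Fin m → ℂ)))

/-- The frame element `e_j`. -/
def e (j : Fin m) : BigForm V m := ExteriorAlgebra.ι ℂ (0, Pi.single j 1, 0)

/-- The dual frame element `e_j^*`. -/
def eStar (j : Fin m) : BigForm V m := ExteriorAlgebra.ι ℂ (0, 0, Pi.single j 1)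

/-- The linear functional reading off the coefficient of `e_j`. -/
def coordE (j : Fin m) : Module.Dual ℂ (Covec V × (Fin m → ℂ) × (Fin m → ℂ)) :=
  LinearMap.proj j ∘ₗ LinearMap.fst ℂ _ _ ∘ₗ LinearMap.snd ℂ _ _

/-- The linear functional reading off the coefficient of `e_j^*`. -/
def coordEStar (j : Fin m) : Module.Dual ℂ (Covec V × (Fin m → ℂ) × (Fin m → ℂ)) :=
  LinearMap.proj j ∘ₗ LinearMap.snd ℂ _ _ ∘ₗ LinearMap.snd ℂ _ _

/-- For `a = (a_{jk})` a form valued endomorphism in the frame, the element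
`ã = ∑_{jk} a_{jk} ∧ e_j ∧ e_k^*`. -/
def snake (a : Matrix (Fin m) (Fin m) (Form V)) : BigForm V m :=
  ∑ j, ∑ k, incl (a j k) * e j * eStar k

/-- `x_k = x^k / k!`. -/
def divPow (x : BigForm V m) (k : ℕ) : BigForm V m := ((k.factorial : ℂ)⁻¹) • x ^ k

/-- The integral `∫_e ω`: if `ω = ω' ∧ Ĩ_m + ω''`, with `ω''` of lower degree in the
`e_j, e_k^*` and `ω'` a scalar valued form, then `∫_e ω = ω'`.  It is computed by contracting
successively with the duals of `e_j` and `e_j^*`, for every `j`. -/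
def berezin (w : BigForm V m) : Form V :=
  scalarPart <| (List.finRange m).foldr
    (fun j y => CliffordAlgebra.contractLeft (coordEStar j)
      (CliffordAlgebra.contractLeft (coordE j) y)) w

end Berezin

/-- The constant `ℵ = i / 2π`. -/
def aleph : ℂ := Complex.I / (2 * Real.pi)

/-! ## Calculus in an open set of a complex vector space -/

section LocalCalculus

variable {V : Type*} [NormedAddCommGroup V] [NormedSpace ℂ V] [FiniteDimensional ℂ V]

/-- Directional derivative of a form valued function, coefficientwise. -/
def dirDeriv (f : V → Form V) (z w : V) : Form V :=
  ∑ s, (fderiv ℝ (fun y => (formBasis V).repr (f y) s) z w) • formBasis V s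

variable (V) in
/-- A real basis of `V`. -/
def realBasis : Module.Basis (Fin (Module.finrank ℝ V)) ℝ V :=
  haveI : FiniteDimensional ℝ V := FiniteDimensional.complexToReal V
  Module.finBasis ℝ V

/-- The real coordinate differential `dx_i` as a complex valued covector. -/
def dx (i : Fin (Module.finrank ℝ V)) : Covec V :=
  haveI : FiniteDimensional ℝ V := FiniteDimensional.complexToReal V
  Complex.ofRealCLM.comp (LinearMap.toContinuousLinearMap ((realBasis V).coord i))

/-- Exterior derivative `d ω = ∑ dx_i ∧ ∂ω/∂x_i`. -/
def extDL (f : V → Form V) (z : V) : Form V :=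
  ∑ i, ExteriorAlgebra.ι ℂ (dx i) * dirDeriv f z (realBasis V i)

/-- The operator `∂`: `∂ω = ∑ (dx_i)^{1,0} ∧ ∂ω/∂x_i`. -/
def delL (f : V → Form V) (z : V) : Form V :=
  ∑ i, ExteriorAlgebra.ι ℂ (covec10 (dx i)) * dirDeriv f z (realBasis V i)

/-- The operator `∂̄`: `∂̄ω = ∑ (dx_i)^{0,1} ∧ ∂ω/∂x_i`. -/
def dbarL (f : V → Form V) (z : V) : Form V :=
  ∑ i, ExteriorAlgebra.ι ℂ (covec01 (dx i)) * dirDeriv f z (realBasis V i)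

variable {m : ℕ}

/-- Connection matrix `θ = H⁻¹ ∂H` of the Chern connection `D = d + θ` in a holomorphic frame
`e_1, …, e_m` with Gram matrix `H_{kj} = ⟨e_j, e_k⟩`; here `D e_j = ∑_k θ_{kj} ⊗ e_k`. -/
def chernConnection (H : V → Matrix (Fin m) (Fin m) ℂ) (z : V) :
    Matrix (Fin m) (Fin m) (Form V) := fun i j =>
  ∑ k, ((H z)⁻¹ i k) • delL (fun y => algebraMap ℂ (Form V) (H y k j)) z

/-- The curvature `Θ = D² = dθ + θ ∧ θ` of the Chern connection. -/
def curvature (H : V → Matrix (Fin m) (Fin m) ℂ) (z : V) :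
    Matrix (Fin m) (Fin m) (Form V) := fun i j =>
  extDL (fun y => chernConnection H y i j) z +
    ∑ k, chernConnection H z i k * chernConnection H z k j

/-- The Chern form `c(D) = det (ℵ Θ + I)`. -/
def chernFormL (H : V → Matrix (Fin m) (Fin m) ℂ) (z : V) : Form V :=
  formDet (aleph • curvature H z + 1)

/-- A complex matrix as a matrix of `0`-forms. -/
def toForms (P : Matrix (Fin m) (Fin m) ℂ) : Matrix (Fin m) (Fin m) (Form V) :=
  P.map (algebraMap ℂ (Form V))

/-- `D'_{End E} P = ∂P + θ P - P θ` for an endomorphism `P` given in a holomorphic frame;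
this is the form `γ_b` when `P = j j^*`. -/
def gammaL (H P : V → Matrix (Fin m) (Fin m) ℂ) (z : V) :
    Matrix (Fin m) (Fin m) (Form V) :=
  Matrix.of (fun i j => delL (fun y => algebraMap ℂ (Form V) (P y i j)) z) +
    chernConnection H z * toForms (P z) - toForms (P z) * chernConnection H z

/-- `∂̄ γ_b`, computed entrywise in a holomorphic frame. -/
def dbarGammaL (H P : V → Matrix (Fin m) (Fin m) ℂ) (z : V) :
    Matrix (Fin m) (Fin m) (Form V) := fun i j =>
  dbarL (fun y => gammaL H P y i j) z

/-- The form
`v = ∑_{ℓ=1}^{m-1} ((-1)^ℓ / 2ℓ) ∫_e P̃ ∧ (Ĩ + ℵΘ̃ - ℵ∂̄γ̃_b)_{m-ℓ-1} ∧ (-ℵ∂̄γ̃_b)_ℓ`. -/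
def vFormL (H P : V → Matrix (Fin m) (Fin m) ℂ) (z : V) : Form V :=
  ∑ l ∈ Finset.Icc 1 (m - 1), ((-1 : ℂ) ^ l / (2 * l)) •
    berezin (snake (toForms (P z)) *
      divPow (snake 1 + aleph • snake (curvature H z) - aleph • snake (dbarGammaL H P z))
        (m - l - 1) *
      divPow (-(aleph • snake (dbarGammaL H P z))) l)

/-- The form `b = ∫_0^1 ∫_e ℵ γ̃_b ∧ exp (Ĩ + ℵΘ̃ - t ℵ∂̄γ̃_b) dt`; the exponent is nilpotent. -/
def bFormL (H P : V → Matrix (Fin m) (Fin m) ℂ) (z : V) : Form V :=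
  formIntegral fun t => berezin ((aleph • snake (gammaL H P z)) *
    IsNilpotent.exp (snake 1 + aleph • snake (curvature H z)
      - (t : ℂ) • (aleph • snake (dbarGammaL H P z))))

end LocalCalculus

/-! ## Differential forms on a complex manifold -/

section Manifold

variable {V : Type*} [NormedAddCommGroup V] [NormedSpace ℂ V]
  {X : Type*} [TopologicalSpace X] [ChartedSpace V X]

/-- A differential form on `X` assigns to every point an element of `Λ^•(T_x^* X ⊗ ℂ)`.  As
everywhere in Mathlib, the tangent space at `x` is identified with `V` by means of the
preferred chart at `x`. The coordinate expression of the form in the chart `φ` at `x₀` is the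
pullback by `φ⁻¹`. -/
def coordForm (w : X → Form V) (x₀ : X) (z : V) : Form V :=
  pullForm (fderiv ℝ (chartAt V ((chartAt V x₀).symm z) ∘ (chartAt V x₀).symm) z)
    (w ((chartAt V x₀).symm z))

variable [FiniteDimensional ℂ V]

/-- Smoothness of a form: its coefficients in local coordinates are smooth. -/
def IsSmoothForm (w : X → Form V) : Prop :=
  ∀ x₀ : X, ∀ s, ContDiffOn ℝ ∞ (fun z => (formBasis V).repr (coordForm w x₀ z) s)
    (chartAt V x₀).target

/-- The exterior derivative, in local coordinates at each point. -/
def extD (w : X → Form V) (x : X) : Form V := extDL (coordForm w x) (chartAt V x x)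

/-- The operator `∂`. -/
def del (w : X → Form V) (x : X) : Form V := delL (coordForm w x) (chartAt V x x)

/-- The operator `∂̄`. -/
def dbar (w : X → Form V) (x : X) : Form V := dbarL (coordForm w x) (chartAt V x x)

/-- `d^c = ℵ (∂̄ - ∂)`. -/
def dc (w : X → Form V) : X → Form V := aleph • (dbar w - del w)

/-- The operator `d d^c`. -/
def ddc (w : X → Form V) : X → Form V := extD (dc w)

/-- The space `⊕_k 𝓔_{k,k}(X)`. -/
def IsSmoothKK (w : X → Form V) : Prop :=
  IsSmoothForm w ∧ ∀ x, w x ∈ ⨆ k : ℕ, bidegree V k k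

/-- The space `⊕_k 𝓔_{k,k}(X) ∩ Ker d`. -/
def IsClosedKK (w : X → Form V) : Prop := IsSmoothKK w ∧ extD w = 0

/-- The class of `a` in `(⊕_k 𝓔_{k,k}(X) ∩ Ker d) / (⊕_k d d^c 𝓔_{k,k}(X))`, as a set of forms:
all the closed forms in `⊕_k 𝓔_{k,k}(X)` which differ from `a` by some `d d^c u`. -/
def bcClass (a : X → Form V) : Set (X → Form V) :=
  {w | IsClosedKK w ∧ ∃ u : X → Form V, IsSmoothKK u ∧ w - a = ddc u}

/-- The product of two classes: the set of the forms in the classes of the wedge products of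
representatives. -/
def bcMul (A B : Set (X → Form V)) : Set (X → Form V) :=
  {w | ∃ a ∈ A, ∃ b ∈ B, w ∈ bcClass (a * b)}

end Manifold

/-! ## Holomorphic Hermitian bundles -/

section Bundles

variable {V : Type*} [NormedAddCommGroup V] [NormedSpace ℂ V]
  {X : Type*} [TopologicalSpace X] [ChartedSpace V X]

/-- A smooth Hermitian metric on a complex vector bundle of rank `m` over `X`; `form x u w` is
`⟨u, w⟩`, linear in `u` and conjugate-linear in `w`. -/
structure HermitianMetric (V : Type*) [NormedAddCommGroup V] [NormedSpace ℂ V]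
    {X : Type*} [TopologicalSpace X] [ChartedSpace V X] (m : ℕ) (E : X → Type*)
    [∀ x, AddCommGroup (E x)] [∀ x, Module ℂ (E x)] [∀ x, TopologicalSpace (E x)]
    [TopologicalSpace (TotalSpace (Fin m → ℂ) E)] [FiberBundle (Fin m → ℂ) E] where
  /-- the sesquilinear form on the fibers -/
  form : ∀ x, E x →ₗ[ℂ] E x →ₛₗ[starRingEnd ℂ] ℂ
  symm : ∀ x (u w : E x), form x u w = starRingEnd ℂ (form x w u)
  pos : ∀ x (u : E x), u ≠ 0 → 0 < (form x u u).re
  smooth : ∀ (x₀ : X) (u w : Fin m → ℂ),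
    ContMDiffOn 𝓘(ℝ, V) 𝓘(ℝ, ℂ) ∞
      (fun x => form x ((trivializationAt (Fin m → ℂ) E x₀).symm x u)
        ((trivializationAt (Fin m → ℂ) E x₀).symm x w))
      (trivializationAt (Fin m → ℂ) E x₀).baseSet

variable {r m : ℕ} {E : X → Type*}
  [∀ x, AddCommGroup (E x)] [∀ x, Module ℂ (E x)] [∀ x, TopologicalSpace (E x)]
  [TopologicalSpace (TotalSpace (Fin m → ℂ) E)] [FiberBundle (Fin m → ℂ) E]

variable (m E) in
/-- The `k`-th element of the preferred holomorphic frame near `x₀`, at the point `x`. -/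
def frame (x₀ x : X) (k : Fin m) : E x :=
  (trivializationAt (Fin m → ℂ) E x₀).symm x (Pi.single k 1)

/-- The Gram matrix `H_{kj} = ⟨e_j, e_k⟩` of the preferred frame near `x₀`, in the preferred
local coordinates near `x₀`. -/
def gram (h : HermitianMetric V m E) (x₀ : X) (z : V) : Matrix (Fin m) (Fin m) ℂ := fun k j =>
  h.form ((chartAt V x₀).symm z) (frame m E x₀ _ j) (frame m E x₀ _ k)

variable [FiniteDimensional ℂ V]

/-- The Chern form `c(D_E)` of the Chern connection of the metric.  Its value at `x` is computed
in the preferred holomorphic frame and the preferred holomorphic coordinates at `x` (the value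
of this form, like that of `v` and `b` below, does not depend on the frame or coordinates). -/
def chernForm (h : HermitianMetric V m E) (x : X) : Form V :=
  chernFormL (gram h x) (chartAt V x x)

/-- The (total) Bott-Chern class `ĉ(E)`. -/
def bottChernClass (h : HermitianMetric V m E) : Set (X → Form V) := bcClass (chernForm h)

variable {S : X → Type*}
  [∀ x, AddCommGroup (S x)] [∀ x, Module ℂ (S x)] [∀ x, TopologicalSpace (S x)]
  [TopologicalSpace (TotalSpace (Fin r → ℂ) S)] [FiberBundle (Fin r → ℂ) S]

variable (r m) in
/-- The matrix of `j : S → E` in the preferred frames near `x₀`. -/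
def homMatrix (j : ∀ x, S x →ₗ[ℂ] E x) (x₀ : X) (z : V) : Matrix (Fin m) (Fin r) ℂ :=
  fun i k => (trivializationAt (Fin m → ℂ) E x₀
    ⟨(chartAt V x₀).symm z, j _ (frame r S x₀ _ k)⟩).2 i

/-- The matrix of `j j^*` in the preferred frame of `E` near `x₀`: the matrix of the adjoint
`j^*` is `H_S⁻¹ Jᴴ H_E`. -/
def jjStar (hS : HermitianMetric V r S) (hE : HermitianMetric V m E)
    (j : ∀ x, S x →ₗ[ℂ] E x) (x₀ : X) (z : V) : Matrix (Fin m) (Fin m) ℂ :=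
  homMatrix r m j x₀ z * ((gram hS x₀ z)⁻¹ * (homMatrix r m j x₀ z)ᴴ * gram hE x₀ z)

/-- The form `v` on `X`, computed at `x` in the preferred frame and coordinates at `x`. -/
def vForm (hS : HermitianMetric V r S) (hE : HermitianMetric V m E)
    (j : ∀ x, S x →ₗ[ℂ] E x) (x : X) : Form V :=
  vFormL (gram hE x) (jjStar hS hE j x) (chartAt V x x)

/-- The form `b` on `X`, computed at `x` in the preferred frame and coordinates at `x`. -/
def bForm (hS : HermitianMetric V r S) (hE : HermitianMetric V m E)
    (j : ∀ x, S x →ₗ[ℂ] E x) (x : X) : Form V :=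
  bFormL (gram hE x) (jjStar hS hE j x) (chartAt V x x)

variable (V r m) in
/-- A family of fiberwise linear maps is a holomorphic bundle map. -/
def IsHolomorphicHom (j : ∀ x, S x →ₗ[ℂ] E x) : Prop :=
  ContMDiff (𝓘(ℂ, V).prod 𝓘(ℂ, Fin r → ℂ)) (𝓘(ℂ, V).prod 𝓘(ℂ, Fin m → ℂ)) ω
    (fun p : TotalSpace (Fin r → ℂ) S => (⟨p.1, j p.1 p.2⟩ : TotalSpace (Fin m → ℂ) E))

end Bundles

end BottChern

end

noncomputable section

namespace BottChern

/-! ## Superalgebras and Leibniz determinants -/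

/-! In a holomorphic frame let `H` be the Gram matrix of E, θ = H⁻¹∂H its Chern connection, Θ = ∂̄θ,
P = jj^* the orthogonal projection onto S and γ = ∂P + [θ, P]. Since S is a holomorphic subbundle,
Pγ = 0 (`IsExactData.proj_mul_gam`); with P² = P this gives γP = γ and γγ = 0, so γ is the second
fundamental form of S. Hence every N = θ − μγ satisfies ∂N = −NN, has curvature Θ − μ∂̄γ, and obeys
the Bianchi identity for C_μ = I + ℵ(Θ − μ∂̄γ). The endpoints of this pencil are the two sides of
the formula: det C_0 = c(D_E), while θ − γ preserves S and induces the Chern connections of S and Q,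
so that det C_1 = c(D_S) c(D_Q) (`IsExactData.ldet_chernMatrix`).

The fiber integral is linear algebra in disguise: ∫_e B̃_m = det B and ∫_e x̃ ∧ B̃_{m-1} = tr(x adj
B) (`berezin_divPow_snake`, `berezin_snake_mul_pow`). Thus b is the integral of ℵ tr(γ adj C_μ) over
μ in [0,1], and v is a weighted sum of the coefficients of tr(P adj C_{1-t}) as a polynomial in t.

Two transgressions follow. As ∂̄ adj C_μ = 0, one has ∂̄ tr(γ adj C_μ) = tr(∂̄γ adj C_μ), and up to
a constant this is the μ-derivative of det C_μ; integrating, ∂̄b = det C_0 − det C_1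
(`SmoothForms.db_bAbs`). On the other hand the covariant derivative of P for θ − μγ is (1 − μ)γ, and
adj C_μ is covariantly constant, so ∂ tr(P adj C_μ) = (1 − μ) tr(γ adj C_μ) (`IsMetric.dl_trace`);
comparing powers of t = 1 − μ gives 2ℵ∂v = b (`SmoothForms.dl_vAbs`). Together, −dd^c v = ∂̄(2ℵ∂v) =
∂̄b.

For the classes, a d-closed form in ⊕ 𝓔_{k,k} is killed by ∂ and by ∂̄ separately, so dd^c(a u) = a
dd^c u; the product of classes therefore does not depend on representatives, and v exhibits the
required equality (`bcClass_eq_bcMul`).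

The matrix identities are proved in an abstract `DiffSuperalgebra` and applied to the algebra
`SmoothForms U`. The global forms are defined at each point by the frame and chart chosen at that
point, so differentiating them needs the same formula in one fixed frame nearby. This comes from
invariance under changes of frame (`IsGauge`) and compatibility with holomorphic pullback
(`SmoothForms.isDiffHom_pull`). -/

/-- A `ℂ`-algebra with a parity involution whose even elements are central. -/
class Superalgebra (A : Type*) [Ring A] [Algebra ℂ A] where
  /-- the parity involution -/
  parity : A →ₐ[ℂ] A
  parity_parity : ∀ a, parity (parity a) = a
  mul_comm_of_even : ∀ a b, parity a = a → a * b = b * a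

export Superalgebra (parity parity_parity mul_comm_of_even)

section LeibnizDet

variable {A B : Type*} [Ring A] [Algebra ℂ A] [Ring B] [Algebra ℂ B] {m : ℕ}

/-- The Leibniz determinant of a matrix over a possibly noncommutative algebra. -/
def ldet (M : Matrix (Fin m) (Fin m) A) : A :=
  ∑ σ : Equiv.Perm (Fin m),
    ((Equiv.Perm.sign σ : ℤ) : ℂ) • (List.ofFn fun i => M (σ i) i).prod

/-- The adjugate formed with the Leibniz determinant. -/
def ladj (M : Matrix (Fin m) (Fin m) A) : Matrix (Fin m) (Fin m) A := fun i j =>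
  ldet (M.updateRow j (Pi.single i 1))

theorem map_ldet (f : A →ₐ[ℂ] B) (M : Matrix (Fin m) (Fin m) A) :
    f (ldet M) = ldet (M.map f) := by
  simp [ldet, map_sum, map_list_prod, List.map_ofFn, Function.comp_def]

theorem map_ladj (f : A →ₐ[ℂ] B) (M : Matrix (Fin m) (Fin m) A) :
    (ladj M).map f = ladj (M.map f) := by
  ext i j
  simp only [Matrix.map_apply, ladj, map_ldet]
  congr 1
  ext k l
  by_cases hk : k = j
  · subst hk
    by_cases hl : l = i
    · subst hl; simp
    · simp [hl]
  · simp [Matrix.updateRow_ne hk]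

theorem ldet_mem (K : Subalgebra ℂ A) {M : Matrix (Fin m) (Fin m) A}
    (hM : ∀ i j, M i j ∈ K) : ldet M ∈ K := by
  refine sum_mem fun σ _ => K.smul_mem (list_prod_mem fun x hx => ?_) _
  obtain ⟨i, rfl⟩ := (List.mem_ofFn' _ _).1 hx
  exact hM _ _

theorem ladj_mem (K : Subalgebra ℂ A) {M : Matrix (Fin m) (Fin m) A}
    (hM : ∀ i j, M i j ∈ K) (i j : Fin m) : ladj M i j ∈ K := by
  refine ldet_mem K fun k l => ?_
  by_cases hk : k = j
  · subst hk
    by_cases hl : l = i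
    · subst hl; simp
    · simp [hl]
  · simpa [Matrix.updateRow_ne hk] using hM k l

end LeibnizDet

/-! ### The commutative ring of even elements -/

section EvenPart

variable (A : Type*) [Ring A] [Algebra ℂ A] [Superalgebra A] {m : ℕ}

/-- The subalgebra of even elements. -/
def evenPart : Subalgebra ℂ A := AlgHom.equalizer (parity (A := A)) (AlgHom.id ℂ A)

variable {A}

theorem mem_evenPart {a : A} : a ∈ evenPart A ↔ parity a = a := Iff.rfl

/-- Even elements are central, so the usual theory of determinants and adjugates is available here.
Matrices with even entries are lifted to this ring by `exists_lift_even`, and the results are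
carried back by `ldet_coe` and `ladj_coe`. -/
instance : CommRing (evenPart A) where
  mul_comm a b := Subtype.ext (mul_comm_of_even (a : A) b a.2)

theorem ldet_coe (M : Matrix (Fin m) (Fin m) (evenPart A)) :
    ldet (M.map (evenPart A).val) = ((M.det : evenPart A) : A) := by
  rw [← map_ldet (evenPart A).val]
  change ((ldet M : evenPart A) : A) = _
  congr 1
  rw [Matrix.det_apply', ldet]
  refine Finset.sum_congr rfl fun σ _ => ?_
  rw [List.prod_ofFn, Algebra.smul_def]
  simp

theorem ladj_coe (M : Matrix (Fin m) (Fin m) (evenPart A)) :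
    ladj (M.map (evenPart A).val) = M.adjugate.map (evenPart A).val := by
  rw [← map_ladj (evenPart A).val]
  congr 1
  ext i j
  rw [Matrix.adjugate_apply, ladj]
  have := ldet_coe (M.updateRow j (Pi.single i 1))
  rw [← map_ldet (evenPart A).val] at this
  exact this

/-- A matrix with even entries lifts to the commutative ring of even elements. -/
theorem exists_lift_even {l n : Type*} (M : Matrix l n A) (hM : ∀ i j, parity (M i j) = M i j) :
    ∃ M' : Matrix l n (evenPart A), M = M'.map (evenPart A).val :=
  ⟨fun i j => ⟨M i j, hM i j⟩, rfl⟩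

end EvenPart

/-! ### The exterior algebra as a superalgebra -/

section Exterior

variable {M : Type*} [AddCommGroup M] [Module ℂ M]

theorem ι_mul_eq_involute_mul_ι (v : M) (x : ExteriorAlgebra ℂ M) :
    ExteriorAlgebra.ι ℂ v * x = CliffordAlgebra.involute x * ExteriorAlgebra.ι ℂ v := by
  induction x using ExteriorAlgebra.induction with
  | algebraMap r => simp [Algebra.commutes]
  | ι w =>
    rw [CliffordAlgebra.involute_ι, neg_mul, eq_neg_iff_add_eq_zero]
    exact ExteriorAlgebra.ι_add_mul_swap v w
  | mul a b ha hb => rw [← mul_assoc, ha, mul_assoc, hb, map_mul, mul_assoc]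
  | add a b ha hb => rw [mul_add, ha, hb, map_add, add_mul]

instance : Superalgebra (ExteriorAlgebra ℂ M) where
  parity := CliffordAlgebra.involute
  parity_parity := CliffordAlgebra.involute_involute
  mul_comm_of_even a b ha := by
    induction b using ExteriorAlgebra.induction with
    | algebraMap r => simp [Algebra.commutes]
    | ι w => rw [ι_mul_eq_involute_mul_ι, ha]
    | mul b c hb hc => rw [← mul_assoc, hb, mul_assoc, hc, mul_assoc]
    | add b c hb hc => rw [mul_add, hb, hc, add_mul]

theorem parity_ι (v : M) :
    parity (ExteriorAlgebra.ι ℂ v) = -ExteriorAlgebra.ι ℂ v := CliffordAlgebra.involute_ι v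

theorem ι_mul (v : M) (x : ExteriorAlgebra ℂ M) :
    ExteriorAlgebra.ι ℂ v * x = parity x * ExteriorAlgebra.ι ℂ v := ι_mul_eq_involute_mul_ι v x

theorem parity_map {N : Type*} [AddCommGroup N] [Module ℂ N] (f : M →ₗ[ℂ] N)
    (x : ExteriorAlgebra ℂ M) :
    parity (ExteriorAlgebra.map f x) = ExteriorAlgebra.map f (parity x) := by
  induction x using ExteriorAlgebra.induction with
  | algebraMap r => simp
  | ι w => simp [parity_ι]
  | mul a b ha hb => simp [ha, hb]
  | add a b ha hb => simp [ha, hb]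

/-- Contraction is natural for maps of exterior algebras. -/
theorem contractLeft_map {N : Type*} [AddCommGroup N] [Module ℂ N] (f : M →ₗ[ℂ] N)
    (d : Module.Dual ℂ N) (x : ExteriorAlgebra ℂ M) :
    CliffordAlgebra.contractLeft d (ExteriorAlgebra.map f x) =
      ExteriorAlgebra.map f (CliffordAlgebra.contractLeft (d ∘ₗ f) x) := by
  induction x using CliffordAlgebra.left_induction with
  | algebraMap r =>
    simp only [AlgHom.commutes, CliffordAlgebra.contractLeft_algebraMap, map_zero]
  | add a b ha hb => simp only [map_add, ha, hb]
  | ι_mul x v hx =>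
    rw [map_mul, show ExteriorAlgebra.map f (CliffordAlgebra.ι 0 v) = CliffordAlgebra.ι 0 (f v)
      from ExteriorAlgebra.map_apply_ι f v, CliffordAlgebra.contractLeft_ι_mul, hx,
      CliffordAlgebra.contractLeft_ι_mul, map_sub, map_smul, map_mul,
      show ExteriorAlgebra.map f (CliffordAlgebra.ι 0 v) = CliffordAlgebra.ι 0 (f v)
      from ExteriorAlgebra.map_apply_ι f v]
    rfl

end Exterior

/-! ## Powers of sums of square zero elements in a commutative ring -/

section CommAlg

variable {R : Type*} [CommRing R] {ι : Type*}

/-- In the multinomial expansion only square-free monomials survive. In degree `s.card` the only one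
is the full product, which occurs `s.card!` times; in the next degree there is none. -/
theorem sum_pow_card_of_sq_eq_zero [DecidableEq ι] (s : Finset ι) (y : ι → R)
    (hy : ∀ i, y i * y i = 0) :
    (∑ i ∈ s, y i) ^ s.card = s.card.factorial • ∏ i ∈ s, y i ∧
      (∑ i ∈ s, y i) ^ (s.card + 1) = 0 := by
  induction s using Finset.induction_on with
  | empty => simp
  | insert a s ha ih =>
    obtain ⟨h1, h2⟩ := ih
    -- The binomial formula stops after the linear term because `y a` has square zero.
    have key : ∀ n : ℕ, (y a + ∑ i ∈ s, y i) ^ (n + 1) =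
        (∑ i ∈ s, y i) ^ (n + 1) + (n + 1) • (y a * (∑ i ∈ s, y i) ^ n) := by
      intro n
      induction n with
      | zero => simp [add_comm]
      | succ n ihn =>
        rw [pow_succ, ihn]
        have := hy a
        simp only [nsmul_eq_mul, pow_succ]
        push_cast
        linear_combination ((n + 1 : R) * (∑ i ∈ s, y i) ^ n) * this
    rw [Finset.sum_insert ha, Finset.prod_insert ha, Finset.card_insert_of_notMem ha]
    refine ⟨?_, ?_⟩
    · rw [key, h2, h1, Nat.factorial_succ]
      simp only [nsmul_eq_mul]
      push_cast
      ring
    · rw [key, pow_succ, h2]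
      simp

variable {m : ℕ} (p : Fin m → Fin m → R) (hp : ∀ j k l h, p j k * p l h = -(p j h * p l k))
  (hp₁ : ∀ j k h, p j k * p j h = 0) (hp₂ : ∀ j k l, p j k * p l k = 0)

-- The elements `p j k` model `e_j ∧ e_k^*`. By `hp`, exchanging two second indices in a product
-- changes its sign, so each transposition contributes −1.
include hp in
theorem prod_perm_eq_sign (σ : Equiv.Perm (Fin m)) :
    ∏ j, p j (σ j) = ((Equiv.Perm.sign σ : ℤ) : R) * ∏ j, p j j := by
  induction σ using Equiv.Perm.swap_induction_on' with
  | one => simp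
  | mul_swap σ x y hxy ih =>
    rw [Equiv.Perm.sign_mul, Equiv.Perm.sign_swap hxy]
    have e1 : ∀ τ : Equiv.Perm (Fin m), ∏ j, p j (τ j) =
        p x (τ x) * p y (τ y) * ∏ j ∈ (Finset.univ.erase x).erase y, p j (τ j) := by
      intro τ
      rw [← Finset.mul_prod_erase _ _ (Finset.mem_univ x),
        ← Finset.mul_prod_erase _ _ (Finset.mem_erase.2 ⟨hxy.symm, Finset.mem_univ y⟩), mul_assoc]
    have e2 : ∏ j ∈ (Finset.univ.erase x).erase y, p j ((σ * Equiv.swap x y) j) =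
        ∏ j ∈ (Finset.univ.erase x).erase y, p j (σ j) := by
      refine Finset.prod_congr rfl fun j hj => ?_
      simp only [Finset.mem_erase] at hj
      simp [Equiv.swap_apply_of_ne_of_ne hj.2.1 hj.1]
    have h3 : ∏ j, p j ((σ * Equiv.swap x y) j) = -∏ j, p j (σ j) := by
      rw [e1, e2, e1 σ]
      simp only [Equiv.Perm.mul_apply, Equiv.swap_apply_left, Equiv.swap_apply_right]
      rw [hp x (σ y) y (σ x)]
      ring
    rw [h3, ih]
    simp

-- By `hp₁` each row sum has square zero, so the m-th power is m! times the product of the row sums.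
-- Expanding that product over functions `f`, the non-injective ones vanish by `hp₂`, and a
-- permutation contributes its sign.
include hp hp₁ hp₂ in
theorem sum_mul_pow_eq_det (B : Matrix (Fin m) (Fin m) R) :
    (∑ j, ∑ k, B j k * p j k) ^ m = m.factorial • (B.det * ∏ j, p j j) ∧
      (∑ j, ∑ k, B j k * p j k) ^ (m + 1) = 0 := by
  have hy : ∀ j, (∑ k, B j k * p j k) * (∑ k, B j k * p j k) = 0 := by
    intro j
    rw [Finset.sum_mul_sum]
    refine Finset.sum_eq_zero fun k _ => Finset.sum_eq_zero fun h _ => ?_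
    linear_combination B j k * B j h * hp₁ j k h
  obtain ⟨h1, h2⟩ := sum_pow_card_of_sq_eq_zero Finset.univ (fun j => ∑ k, B j k * p j k) hy
  rw [Finset.card_univ, Fintype.card_fin] at h1 h2
  refine ⟨?_, h2⟩
  rw [h1, Finset.prod_univ_sum, Fintype.piFinset_univ]
  congr 1
  have h3 : ∀ f : Fin m → Fin m, ¬ Function.Injective f → ∏ j, p j (f j) = 0 := by
    intro f hf
    simp only [Function.Injective, not_forall] at hf
    obtain ⟨x, y, hxy, hne⟩ := hf
    rw [← Finset.mul_prod_erase _ _ (Finset.mem_univ x),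
        ← Finset.mul_prod_erase _ _ (Finset.mem_erase.2 ⟨fun h => hne h.symm, Finset.mem_univ y⟩),
        ← mul_assoc, hxy, hp₂, zero_mul]
  -- The expansion produces the entries `B j (σ j)`, whereas `Matrix.det_apply'` has the permutation
  -- in the row index.
  rw [← Matrix.det_transpose, Matrix.det_apply', Finset.sum_mul]
  symm
  refine Finset.sum_bij_ne_zero (fun σ _ _ => (σ : Fin m → Fin m)) (fun _ _ _ => Finset.mem_univ _)
    (fun σ _ _ τ _ _ h => Equiv.ext (congrFun h)) ?_ ?_
  · intro f _ hf
    rw [Finset.prod_mul_distrib] at hf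
    have hf' : Function.Injective f := by
      by_contra hn
      exact hf (by rw [h3 f hn, mul_zero])
    refine ⟨Equiv.ofBijective f (Finite.injective_iff_bijective.1 hf'), Finset.mem_univ _, ?_, rfl⟩
    intro h0
    apply hf
    have := prod_perm_eq_sign p hp (Equiv.ofBijective f (Finite.injective_iff_bijective.1 hf'))
    simp only [Equiv.ofBijective_apply] at this
    rw [this]
    simp only [Matrix.transpose_apply, Equiv.ofBijective_apply] at h0
    rw [← h0]
    ring
  · intro σ _ _
    rw [Finset.prod_mul_distrib, prod_perm_eq_sign p hp]
    simp only [Matrix.transpose_apply]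
    ring

end CommAlg

/-! ## Evaluation of the fiber integral -/

section BerezinFormulas

variable {V : Type*} [NormedAddCommGroup V] [NormedSpace ℂ V] {m : ℕ}

/-- Contraction with the duals of `e_j` and `e_j^*`. -/
def contractPair (j : Fin m) : BigForm V m →ₗ[ℂ] BigForm V m :=
  CliffordAlgebra.contractLeft (coordEStar j) ∘ₗ CliffordAlgebra.contractLeft (coordE j)

/-- Successive contraction along a list of indices. -/
def contractList (l : List (Fin m)) : BigForm V m →ₗ[ℂ] BigForm V m :=
  l.foldr (fun j T => contractPair j ∘ₗ T) LinearMap.id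

theorem contractList_apply (l : List (Fin m)) (w : BigForm V m) :
    contractList l w = l.foldr (fun j y => CliffordAlgebra.contractLeft (coordEStar j)
      (CliffordAlgebra.contractLeft (coordE j) y)) w := by
  induction l with
  | nil => rfl
  | cons j l ih => exact congrArg (contractPair j) ih

theorem contractList_cons (j : Fin m) (l : List (Fin m)) (w : BigForm V m) :
    contractList (j :: l) w = contractPair j (contractList l w) := rfl

variable (V m) in
/-- The fiber integral as a linear map. -/
def berezinₗ : BigForm V m →ₗ[ℂ] Form V :=
  scalarPart.toLinearMap ∘ₗ contractList (List.finRange m)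

theorem berezin_eq (w : BigForm V m) : berezin w = berezinₗ V m w :=
  congrArg scalarPart (contractList_apply _ w).symm

theorem incl_ι (α : Covec V) :
    incl (m := m) (ExteriorAlgebra.ι ℂ α) = ExteriorAlgebra.ι ℂ (α, 0, 0) := by
  simp [incl]; rfl

/-- A contraction that kills the covectors of the base passes through a scalar form at the cost of
its parity sign. Contracting with a pair costs this sign twice, which is why the fiber integral is
linear over scalar forms. -/
theorem contractLeft_incl_mul {d : Module.Dual ℂ (Covec V × (Fin m → ℂ) × (Fin m → ℂ))}
    (hd : ∀ α : Covec V, d (α, 0, 0) = 0) (a : Form V) (w : BigForm V m) :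
    CliffordAlgebra.contractLeft d (incl a * w) =
      incl (parity a) * CliffordAlgebra.contractLeft d w := by
  induction a using ExteriorAlgebra.induction generalizing w with
  | algebraMap r =>
    simp only [AlgHom.commutes, CliffordAlgebra.contractLeft_algebraMap_mul]
  | ι v =>
    rw [incl_ι, CliffordAlgebra.contractLeft_ι_mul, hd, parity_ι, map_neg, incl_ι]
    simp
  | mul a b ha hb => rw [map_mul incl, mul_assoc, ha, hb, map_mul, map_mul, mul_assoc]
  | add a b ha hb => simp only [map_add, add_mul, ha, hb]

theorem coordE_inl (j : Fin m) (α : Covec V) :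
    coordE (V := V) j (α, 0, 0) = 0 := rfl

theorem coordEStar_inl (j : Fin m) (α : Covec V) :
    coordEStar (V := V) j (α, 0, 0) = 0 := rfl

theorem contractPair_incl_mul (j : Fin m) (a : Form V) (w : BigForm V m) :
    contractPair j (incl a * w) = incl a * contractPair j w := by
  simp only [contractPair, LinearMap.comp_apply]
  rw [contractLeft_incl_mul (coordE_inl j), contractLeft_incl_mul (coordEStar_inl j),
    parity_parity]

theorem scalarPart_incl (a : Form V) : scalarPart (m := m) (incl a) = a := by
  have : (scalarPart (V := V) (m := m)).comp incl = AlgHom.id ℂ _ := by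
    rw [scalarPart, incl, ExteriorAlgebra.map_comp_map, LinearMap.fst_comp_inl,
      ExteriorAlgebra.map_id]
  exact DFunLike.congr_fun this a

theorem berezin_incl_mul (a : Form V) (w : BigForm V m) :
    berezinₗ V m (incl a * w) = a * berezinₗ V m w := by
  have : ∀ l : List (Fin m), contractList l (incl a * w) = incl a * contractList l w := by
    intro l
    induction l with
    | nil => rfl
    | cons j l ih => rw [contractList_cons, ih, contractPair_incl_mul, contractList_cons]
  simp only [berezinₗ, LinearMap.comp_apply, this]
  simp [scalarPart_incl]

theorem contractPair_pair_mul {k j : Fin m} (h : k ≠ j) (w : BigForm V m) :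
    contractPair k (e j * eStar j * w) = e j * eStar j * contractPair k w := by
  have h1 : ∀ (d : Module.Dual ℂ (Covec V × (Fin m → ℂ) × (Fin m → ℂ)))
      (_ : d (0, Pi.single j 1, 0) = 0) (_ : d (0, 0, Pi.single j 1) = 0) (w : BigForm V m),
      CliffordAlgebra.contractLeft d (e j * eStar j * w) =
        e j * eStar j * CliffordAlgebra.contractLeft d w := by
    intro d hd hd' w
    rw [mul_assoc, e, eStar, CliffordAlgebra.contractLeft_ι_mul,
      CliffordAlgebra.contractLeft_ι_mul, hd, hd']
    simp [mul_assoc]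
  simp only [contractPair, LinearMap.comp_apply]
  rw [h1, h1]
  · rfl
  · simp [coordEStar, h]
  · simp [coordE, h]
  · rfl

theorem contractPair_self (j : Fin m) :
    contractPair (V := V) j (e j * eStar j) = 1 := by
  simp only [contractPair, LinearMap.comp_apply]
  rw [e, eStar, CliffordAlgebra.contractLeft_ι_mul, CliffordAlgebra.contractLeft_ι]
  simp [coordE, coordEStar]

/-- The product `e_j ∧ e_k^*` as an even element. -/
def pairEven (j k : Fin m) : evenPart (BigForm V m) :=
  ⟨e j * eStar k, by simp [mem_evenPart, e, eStar, parity_ι]⟩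

/-- This is the normalization of the fiber integral. Each pair is contracted with `e_j` before
`e_j^*`, in the order of the factors, and pairs of different index commute past one another, so no
sign appears. -/
theorem berezin_top : berezinₗ V m ((∏ j, pairEven j j : evenPart (BigForm V m)) : BigForm V m)
    = 1 := by
  have key : ∀ l : List (Fin m), l.Nodup →
      contractList (V := V) l ((l.map fun j => e j * eStar j).prod) = 1 := by
    intro l
    induction l with
    | nil => intro _; rfl
    | cons j l ih =>
      intro hl
      rw [List.nodup_cons] at hl
      have h2 : ∀ (l' : List (Fin m)) (_ : j ∉ l') (w : BigForm V m),
          contractList l' (e j * eStar j * w) = e j * eStar j * contractList l' w := by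
        intro l' hl' w
        induction l' with
        | nil => rfl
        | cons k l' ih =>
          simp only [List.mem_cons, not_or] at hl'
          rw [contractList_cons, ih hl'.2, contractPair_pair_mul (Ne.symm hl'.1), contractList_cons]
      rw [List.map_cons, List.prod_cons, contractList_cons, h2 l hl.1, ih hl.2, mul_one,
        contractPair_self]
  have h3 : ((∏ j, pairEven j j : evenPart (BigForm V m)) : BigForm V m) =
      ((List.finRange m).map fun j => e j * eStar j).prod := by
    rw [← List.ofFn_eq_map, ← List.prod_ofFn]
    change (evenPart (BigForm V m)).val _ = _
    rw [map_list_prod, List.map_ofFn]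
    rfl
  rw [h3, berezinₗ, LinearMap.comp_apply, key _ (List.nodup_finRange m)]
  simp

theorem ι_mul_ι_mul_ι {M : Type*} [AddCommGroup M] [Module ℂ M] (u v w : M) :
    ExteriorAlgebra.ι ℂ u * ExteriorAlgebra.ι ℂ v * ExteriorAlgebra.ι ℂ w =
      -(ExteriorAlgebra.ι ℂ w * ExteriorAlgebra.ι ℂ v * ExteriorAlgebra.ι ℂ u) := by
  have h : ∀ x y : M, ExteriorAlgebra.ι ℂ x * ExteriorAlgebra.ι ℂ y =
      -(ExteriorAlgebra.ι ℂ y * ExteriorAlgebra.ι ℂ x) := fun x y =>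
    eq_neg_of_add_eq_zero_left (ExteriorAlgebra.ι_add_mul_swap x y)
  rw [h u v, neg_mul, mul_assoc, h u w, mul_neg, ← mul_assoc, h v w]
  simp

theorem ι_mul_ι_mul_self {M : Type*} [AddCommGroup M] [Module ℂ M] (u v : M) :
    ExteriorAlgebra.ι ℂ u * ExteriorAlgebra.ι ℂ v * ExteriorAlgebra.ι ℂ u = 0 := by
  have h : ∀ x y : M, ExteriorAlgebra.ι ℂ x * ExteriorAlgebra.ι ℂ y =
      -(ExteriorAlgebra.ι ℂ y * ExteriorAlgebra.ι ℂ x) := fun x y =>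
    eq_neg_of_add_eq_zero_left (ExteriorAlgebra.ι_add_mul_swap x y)
  rw [mul_assoc, h v u, mul_neg, ← mul_assoc, ExteriorAlgebra.ι_sq_zero]
  simp

/-- Together with the next two relations, this supplies the hypotheses `hp`, `hp₁` and `hp₂` of
`sum_mul_pow_eq_det` for the pairs `e_j ∧ e_k^*`. -/
theorem pairEven_swap (j k l h : Fin m) :
    pairEven (V := V) j k * pairEven l h = -(pairEven j h * pairEven l k) := by
  refine Subtype.ext ?_
  change e j * eStar k * (e l * eStar h) = -(e j * eStar h * (e l * eStar k))
  simp only [e, eStar]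
  have := ι_mul_ι_mul_ι ((0, 0, Pi.single k 1) : Covec V × (Fin m → ℂ) × (Fin m → ℂ))
    (0, Pi.single l 1, 0) (0, 0, Pi.single h 1)
  simp only [mul_assoc] at this ⊢
  rw [this, mul_neg]

theorem pairEven_mul_left (j k h : Fin m) :
    pairEven (V := V) j k * pairEven j h = 0 := by
  refine Subtype.ext ?_
  change e j * eStar k * (e j * eStar h) = 0
  simp only [e, eStar]
  rw [← mul_assoc, ι_mul_ι_mul_self, zero_mul]

theorem pairEven_mul_right (j k l : Fin m) :
    pairEven (V := V) j k * pairEven l k = 0 := by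
  refine Subtype.ext ?_
  change e j * eStar k * (e l * eStar k) = 0
  simp only [e, eStar]
  rw [mul_assoc, ← mul_assoc (ExteriorAlgebra.ι ℂ _) _ (ExteriorAlgebra.ι ℂ _),
    ι_mul_ι_mul_self, mul_zero]

/-- The inclusion of even scalar forms. -/
def inclEven : evenPart (Form V) →ₐ[ℂ] evenPart (BigForm V m) :=
  (incl.comp (evenPart (Form V)).val).codRestrict _ fun a => by
    change parity (incl (a : Form V)) = _
    rw [incl, parity_map, a.2]; rfl

theorem snake_coe (B : Matrix (Fin m) (Fin m) (evenPart (Form V))) :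
    snake (B.map (evenPart (Form V)).val) =
      ((∑ j, ∑ k, inclEven (B j k) * pairEven j k : evenPart (BigForm V m)) : BigForm V m) := by
  simp only [snake, AddSubmonoidClass.coe_finsetSum]
  refine Finset.sum_congr rfl fun j _ => Finset.sum_congr rfl fun k _ => ?_
  change _ = incl (B j k : Form V) * (e j * eStar k)
  rw [mul_assoc]; rfl

theorem snake_pow_succ (B : Matrix (Fin m) (Fin m) (evenPart (Form V))) :
    snake (B.map (evenPart (Form V)).val) ^ (m + 1) = 0 := by
  rw [snake_coe, ← SubmonoidClass.coe_pow]
  have := (sum_mul_pow_eq_det _ pairEven_swap pairEven_mul_left pairEven_mul_right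
    (B.map (inclEven (V := V) (m := m)))).2
  simp only [Matrix.map_apply] at this
  rw [this]; rfl

theorem berezin_snake_pow (B : Matrix (Fin m) (Fin m) (evenPart (Form V))) :
    berezinₗ V m (divPow (snake (B.map (evenPart (Form V)).val)) m) = (B.det : Form V) := by
  rw [snake_coe, divPow, ← SubmonoidClass.coe_pow]
  have := (sum_mul_pow_eq_det _ pairEven_swap pairEven_mul_left pairEven_mul_right
    (B.map (inclEven (V := V) (m := m)))).1
  simp only [Matrix.map_apply] at this
  have h2 : (B.map (inclEven (V := V) (m := m))).det = inclEven B.det :=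
    (RingHom.map_det (inclEven (V := V) (m := m)).toRingHom B).symm
  have h3 : ((inclEven B.det * ∏ j, pairEven j j : evenPart (BigForm V m)) : BigForm V m) =
    incl (B.det : Form V) * ((∏ j, pairEven j j : evenPart (BigForm V m)) : BigForm V m) := rfl
  rw [this, h2, ← Nat.cast_smul_eq_nsmul ℂ]
  rw [Subalgebra.coe_smul, smul_smul, inv_mul_cancel₀ (by exact_mod_cast m.factorial_ne_zero),
    one_smul, h3, berezin_incl_mul, berezin_top, mul_one]

/-! ### Homogeneity -/

variable (V m) in
/-- Multiplication of all the `e_j` by `2`. -/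
def scaleE : BigForm V m →ₐ[ℂ] BigForm V m :=
  ExteriorAlgebra.map (LinearMap.prodMap LinearMap.id
    (LinearMap.prodMap ((2 : ℂ) • LinearMap.id) LinearMap.id))

theorem scaleE_incl (a : Form V) : scaleE V m (incl a) = incl a := by
  have : (scaleE V m).comp incl = incl := by
    rw [scaleE, incl, ExteriorAlgebra.map_comp_map]
    congr 1
    ext x <;> simp
  exact DFunLike.congr_fun this a

theorem scalarPart_scaleE (w : BigForm V m) : scalarPart (scaleE V m w) = scalarPart w := by
  have : scalarPart.comp (scaleE V m) = scalarPart := by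
    rw [scaleE, scalarPart, ExteriorAlgebra.map_comp_map]
    rfl
  exact DFunLike.congr_fun this w

theorem scaleE_snake (a : Matrix (Fin m) (Fin m) (Form V)) :
    scaleE V m (snake a) = (2 : ℂ) • snake a := by
  have h1 : ∀ j : Fin m, scaleE V m (e j) = (2 : ℂ) • e j := fun j => by
    rw [scaleE, e, ExteriorAlgebra.map_apply_ι, ← map_smul]
    congr 1
    ext <;> simp
  have h2 : ∀ j : Fin m, scaleE V m (eStar j) = eStar j := fun j => by
    rw [scaleE, eStar, ExteriorAlgebra.map_apply_ι]
    congr 1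
    ext <;> simp
  simp only [snake, map_sum, map_mul, scaleE_incl, h1, h2, Finset.smul_sum, mul_smul_comm,
    smul_mul_assoc]

theorem contractPair_scaleE (j : Fin m) (w : BigForm V m) :
    contractPair j (scaleE V m w) = (2 : ℂ) • scaleE V m (contractPair j w) := by
  simp only [contractPair, LinearMap.comp_apply, scaleE]
  rw [contractLeft_map]
  have h1 : (coordE j ∘ₗ LinearMap.prodMap LinearMap.id
      (LinearMap.prodMap ((2 : ℂ) • LinearMap.id) LinearMap.id) :
      Module.Dual ℂ (Covec V × (Fin m → ℂ) × (Fin m → ℂ))) = (2 : ℂ) • coordE j := by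
    ext <;> simp [coordE]
  have h2 : (coordEStar j ∘ₗ LinearMap.prodMap LinearMap.id
      (LinearMap.prodMap ((2 : ℂ) • LinearMap.id) LinearMap.id) :
      Module.Dual ℂ (Covec V × (Fin m → ℂ) × (Fin m → ℂ))) = coordEStar j := by
    ext <;> simp [coordEStar]
  rw [h1, contractLeft_map, h2]
  simp

theorem berezin_scaleE (w : BigForm V m) :
    berezinₗ V m (scaleE V m w) = (2 : ℂ) ^ m • berezinₗ V m w := by
  have : ∀ l : List (Fin m), contractList l (scaleE V m w) =
      (2 : ℂ) ^ l.length • scaleE V m (contractList l w) := by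
    intro l
    induction l with
    | nil => simp [contractList]
    | cons j l ih =>
      rw [contractList_cons, ih, map_smul, contractPair_scaleE, contractList_cons, smul_smul,
        List.length_cons, pow_succ]
  simp only [berezinₗ, LinearMap.comp_apply, this, List.length_finRange]
  simp [scalarPart_scaleE]

/-- Doubling all the `e_j` multiplies the integral by 2^m, and 2^n differs from 2^m. Eigenvectors of
`scaleE` thus do the work of a grading by degree in the frame. -/
theorem berezin_eq_zero {n : ℕ} (hn : n ≠ m) {w : BigForm V m}
    (hw : scaleE V m w = (2 : ℂ) ^ n • w) : berezinₗ V m w = 0 := by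
  have h := berezin_scaleE w
  rw [hw, map_smul, ← sub_eq_zero, ← sub_smul] at h
  refine (smul_eq_zero.1 h).resolve_left fun h0 => hn ?_
  have : (2 : ℕ) ^ n = 2 ^ m := by exact_mod_cast (sub_eq_zero.1 h0)
  exact Nat.pow_right_injective le_rfl this

theorem berezin_snake_mul_pow_of_ne {n : ℕ} (hn : n + 1 ≠ m)
    (x B : Matrix (Fin m) (Fin m) (Form V)) :
    berezinₗ V m (snake x * divPow (snake B) n) = 0 := by
  refine berezin_eq_zero hn ?_
  simp only [divPow, map_mul, map_smul, map_pow, scaleE_snake, smul_pow, smul_mul_assoc,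
    mul_smul_comm, smul_smul, pow_succ]
  congr 1; ring

theorem snake_single (j k : Fin m) :
    snake (V := V) (Matrix.single j k 1) = e j * eStar k := by
  rw [snake, Finset.sum_eq_single j, Finset.sum_eq_single k]
  · simp
  · intro b _ hb; simp [hb.symm]
  · simp
  · intro b _ hb; simp [hb.symm]
  · simp

theorem snake_add (a b : Matrix (Fin m) (Fin m) (Form V)) :
    snake (a + b) = snake a + snake b := by
  simp only [snake, Matrix.add_apply, map_add, add_mul, Finset.sum_add_distrib]

theorem snake_smul (c : ℂ) (a : Matrix (Fin m) (Fin m) (Form V)) :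
    snake (c • a) = c • snake a := by
  simp only [snake, Matrix.smul_apply, map_smul, smul_mul_assoc, Finset.smul_sum]

theorem det_add_single {R : Type*} [CommRing R] (B : Matrix (Fin m) (Fin m) R) (j k : Fin m) :
    (B + Matrix.single j k 1).det = B.det + B.adjugate k j := by
  have h : B + Matrix.single j k 1 = B.updateRow j (B j + Pi.single k 1) := by
    ext a b
    by_cases ha : a = j
    · subst ha
      by_cases hb : b = k
      · subst hb; simp
      · simp [hb, Ne.symm hb]
    · simp [Matrix.updateRow_ne ha, Ne.symm ha]
  rw [h, Matrix.det_updateRow_add, Matrix.updateRow_eq_self, Matrix.adjugate_apply]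

theorem inv_factorial_smul_add_pow {R : Type*} [Ring R] [Algebra ℂ R] {x y : R}
    (hc : Commute x y) (hy : y ^ 2 = 0) (n : ℕ) :
    (((n + 1).factorial : ℕ) : ℂ)⁻¹ • (x + y) ^ (n + 1) =
      (((n + 1).factorial : ℕ) : ℂ)⁻¹ • x ^ (n + 1) + y * (((n.factorial : ℕ) : ℂ)⁻¹ • x ^ n) := by
  rw [add_comm x y, hc.symm.add_pow, Finset.sum_range_succ', Finset.sum_range_succ']
  have hz : ∀ i, y ^ (i + 1 + 1) = 0 := fun i => by
    rw [pow_succ, pow_succ, mul_assoc, ← sq, hy, mul_zero]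
  simp only [hz, zero_mul, Finset.sum_const_zero, zero_add, pow_one, pow_zero, one_mul,
    Nat.sub_zero, Nat.choose_zero_right, Nat.choose_one_right, Nat.add_sub_cancel, smul_add,
    Nat.cast_one, mul_one, mul_smul_comm]
  rw [add_comm]
  congr 1
  rw [← Nat.cast_comm, ← nsmul_eq_mul, ← Nat.cast_smul_eq_nsmul ℂ, smul_smul]
  congr 1
  rw [Nat.factorial_succ]
  have : (n.factorial : ℂ) ≠ 0 := by exact_mod_cast n.factorial_ne_zero
  have : ((n + 1 : ℕ) : ℂ) ≠ 0 := by exact_mod_cast n.succ_ne_zero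
  push_cast at this ⊢
  field_simp

/-- Polarization of `berezin_snake_pow`: adding 1 to the entry (j, k) of `B` adds the square-zero
element `e_j ∧ e_k^*` to B̃. On one side the m-th divided power changes by its linear term, on the
other the determinant changes by a cofactor. -/
theorem berezin_pair_mul_pow {n : ℕ} (hn : n + 1 = m)
    (B : Matrix (Fin m) (Fin m) (evenPart (Form V))) (j k : Fin m) :
    berezinₗ V m (e j * eStar k * divPow (snake (B.map (evenPart (Form V)).val)) n) =
      (B.adjugate k j : Form V) := by
  have h1 : (B + Matrix.single j k 1).map (evenPart (Form V)).val =
      B.map (evenPart (Form V)).val + Matrix.single j k 1 := by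
    ext a b
    simp [Matrix.single_apply, apply_ite]
  have hE : (e j * eStar k : BigForm V m) ^ 2 = 0 := by
    rw [sq]
    exact congrArg Subtype.val (pairEven_mul_left (V := V) j k k)
  have hc : Commute (snake (B.map (evenPart (Form V)).val)) (e j * eStar k) :=
    (mul_comm_of_even _ _ (pairEven (V := V) j k).2).symm
  have h2 := berezin_snake_pow (V := V) (B + Matrix.single j k 1)
  rw [h1, snake_add, snake_single, det_add_single] at h2
  have h3 : divPow (snake (B.map (evenPart (Form V)).val) + e j * eStar k) m =
      divPow (snake (B.map (evenPart (Form V)).val)) m +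
        e j * eStar k * divPow (snake (B.map (evenPart (Form V)).val)) n := by
    subst hn
    exact inv_factorial_smul_add_pow hc hE n
  rw [h3, map_add, berezin_snake_pow] at h2
  exact add_left_cancel (h2.trans ((evenPart (Form V)).coe_add _ _))

/-- `∫_e x̃ ∧ B̃_{m-1}` is the trace of `x` times the adjugate of `B`. -/
theorem berezin_snake_mul_pow {n : ℕ} (hn : n + 1 = m) (x : Matrix (Fin m) (Fin m) (Form V))
    (B : Matrix (Fin m) (Fin m) (Form V)) (hB : ∀ i j, parity (B i j) = B i j) :
    berezinₗ V m (snake x * divPow (snake B) n) = (x * ladj B).trace := by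
  obtain ⟨B, rfl⟩ := exists_lift_even B hB
  rw [ladj_coe]
  simp only [snake, Finset.sum_mul, map_sum, Matrix.trace, Matrix.diag_apply, Matrix.mul_apply,
    Matrix.map_apply]
  refine Finset.sum_congr rfl fun j _ => Finset.sum_congr rfl fun k _ => ?_
  rw [mul_assoc, mul_assoc, ← mul_assoc (e j), berezin_incl_mul]
  congr 1
  exact berezin_pair_mul_pow hn B j k

theorem berezin_divPow_snake (B : Matrix (Fin m) (Fin m) (Form V))
    (hB : ∀ i j, parity (B i j) = B i j) :
    berezinₗ V m (divPow (snake B) m) = ldet B := by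
  obtain ⟨B, rfl⟩ := exists_lift_even B hB
  rw [ldet_coe, berezin_snake_pow]

theorem snake_pow_eq_zero (B : Matrix (Fin m) (Fin m) (Form V))
    (hB : ∀ i j, parity (B i j) = B i j) : snake B ^ (m + 1) = 0 := by
  obtain ⟨B, rfl⟩ := exists_lift_even B hB
  exact snake_pow_succ B

theorem snake_even (B : Matrix (Fin m) (Fin m) (Form V))
    (hB : ∀ i j, parity (B i j) = B i j) : parity (snake B) = snake B := by
  obtain ⟨B, rfl⟩ := exists_lift_even B hB
  rw [snake_coe]
  exact mem_evenPart.1 (SetLike.coe_mem _)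

end BerezinFormulas

/-! ## Differential superalgebras -/

section MatrixMap

variable {A : Type*} [Ring A] [Algebra ℂ A] {l k : Type*} {m : ℕ}

theorem matrix_map_add (d : A →ₗ[ℂ] A) (M N : Matrix l k A) :
    (M + N).map d = M.map d + N.map d := by ext; simp

theorem matrix_map_sub (d : A →ₗ[ℂ] A) (M N : Matrix l k A) :
    (M - N).map d = M.map d - N.map d := by ext; simp

theorem matrix_map_neg (d : A →ₗ[ℂ] A) (M : Matrix l k A) :
    (-M).map d = -M.map d := by ext; simp

theorem matrix_map_smul (d : A →ₗ[ℂ] A) (c : ℂ) (M : Matrix l k A) :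
    (c • M).map d = c • M.map d := by ext; simp

theorem map_trace (d : A →ₗ[ℂ] A) (M : Matrix (Fin m) (Fin m) A) :
    d M.trace = (M.map d).trace := by
  simp [Matrix.trace]

end MatrixMap

section Antiderivation

variable {A : Type*} [Ring A] [Algebra ℂ A] [Superalgebra A]

/-- Odd derivations of a superalgebra. -/
structure IsAntiderivation (d : A →ₗ[ℂ] A) : Prop where
  mul : ∀ a b, d (a * b) = d a * b + parity a * d b
  parity_map : ∀ a, parity (d a) = -d (parity a)

variable {d : A →ₗ[ℂ] A} {l n k : Type*}

theorem IsAntiderivation.one (h : IsAntiderivation d) : d 1 = 0 := by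
  have := h.mul 1 1
  simpa using this

theorem IsAntiderivation.matrix_mul [Fintype n] (h : IsAntiderivation d) (M : Matrix l n A)
    (N : Matrix n k A) :
    (M * N).map d = M.map d * N + M.map parity * N.map d := by
  ext i j
  simp only [Matrix.map_apply, Matrix.mul_apply, Matrix.add_apply, map_sum, h.mul,
    Finset.sum_add_distrib]

theorem IsAntiderivation.even_mul [Fintype n] (h : IsAntiderivation d) {M : Matrix l n A}
    (hM : M.map parity = M) (N : Matrix n k A) :
    (M * N).map d = M.map d * N + M * N.map d := by
  rw [h.matrix_mul, hM]

theorem IsAntiderivation.odd_mul [Fintype n] (h : IsAntiderivation d) {M : Matrix l n A}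
    (hM : M.map parity = -M) (N : Matrix n k A) :
    (M * N).map d = M.map d * N - M * N.map d := by
  rw [h.matrix_mul, hM, Matrix.neg_mul, sub_eq_add_neg]

theorem IsAntiderivation.even_map (h : IsAntiderivation d) {M : Matrix l k A}
    (hM : M.map parity = M) : (M.map d).map parity = -M.map d := by
  ext i j
  have := congrFun (congrFun hM i) j
  simp only [Matrix.map_apply] at this
  simp [h.parity_map, this]

theorem IsAntiderivation.odd_map (h : IsAntiderivation d) {M : Matrix l k A}
    (hM : M.map parity = -M) : (M.map d).map parity = M.map d := by
  ext i j
  have := congrFun (congrFun hM i) j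
  simp only [Matrix.map_apply, Matrix.neg_apply] at this
  simp [h.parity_map, this]

variable {M : Matrix l n A} {N : Matrix n k A}

theorem even_mul_even [Fintype n] (hM : M.map parity = M) (hN : N.map parity = N) :
    (M * N).map parity = M * N := by
  rw [Matrix.map_mul, hM, hN]

theorem even_mul_odd [Fintype n] (hM : M.map parity = M) (hN : N.map parity = -N) :
    (M * N).map parity = -(M * N) := by
  rw [Matrix.map_mul, hM, hN, Matrix.mul_neg]

theorem odd_mul_even [Fintype n] (hM : M.map parity = -M) (hN : N.map parity = N) :
    (M * N).map parity = -(M * N) := by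
  rw [Matrix.map_mul, hM, hN, Matrix.neg_mul]

theorem matrix_map_parity_add (M N : Matrix l k A) :
    (M + N).map parity = M.map parity + N.map parity := by ext; simp

theorem matrix_map_parity_sub (M N : Matrix l k A) :
    (M - N).map parity = M.map parity - N.map parity := by ext; simp

theorem matrix_map_parity_smul (c : ℂ) (M : Matrix l k A) :
    (c • M).map parity = c • M.map parity := by ext; simp

theorem matrix_map_parity_one [DecidableEq k] :
    (1 : Matrix k k A).map parity = 1 := by
  rw [Matrix.map_one] <;> simp

theorem IsAntiderivation.matrix_one (h : IsAntiderivation d) [DecidableEq k] :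
    (1 : Matrix k k A).map d = 0 := by
  ext i j
  by_cases hij : i = j
  · subst hij; simp [h.one]
  · simp [hij]

/-- Even matrices can be moved cyclically under the trace. -/
theorem trace_mul_comm_even [Fintype n] {M : Matrix l n A} [Fintype l] {N : Matrix n l A}
    (hM : M.map parity = M) : (M * N).trace = (N * M).trace := by
  simp only [Matrix.trace, Matrix.diag_apply, Matrix.mul_apply]
  rw [Finset.sum_comm]
  exact Finset.sum_congr rfl fun j _ => Finset.sum_congr rfl fun i _ =>
    mul_comm_of_even _ _ (congrFun (congrFun hM i) j)

variable {m : ℕ}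

theorem ladj_even {M : Matrix (Fin m) (Fin m) A} (hM : M.map parity = M) :
    (ladj M).map parity = ladj M := by
  rw [map_ladj, hM]

theorem exists_lift_even' {l n : Type*} {M : Matrix l n A} (hM : M.map parity = M) :
    ∃ M' : Matrix l n (evenPart A), M = M'.map (evenPart A).val :=
  exists_lift_even M fun i j => congrFun (congrFun hM i) j

theorem mul_ladj {M : Matrix (Fin m) (Fin m) A} (hM : M.map parity = M) :
    M * ladj M = ldet M • (1 : Matrix (Fin m) (Fin m) A) := by
  obtain ⟨M, rfl⟩ := exists_lift_even' hM
  rw [ladj_coe, ldet_coe, ← Matrix.map_mul, Matrix.mul_adjugate]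
  ext i j
  by_cases h : i = j <;> simp [h]

theorem ladj_mul {M : Matrix (Fin m) (Fin m) A} (hM : M.map parity = M) :
    ladj M * M = ldet M • (1 : Matrix (Fin m) (Fin m) A) := by
  obtain ⟨M, rfl⟩ := exists_lift_even' hM
  rw [ladj_coe, ldet_coe, ← Matrix.map_mul, Matrix.adjugate_mul]
  ext i j
  by_cases h : i = j <;> simp [h]

theorem ldet_even {M : Matrix (Fin m) (Fin m) A} (hM : M.map parity = M) :
    parity (ldet M) = ldet M := by
  rw [map_ldet, hM]

/-- The restriction of an antiderivation to the even part is a derivation. -/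
theorem IsAntiderivation.prod (h : IsAntiderivation d) {ι : Type*} [DecidableEq ι]
    (s : Finset ι) (f : ι → evenPart A) :
    d ((∏ i ∈ s, f i : evenPart A) : A) =
      ∑ i ∈ s, ((∏ k ∈ s.erase i, f k : evenPart A) : A) * d (f i) := by
  induction s using Finset.induction_on with
  | empty => simp [h.one]
  | insert a s ha ih =>
    rw [Finset.prod_insert ha, Finset.sum_insert ha, Finset.erase_insert ha]
    rw [MulMemClass.coe_mul, h.mul, ih, mem_evenPart.1 (f a).2, add_comm, Finset.mul_sum]
    rw [← mul_comm_of_even _ (d (f a : A)) (mem_evenPart.1 (SetLike.coe_mem (∏ i ∈ s, f i)))]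
    rw [add_comm]
    congr 1
    refine Finset.sum_congr rfl fun i hi => ?_
    have hia : i ≠ a := fun h => ha (h ▸ hi)
    rw [Finset.erase_insert_of_ne hia.symm, Finset.prod_insert (fun h => ha (Finset.mem_of_mem_erase h)),
      MulMemClass.coe_mul, mul_assoc]

/-- Jacobi's formula. -/
theorem IsAntiderivation.det (h : IsAntiderivation d) {M : Matrix (Fin m) (Fin m) A}
    (hM : M.map parity = M) : d (ldet M) = (ladj M * M.map d).trace := by
  obtain ⟨M, rfl⟩ := exists_lift_even' hM
  rw [ladj_coe, ldet_coe, Matrix.det_apply']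
  have h1 : ∀ (σ : Equiv.Perm (Fin m)) (x : evenPart A),
      (((((Equiv.Perm.sign σ : ℤ) : evenPart A) * x : evenPart A)) : A) =
        ((Equiv.Perm.sign σ : ℤ) : ℂ) • (x : A) := fun σ x => by
    rw [Algebra.smul_def]; simp
  -- The cofactor as a sum over the permutations with `σ i = j`, with the factor of column `i` left
  -- out. Deriving the Leibniz formula factor by factor produces exactly these sums.
  have h2 : ∀ i j, M.adjugate i j = ∑ σ : Equiv.Perm (Fin m), if σ i = j then
      ((Equiv.Perm.sign σ : ℤ) : evenPart A) * ∏ k ∈ Finset.univ.erase i, M (σ k) k else 0 := by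
    intro i j
    rw [Matrix.adjugate_apply, Matrix.det_apply']
    refine Finset.sum_congr rfl fun σ _ => ?_
    split_ifs with hσ
    · rw [← Finset.mul_prod_erase _ _ (Finset.mem_univ i), hσ, Matrix.updateRow_self,
        Pi.single_eq_same, one_mul]
      congr 1
      refine Finset.prod_congr rfl fun k hk => ?_
      rw [Matrix.updateRow_ne]
      rw [← hσ]
      exact fun he => (Finset.ne_of_mem_erase hk) (σ.injective he)
    · rw [Finset.prod_eq_zero (Finset.mem_univ (σ.symm j)), mul_zero]
      rw [Equiv.apply_symm_apply, Matrix.updateRow_self, Pi.single_eq_of_ne]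
      exact fun he => hσ (by rw [← he, Equiv.apply_symm_apply])
  simp only [AddSubmonoidClass.coe_finsetSum, h1, map_sum, map_smul, h.prod, Finset.smul_sum]
  rw [Finset.sum_comm]
  simp only [Matrix.trace, Matrix.diag_apply, Matrix.mul_apply, Matrix.map_apply]
  refine Finset.sum_congr rfl fun i _ => ?_
  have h3 : ∀ j, (evenPart A).val (M.adjugate i j) * d ((evenPart A).val (M j i)) =
      ∑ σ : Equiv.Perm (Fin m), if σ i = j then ((Equiv.Perm.sign σ : ℤ) : ℂ) •
        (((∏ k ∈ Finset.univ.erase i, M (σ k) k : evenPart A) : A) * d (M (σ i) i)) else 0 := by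
    intro j
    rw [h2, map_sum, Finset.sum_mul]
    refine Finset.sum_congr rfl fun σ _ => ?_
    split_ifs with hσ
    · subst hσ
      have := h1 σ (∏ k ∈ Finset.univ.erase i, M (σ k) k)
      change ((((Equiv.Perm.sign σ : ℤ) : evenPart A) * _ : evenPart A) : A) * _ = _
      rw [this, smul_mul_assoc]; rfl
    · simp
  simp only [h3]
  rw [Finset.sum_comm]
  simp

end Antiderivation

/-- An algebra of differential forms: a superalgebra with two anticommuting odd derivations of
square zero, the second of which takes nilpotent values on odd elements. -/
class DiffSuperalgebra (A : Type*) [Ring A] [Algebra ℂ A] extends Superalgebra A where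
  /-- the operator `∂` -/
  dl : A →ₗ[ℂ] A
  /-- the operator `∂̄` -/
  db : A →ₗ[ℂ] A
  dl_anti : IsAntiderivation dl
  db_anti : IsAntiderivation db
  dl_dl : ∀ a, dl (dl a) = 0
  db_db : ∀ a, db (db a) = 0
  db_dl : ∀ a, db (dl a) = -dl (db a)
  db_nilpotent : ∀ a, parity a = -a → IsNilpotent (db a)

export DiffSuperalgebra (dl db dl_anti db_anti dl_dl db_db db_dl db_nilpotent)

/-! ### The pencil of connections θ − μγ, its Bianchi identity and the derivative of traces -/

section Connections

variable {A : Type*} [Ring A] [Algebra ℂ A] [DiffSuperalgebra A] {l k : Type*} {m : ℕ}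

theorem mdl_mdl (M : Matrix l k A) : (M.map dl).map dl = 0 := by ext; simp [dl_dl]
theorem mdb_mdb (M : Matrix l k A) : (M.map db).map db = 0 := by ext; simp [db_db]
theorem mdb_mdl (M : Matrix l k A) : (M.map dl).map db = -(M.map db).map dl := by
  ext; simp [db_dl]

/-- If the even matrix `M` is covariantly constant for the connection `∂ + N`, so is its
determinant. -/
theorem dl_ldet_eq_zero {M N : Matrix (Fin m) (Fin m) A} (hM : M.map parity = M)
    (h : M.map dl = M * N - N * M) : dl (ldet M) = 0 := by
  -- By Jacobi's formula the derivative is the trace of adj M · [M, N]; since `M` is even it can be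
  -- moved cyclically, and both halves of the commutator give det M · tr N.
  rw [dl_anti.det hM, h, Matrix.mul_sub, Matrix.trace_sub, ← mul_assoc, ladj_mul hM,
    ← mul_assoc, ← trace_mul_comm_even hM, ← mul_assoc, mul_ladj hM, sub_self]

/-- If the invertible even matrix `M` is covariantly constant for the connection `∂ + N`, so is
its adjugate. -/
theorem dl_ladj {M N : Matrix (Fin m) (Fin m) A} (hM : M.map parity = M)
    (hu : IsUnit (ldet M)) (h : M.map dl = M * N - N * M) :
    (ladj M).map dl = ladj M * N - N * ladj M := by
  -- Differentiating M adj M = det M · 1, whose right side is killed by ∂, shows that `M`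
  -- annihilates the defect of the claimed identity. Multiplying by adj M leaves det M times the
  -- defect, and det M is a unit.
  have h1 := congrArg (fun X => X.map dl) (mul_ladj hM)
  have h2 : (ldet M • (1 : Matrix (Fin m) (Fin m) A)).map dl = 0 := by
    ext i j
    by_cases hij : i = j
    · subst hij; simp [dl_ldet_eq_zero hM h]
    · simp [hij]
  simp only [dl_anti.even_mul hM, h, h2, sub_mul] at h1
  have hc : ldet M • (1 : Matrix (Fin m) (Fin m) A) * N =
      N * (ldet M • (1 : Matrix (Fin m) (Fin m) A)) := by
    ext i j
    simp [Matrix.mul_apply, Matrix.one_apply, mul_comm_of_even _ _ (ldet_even hM)]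
  have h3 : M * ((ladj M).map dl - (ladj M * N - N * ladj M)) = 0 := by
    have : M * ((ladj M).map dl - (ladj M * N - N * ladj M)) =
      M * N * ladj M - N * M * ladj M + M * (ladj M).map dl
        - ((M * ladj M) * N - N * (M * ladj M)) := by noncomm_ring
    rw [this, h1, mul_ladj hM, hc, sub_self, sub_self]
  have h4 : ladj M * M * ((ladj M).map dl - (ladj M * N - N * ladj M)) = 0 := by
    rw [mul_assoc, h3, mul_zero]
  rw [ladj_mul hM] at h4
  rw [← sub_eq_zero]
  ext i j
  have h5 := congrFun (congrFun h4 i) j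
  rw [smul_mul_assoc, one_mul, Matrix.smul_apply, smul_eq_mul, Matrix.zero_apply] at h5
  exact (hu.mul_right_eq_zero).1 h5

/-- Modulo the nilradical of the even part the matrix becomes the identity, so its determinant is 1
plus a nilpotent element. -/
theorem isUnit_ldet_one_add {M : Matrix (Fin m) (Fin m) A} (hM : M.map parity = M)
    (hn : ∀ i j, IsNilpotent (M i j)) : IsUnit (ldet (1 + M)) := by
  obtain ⟨M, rfl⟩ := exists_lift_even' hM
  have h1 : (1 : Matrix (Fin m) (Fin m) A) + M.map (evenPart A).val =
      (1 + M).map (evenPart A).val := by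
    ext i j
    by_cases hij : i = j <;> simp [hij]
  rw [h1, ldet_coe]
  suffices IsUnit (1 + M).det from this.map (evenPart A).val
  have h2 : ∀ i j, M i j ∈ nilradical (evenPart A) := by
    intro i j
    obtain ⟨n, hn⟩ := hn i j
    exact ⟨n, Subtype.ext hn⟩
  let q := Ideal.Quotient.mk (nilradical (evenPart A))
  have h3 : q (1 + M).det = 1 := by
    rw [RingHom.map_det, ← Matrix.det_one (n := Fin m)]
    congr 1
    ext i j
    have : q (M i j) = 0 := Ideal.Quotient.eq_zero_iff_mem.2 (h2 i j)
    simp [this, Matrix.one_apply, apply_ite q]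
  have h4 : IsNilpotent ((1 + M).det - 1) := by
    rw [← mem_nilradical, ← Ideal.Quotient.eq_zero_iff_mem, map_sub]
    rw [map_one, sub_eq_zero]
    exact h3
  have := h4.isUnit_one_add
  rwa [add_sub_cancel] at this

/-- The matrix `H⁻¹ ∂H` of the Chern connection. -/
def conn (Hi H : Matrix (Fin m) (Fin m) A) : Matrix (Fin m) (Fin m) A := Hi * H.map dl

/-- The `(1,0)`-part of the covariant derivative of an endomorphism. -/
def gam (Hi H P : Matrix (Fin m) (Fin m) A) : Matrix (Fin m) (Fin m) A :=
  P.map dl + conn Hi H * P - P * conn Hi H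

/-- The connection matrix `θ - μ γ`. -/
def connμ (Hi H P : Matrix (Fin m) (Fin m) A) (μ : ℂ) : Matrix (Fin m) (Fin m) A :=
  conn Hi H - μ • gam Hi H P

/-- `I + ℵ (Θ - μ ∂̄γ)`. -/
def chernMatrix (Hi H P : Matrix (Fin m) (Fin m) A) (μ : ℂ) : Matrix (Fin m) (Fin m) A :=
  1 + aleph • (connμ Hi H P μ).map db

theorem mdb_chernMatrix (Hi H P : Matrix (Fin m) (Fin m) A) (μ : ℂ) : (chernMatrix Hi H P μ).map db = 0 := by
  rw [chernMatrix, matrix_map_add, matrix_map_smul, mdb_mdb, db_anti.matrix_one]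
  simp

/-- `H` is an invertible even matrix with inverse `Hi`. -/
structure IsMetric (Hi H : Matrix (Fin m) (Fin m) A) : Prop where
  even : H.map parity = H
  even' : Hi.map parity = Hi
  mul : H * Hi = 1
  mul' : Hi * H = 1

section Metric

variable {Hi H : Matrix (Fin m) (Fin m) A} (h : IsMetric Hi H)
include h

theorem IsMetric.conn_odd : (conn Hi H).map parity = -conn Hi H :=
  even_mul_odd h.even' (dl_anti.even_map h.even)

theorem IsMetric.dl_inv : Hi.map dl = -(conn Hi H * Hi) := by
  have h1 := congrArg (fun X => X.map dl) h.mul'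
  simp only [dl_anti.even_mul h.even', dl_anti.matrix_one] at h1
  have h2 : (Hi.map dl * H + Hi * H.map dl) * Hi = 0 := by rw [h1, zero_mul]
  rw [add_mul, mul_assoc, h.mul, mul_one] at h2
  exact eq_neg_of_add_eq_zero_left h2

/-- A matrix of the form H⁻¹∂H is flat in the ∂ direction. Hence the curvature dθ + θθ of the Chern
connection reduces to ∂̄θ. -/
theorem IsMetric.dl_conn : (conn Hi H).map dl = -(conn Hi H * conn Hi H) := by
  conv_lhs => rw [conn, dl_anti.even_mul h.even', mdl_mdl, h.dl_inv, mul_zero, add_zero]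
  rw [neg_mul, mul_assoc]; rfl

theorem IsMetric.dl_eq : H.map dl = H * conn Hi H := by
  rw [conn, ← mul_assoc, h.mul, one_mul]

variable {P : Matrix (Fin m) (Fin m) A} (hP : P.map parity = P)
include hP

theorem IsMetric.gam_odd : (gam Hi H P).map parity = -gam Hi H P := by
  rw [gam, matrix_map_parity_sub, matrix_map_parity_add, odd_mul_even h.conn_odd hP,
    even_mul_odd hP h.conn_odd, dl_anti.even_map hP]
  abel

theorem IsMetric.connμ_odd (μ : ℂ) : (connμ Hi H P μ).map parity = -connμ Hi H P μ := by
  rw [connμ, matrix_map_parity_sub, matrix_map_parity_smul, h.conn_odd, h.gam_odd hP, smul_neg]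
  abel

/-- By flatness in the ∂ direction the (1,0) covariant derivative of endomorphisms has square zero,
so it kills γ. The plus sign occurs because γ is odd. -/
theorem IsMetric.dl_gam :
    (gam Hi H P).map dl = -(conn Hi H * gam Hi H P + gam Hi H P * conn Hi H) := by
  conv_lhs => rw [gam, matrix_map_sub, matrix_map_add, mdl_mdl, dl_anti.even_mul hP,
    dl_anti.odd_mul h.conn_odd, h.dl_conn]
  rw [gam]
  noncomm_ring

theorem IsMetric.chernMatrix_even (μ : ℂ) :
    (chernMatrix Hi H P μ).map parity = chernMatrix Hi H P μ := by
  rw [chernMatrix, matrix_map_parity_add, matrix_map_parity_one, matrix_map_parity_smul,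
    db_anti.odd_map (h.connμ_odd hP μ)]

theorem IsMetric.isUnit_ldet (μ : ℂ) : IsUnit (ldet (chernMatrix Hi H P μ)) := by
  refine isUnit_ldet_one_add ?_ fun i j => ?_
  · rw [matrix_map_parity_smul, db_anti.odd_map (h.connμ_odd hP μ)]
  · have := db_nilpotent (connμ Hi H P μ i j)
      (congrFun (congrFun (h.connμ_odd hP μ) i) j)
    exact this.smul aleph

/-- The even ∂̄-closed elements form a subalgebra. It contains the entries of the matrix, and
therefore also its determinant and the entries of its adjugate. -/
theorem IsMetric.chernMatrix_mem (μ : ℂ) :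
    ∃ K : Subalgebra ℂ A, (∀ i j, chernMatrix Hi H P μ i j ∈ K) ∧ ∀ a ∈ K, db a = 0 := by
  let K : Subalgebra ℂ A :=
    { carrier := {a | parity a = a ∧ db a = 0}
      mul_mem' := fun {a b} ha hb => ⟨by rw [map_mul, ha.1, hb.1], by
        rw [db_anti.mul, ha.2, hb.2]; simp⟩
      add_mem' := fun {a b} ha hb => ⟨by rw [map_add, ha.1, hb.1], by
        rw [map_add, ha.2, hb.2]; simp⟩
      algebraMap_mem' := fun r => ⟨AlgHom.commutes _ r, by
        rw [Algebra.algebraMap_eq_smul_one, map_smul, db_anti.one, smul_zero]⟩ }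
  exact ⟨K, fun i j => ⟨congrFun (congrFun (h.chernMatrix_even hP μ) i) j,
    congrFun (congrFun (mdb_chernMatrix Hi H P μ) i) j⟩, fun a ha => ha.2⟩

theorem IsMetric.db_ldet (μ : ℂ) : db (ldet (chernMatrix Hi H P μ)) = 0 := by
  obtain ⟨K, h1, h2⟩ := h.chernMatrix_mem hP μ
  exact h2 _ (ldet_mem K h1)

theorem IsMetric.db_ladj (μ : ℂ) : (ladj (chernMatrix Hi H P μ)).map db = 0 := by
  obtain ⟨K, h1, h2⟩ := h.chernMatrix_mem hP μ
  ext i j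
  exact h2 _ (ladj_mem K h1 i j)

/-- `∂̄ tr (γ adj) = tr (∂̄γ adj)`. -/
theorem IsMetric.db_trace_gam (μ : ℂ) :
    db (gam Hi H P * ladj (chernMatrix Hi H P μ)).trace =
      ((gam Hi H P).map db * ladj (chernMatrix Hi H P μ)).trace := by
  rw [map_trace, db_anti.odd_mul (h.gam_odd hP), h.db_ladj hP, mul_zero, sub_zero]

/-- Bianchi's identity for `θ - μ γ`. -/
theorem IsMetric.dl_chernMatrix (μ : ℂ)
    (hc : (connμ Hi H P μ).map dl = -(connμ Hi H P μ * connμ Hi H P μ)) :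
    (chernMatrix Hi H P μ).map dl =
      chernMatrix Hi H P μ * connμ Hi H P μ - connμ Hi H P μ * chernMatrix Hi H P μ := by
  have h1 : ((connμ Hi H P μ).map db).map dl =
      (connμ Hi H P μ).map db * connμ Hi H P μ - connμ Hi H P μ * (connμ Hi H P μ).map db := by
    rw [← neg_neg (((connμ Hi H P μ).map db).map dl), ← mdb_mdl, hc, matrix_map_neg, neg_neg,
      db_anti.odd_mul (h.connμ_odd hP μ)]
  conv_lhs => rw [chernMatrix, matrix_map_add, matrix_map_smul, dl_anti.matrix_one, h1]
  rw [chernMatrix, add_mul, mul_add, smul_mul_assoc, mul_smul_comm, smul_sub]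
  simp

variable (hPP : P * P = P) (hPγ : P * gam Hi H P = 0)
include hPP

-- The covariant derivative of endomorphisms is a derivation; this is its effect on P² = P.
omit h in
theorem gam_decomp : gam Hi H P = gam Hi H P * P + P * gam Hi H P := by
  have h1 := congrArg (fun X => X.map dl) hPP
  simp only [dl_anti.even_mul hP] at h1
  have h2 : gam Hi H P * P + P * gam Hi H P = P.map dl * P + P * P.map dl
      + conn Hi H * (P * P) - (P * P) * conn Hi H := by rw [gam]; noncomm_ring
  rw [h2, h1, hPP]; rfl

include hPγ

-- Together with Pγ = 0 this says that γ sees only the image of `P` and takes values in the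
-- complement: it is a second fundamental form, and composing it with itself gives zero.
omit h in
theorem gam_mul : gam Hi H P * P = gam Hi H P := by
  have := gam_decomp (Hi := Hi) (H := H) hP hPP
  rw [hPγ, add_zero] at this
  exact this.symm

omit h in
theorem gam_mul_gam : gam Hi H P * gam Hi H P = 0 := by
  nth_rewrite 1 [← gam_mul hP hPP hPγ]
  rw [mul_assoc, hPγ, mul_zero]

/-- After `dl_conn` and `dl_gam` the two sides differ only by μ²γγ, which vanishes. So the whole
pencil is flat in the ∂ direction, and the curvature of each member is ∂̄ of its connection matrix.
-/
theorem IsMetric.dl_connμ (μ : ℂ) :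
    (connμ Hi H P μ).map dl = -(connμ Hi H P μ * connμ Hi H P μ) := by
  conv_lhs => rw [connμ, matrix_map_sub, matrix_map_smul, h.dl_gam hP, h.dl_conn]
  rw [connμ, sub_mul, mul_sub, mul_sub]
  simp only [smul_mul_assoc, mul_smul_comm, gam_mul_gam hP hPP hPγ, smul_zero]
  rw [smul_neg, smul_add]
  abel

/-- The covariant derivative of `tr (P adj (I + ℵ (Θ - μ ∂̄γ)))`. -/
theorem IsMetric.dl_trace (μ : ℂ) :
    dl (P * ladj (chernMatrix Hi H P μ)).trace =
      (1 - μ) • (gam Hi H P * ladj (chernMatrix Hi H P μ)).trace := by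
  set C := chernMatrix Hi H P μ with hC
  set N := connμ Hi H P μ with hN
  have hCe : C.map parity = C := h.chernMatrix_even hP μ
  have h1 : (ladj C).map dl = ladj C * N - N * ladj C :=
    dl_ladj hCe (h.isUnit_ldet hP μ) (h.dl_chernMatrix hP μ (h.dl_connμ hP hPP hPγ μ))
  rw [map_trace, dl_anti.even_mul hP, h1]
  have h2 : (P * (ladj C * N)).trace = (N * P * ladj C).trace := by
    rw [← mul_assoc, trace_mul_comm_even (even_mul_even hP (ladj_even hCe)), mul_assoc]
  -- The covariant derivative of `P` for θ − μγ is γ − μ[γ, P], and [γ, P] = γP − Pγ = γ. This is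
  -- the source of the factor 1 − μ.
  have h3 : P.map dl + N * P - P * N = (1 - μ) • gam Hi H P := by
    have : P.map dl + N * P - P * N = gam Hi H P - μ • (gam Hi H P * P) +
        μ • (P * gam Hi H P) := by
      rw [hN, connμ, sub_mul, mul_sub, smul_mul_assoc, mul_smul_comm]
      conv_rhs => enter [1, 1]; rw [gam]
      abel
    rw [this, hPγ, gam_mul hP hPP hPγ, smul_zero, add_zero, sub_smul, one_smul]
  rw [mul_sub, Matrix.trace_add, Matrix.trace_sub, h2, ← mul_assoc, ← Matrix.trace_sub,
    ← Matrix.trace_add, ← sub_mul, ← add_mul, ← Matrix.trace_smul, ← smul_mul_assoc, ← h3]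
  congr 2
  abel

end Metric

end Connections

/-! ## Short exact sequences -/

section ExactSequence

variable {A : Type*} [Ring A] [Algebra ℂ A] [DiffSuperalgebra A] {m r q : ℕ}

/-- The matrices of a short exact sequence of Hermitian holomorphic bundles with the induced
metrics; `J'` and `G'` are the conjugate transposes of `J` and `G`. -/
structure IsExactData (Hi H : Matrix (Fin m) (Fin m) A) (HSi HS : Matrix (Fin r) (Fin r) A)
    (HQi HQ : Matrix (Fin q) (Fin q) A) (J : Matrix (Fin m) (Fin r) A)
    (J' : Matrix (Fin r) (Fin m) A) (G : Matrix (Fin q) (Fin m) A)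
    (G' : Matrix (Fin m) (Fin q) A) : Prop where
  metric : IsMetric Hi H
  metricS : IsMetric HSi HS
  metricQ : IsMetric HQi HQ
  evenJ : J.map parity = J
  evenJ' : J'.map parity = J'
  evenG : G.map parity = G
  evenG' : G'.map parity = G'
  dbJ : J.map db = 0
  dlJ' : J'.map dl = 0
  dbG : G.map db = 0
  dlG' : G'.map dl = 0
  HS_eq : HS = J' * H * J
  HQi_eq : HQi = G * Hi * G'
  GJ : G * J = 0
  J'G' : J' * G' = 0
  split : J * (HSi * J' * H) + (Hi * G' * HQ) * G = 1

variable {Hi H : Matrix (Fin m) (Fin m) A} {HSi HS : Matrix (Fin r) (Fin r) A}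
    {HQi HQ : Matrix (Fin q) (Fin q) A} {J : Matrix (Fin m) (Fin r) A}
    {J' : Matrix (Fin r) (Fin m) A} {G : Matrix (Fin q) (Fin m) A}
    {G' : Matrix (Fin m) (Fin q) A} (h : IsExactData Hi H HSi HS HQi HQ J J' G G')
include h

theorem IsExactData.WJ : HSi * J' * H * J = 1 := by
  rw [← h.metricS.mul', h.HS_eq]
  simp only [Matrix.mul_assoc]

theorem IsExactData.GL : G * (Hi * G' * HQ) = 1 := by
  rw [← h.metricQ.mul', h.HQi_eq]
  simp only [Matrix.mul_assoc]

theorem IsExactData.even_proj : (J * (HSi * J' * H)).map parity = J * (HSi * J' * H) :=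
  even_mul_even h.evenJ
    (even_mul_even (even_mul_even h.metricS.even' h.evenJ') h.metric.even)

theorem IsExactData.proj_mul_proj :
    J * (HSi * J' * H) * (J * (HSi * J' * H)) = J * (HSi * J' * H) := by
  have : J * (HSi * J' * H) * (J * (HSi * J' * H)) = J * ((HSi * J' * H * J) * (HSi * J' * H)) := by
    simp only [Matrix.mul_assoc]
  rw [this, h.WJ, Matrix.one_mul]

theorem IsExactData.proj_mul_J : J * (HSi * J' * H) * J = J := by
  rw [Matrix.mul_assoc, h.WJ, Matrix.mul_one]

theorem IsExactData.J'H_mul_proj : J' * H * (J * (HSi * J' * H)) = J' * H := by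
  have : J' * H * (J * (HSi * J' * H)) = (J' * H * J) * HSi * (J' * H) := by
    simp only [Matrix.mul_assoc]
  rw [this, ← h.HS_eq, h.metricS.mul, Matrix.one_mul]

/-- Differentiate J' H P = J' H. The conjugate transpose of a holomorphic matrix is killed by ∂, so
only `H` and `P` contribute and what remains is J' H γ = 0. The projection has J' H as its right
factor. -/
theorem IsExactData.proj_mul_gam :
    J * (HSi * J' * H) * gam Hi H (J * (HSi * J' * H)) = 0 := by
  set P := J * (HSi * J' * H) with hP
  have h1 := congrArg (fun X => X.map dl) h.J'H_mul_proj
  simp only [dl_anti.even_mul (even_mul_even h.evenJ' h.metric.even),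
    dl_anti.even_mul h.evenJ', h.dlJ', Matrix.zero_mul, zero_add, ← hP, h.metric.dl_eq] at h1
  have h2 : J' * H * gam Hi H P = 0 := by
    rw [gam, Matrix.mul_sub, Matrix.mul_add, ← Matrix.mul_assoc (J' * H) P, hP,
      h.J'H_mul_proj, ← hP]
    rw [sub_eq_zero]
    simp only [Matrix.mul_assoc] at h1 ⊢
    rw [← h1]
    abel
  have h3 : ∀ X : Matrix (Fin m) (Fin m) A, P * X = J * HSi * (J' * H * X) := by
    intro X
    rw [hP]
    simp only [Matrix.mul_assoc]
  rw [h3, h2, Matrix.mul_zero]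

/-- At μ = 1 the part of the connection that leaves S has been removed: θ − γ preserves the image of
`J` and restricts there to the Chern connection of S. -/
theorem IsExactData.connμ_one_mul_J :
    connμ Hi H (J * (HSi * J' * H)) 1 * J + J.map dl = J * conn HSi HS := by
  set P := J * (HSi * J' * H) with hP
  have h1 : J * conn HSi HS = P * (conn Hi H * J + J.map dl) := by
    conv_lhs => rw [conn, h.HS_eq, dl_anti.even_mul (even_mul_even h.evenJ' h.metric.even),
      dl_anti.even_mul h.evenJ', h.dlJ', Matrix.zero_mul, zero_add, h.metric.dl_eq]
    rw [hP]
    simp only [Matrix.mul_assoc, Matrix.mul_add]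
  have h2 := congrArg (fun X => X.map dl) h.proj_mul_J
  simp only [← hP, dl_anti.even_mul (show P.map parity = P from h.even_proj)] at h2
  rw [h1, connμ, gam, one_smul, Matrix.sub_mul, Matrix.sub_mul, Matrix.add_mul, Matrix.mul_add]
  simp only [Matrix.mul_assoc, show P * J = J from h.proj_mul_J, eq_sub_of_add_eq h2]
  abel

/-- The counterpart on the quotient: θ − γ descends along `G` to the Chern connection of Q. -/
theorem IsExactData.G_mul_connμ_one :
    conn HQi HQ * G + G.map dl = G * connμ Hi H (J * (HSi * J' * H)) 1 := by
  set P := J * (HSi * J' * H) with hP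
  set L := Hi * G' * HQ with hL
  have hGP : G * P = 0 := by rw [hP, ← Matrix.mul_assoc, h.GJ, Matrix.zero_mul]
  have h0 : L * G = 1 - P := by rw [eq_sub_iff_add_eq, add_comm]; exact h.split
  -- The connection of Q is read off from ∂ of the inverse metric G H⁻¹ G', since that is the metric
  -- which `G` expresses directly.
  have h1 : conn HQi HQ = G * conn Hi H * L - G.map dl * L := by
    have hi : HQi.map dl = -(conn HQi HQ * HQi) := h.metricQ.dl_inv
    have e1 : HQi.map dl * HQ = -conn HQi HQ := by
      rw [hi, neg_mul, mul_assoc, h.metricQ.mul', mul_one]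
    have e2 : HQi.map dl * HQ = G.map dl * L - G * conn Hi H * L := by
      conv_lhs => rw [h.HQi_eq, dl_anti.even_mul (even_mul_even h.evenG h.metric.even'),
        dl_anti.even_mul h.evenG, h.dlG', Matrix.mul_zero, add_zero, h.metric.dl_inv]
      rw [hL]
      simp only [Matrix.add_mul, Matrix.mul_assoc, Matrix.mul_neg, Matrix.neg_mul, sub_eq_add_neg]
    rw [← neg_neg (conn HQi HQ), ← e1, e2, neg_sub]
  have h2 := congrArg (fun X => X.map dl) hGP
  have hz : (0 : Matrix (Fin q) (Fin m) A).map dl = 0 := by ext; simp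
  simp only [dl_anti.even_mul h.evenG, hz] at h2
  rw [h1, connμ, gam, one_smul, Matrix.sub_mul, Matrix.mul_assoc _ L, Matrix.mul_assoc _ L, h0]
  simp only [Matrix.mul_sub, Matrix.mul_add, Matrix.mul_one, ← Matrix.mul_assoc, hGP,
    Matrix.zero_mul]
  rw [eq_neg_of_add_eq_zero_right h2]
  abel

/-- Obtained by applying ∂̄ to `connμ_one_mul_J`; the terms with ∂̄J and ∂̄∂J = −∂∂̄J vanish because
`J` is holomorphic. The statement for `G` is proved in the same way. -/
theorem IsExactData.curv_mul_J :
    (connμ Hi H (J * (HSi * J' * H)) 1).map db * J = J * (conn HSi HS).map db := by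
  have h1 := congrArg (fun X => X.map db) h.connμ_one_mul_J
  have hz : (0 : Matrix (Fin m) (Fin r) A).map dl = 0 := by ext; simp
  simp only [matrix_map_add, db_anti.odd_mul (h.metric.connμ_odd h.even_proj 1), h.dbJ, mdb_mdl,
    db_anti.even_mul h.evenJ, Matrix.mul_zero, Matrix.zero_mul, zero_add, sub_zero, hz,
    neg_zero, add_zero] at h1
  exact h1

theorem IsExactData.G_mul_curv :
    (conn HQi HQ).map db * G = G * (connμ Hi H (J * (HSi * J' * H)) 1).map db := by
  have h1 := congrArg (fun X => X.map db) h.G_mul_connμ_one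
  have hz : (0 : Matrix (Fin q) (Fin m) A).map dl = 0 := by ext; simp
  simp only [matrix_map_add, db_anti.odd_mul h.metricQ.conn_odd, h.dbG, mdb_mdl,
    db_anti.even_mul h.evenG, Matrix.mul_zero, Matrix.zero_mul, zero_add, sub_zero, hz,
    neg_zero, add_zero] at h1
  exact h1

end ExactSequence

/-! ### Multiplicativity of the determinant along an exact sequence -/

section BlockDet

/-- The determinant of an endomorphism which preserves a short exact sequence. -/
theorem det_of_exact {R : Type*} [CommRing R] {m r q : Type*} [Fintype m] [DecidableEq m]
    [Fintype r] [DecidableEq r] [Fintype q] [DecidableEq q]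
    {T : Matrix m m R} {TS : Matrix r r R} {TQ : Matrix q q R}
    {J : Matrix m r R} {W : Matrix r m R} {L : Matrix m q R} {G : Matrix q m R}
    (hWJ : W * J = 1) (hGL : G * L = 1) (hGJ : G * J = 0) (hWL : W * L = 0)
    (hs : J * W + L * G = 1) (hTJ : T * J = J * TS) (hGT : TQ * G = G * T) :
    T.det = TS.det * TQ.det := by
  have h1 : Matrix.fromCols J L * Matrix.fromRows W G = 1 := by
    rw [Matrix.fromCols_mul_fromRows, hs]
  have h2 : Matrix.fromRows W G * Matrix.fromCols J L = 1 := by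
    rw [Matrix.fromRows_mul_fromCols, hWJ, hGL, hGJ, hWL, Matrix.fromBlocks_one]
  -- In the basis given by the columns of `J` and `L` the endomorphism is block triangular: the
  -- lower left block is G T J = G J T_S = 0.
  have h3 : Matrix.fromRows W G * T * Matrix.fromCols J L =
      Matrix.fromBlocks TS (W * T * L) 0 TQ := by
    rw [Matrix.fromRows_mul, Matrix.fromRows_mul_fromCols]
    congr 1
    · rw [Matrix.mul_assoc, hTJ, ← Matrix.mul_assoc, hWJ, Matrix.one_mul]
    · rw [Matrix.mul_assoc, hTJ, ← Matrix.mul_assoc, hGJ, Matrix.zero_mul]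
    · rw [← hGT, Matrix.mul_assoc, hGL, Matrix.mul_one]
  rw [← Matrix.det_conj_of_mul_eq_one h2 h1, h3, Matrix.det_fromBlocks_zero₂₁]

theorem ldet_of_exact {A : Type*} [Ring A] [Algebra ℂ A] [Superalgebra A] {m r q : ℕ}
    {T : Matrix (Fin m) (Fin m) A} {TS : Matrix (Fin r) (Fin r) A} {TQ : Matrix (Fin q) (Fin q) A}
    {J : Matrix (Fin m) (Fin r) A} {W : Matrix (Fin r) (Fin m) A} {L : Matrix (Fin m) (Fin q) A}
    {G : Matrix (Fin q) (Fin m) A}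
    (eT : T.map parity = T) (eTS : TS.map parity = TS) (eTQ : TQ.map parity = TQ)
    (eJ : J.map parity = J) (eW : W.map parity = W) (eL : L.map parity = L)
    (eG : G.map parity = G)
    (hWJ : W * J = 1) (hGL : G * L = 1) (hGJ : G * J = 0) (hWL : W * L = 0)
    (hs : J * W + L * G = 1) (hTJ : T * J = J * TS) (hGT : TQ * G = G * T) :
    ldet T = ldet TS * ldet TQ := by
  obtain ⟨T, rfl⟩ := exists_lift_even' eT
  obtain ⟨TS, rfl⟩ := exists_lift_even' eTS
  obtain ⟨TQ, rfl⟩ := exists_lift_even' eTQ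
  obtain ⟨J, rfl⟩ := exists_lift_even' eJ
  obtain ⟨W, rfl⟩ := exists_lift_even' eW
  obtain ⟨L, rfl⟩ := exists_lift_even' eL
  obtain ⟨G, rfl⟩ := exists_lift_even' eG
  have hinj : ∀ {a b : Type} {M N : Matrix a b (evenPart A)},
      M.map (evenPart A).val = N.map (evenPart A).val → M = N := fun h =>
    Matrix.map_injective Subtype.val_injective h
  have h1 : ∀ (n : ℕ), (1 : Matrix (Fin n) (Fin n) A) =
      (1 : Matrix (Fin n) (Fin n) (evenPart A)).map (evenPart A).val := fun n => by
    rw [Matrix.map_one] <;> simp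
  have h0 : ∀ (n k : ℕ), (0 : Matrix (Fin n) (Fin k) A) =
      (0 : Matrix (Fin n) (Fin k) (evenPart A)).map (evenPart A).val := fun n k => by
    rw [Matrix.map_zero]; simp
  rw [ldet_coe, ldet_coe, ldet_coe, ← MulMemClass.coe_mul]
  congr 1
  simp only [← Matrix.map_mul, h1, h0] at *
  refine det_of_exact (hinj hWJ) (hinj hGL) (hinj hGJ) (hinj hWL) (hinj ?_) (hinj hTJ) (hinj hGT)
  rw [Matrix.map_add _ (map_add _), hs]

theorem chernMatrix_zero {A : Type*} [Ring A] [Algebra ℂ A] [DiffSuperalgebra A] {m : ℕ}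
    (Hi H P : Matrix (Fin m) (Fin m) A) :
    chernMatrix Hi H P 0 = 1 + aleph • (conn Hi H).map db := by
  rw [chernMatrix, connμ, zero_smul, sub_zero]

/-- `c(D_E - γ) = c(D_S) c(D_Q)`. -/
theorem IsExactData.ldet_chernMatrix {A : Type*} [Ring A] [Algebra ℂ A] [DiffSuperalgebra A]
    {m r q : ℕ} {Hi H : Matrix (Fin m) (Fin m) A} {HSi HS : Matrix (Fin r) (Fin r) A}
    {HQi HQ : Matrix (Fin q) (Fin q) A} {J : Matrix (Fin m) (Fin r) A}
    {J' : Matrix (Fin r) (Fin m) A} {G : Matrix (Fin q) (Fin m) A}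
    {G' : Matrix (Fin m) (Fin q) A} (h : IsExactData Hi H HSi HS HQi HQ J J' G G') :
    ldet (chernMatrix Hi H (J * (HSi * J' * H)) 1) =
      ldet (chernMatrix HSi HS 0 0) * ldet (chernMatrix HQi HQ 0 0) := by
  have ez : ∀ n, (0 : Matrix (Fin n) (Fin n) A).map parity = 0 := fun n => by ext; simp
  refine ldet_of_exact (J := J) (W := HSi * J' * H) (L := Hi * G' * HQ) (G := G)
    (h.metric.chernMatrix_even h.even_proj 1) (h.metricS.chernMatrix_even (ez _) 0)
    (h.metricQ.chernMatrix_even (ez _) 0) h.evenJ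
    (even_mul_even (even_mul_even h.metricS.even' h.evenJ') h.metric.even)
    (even_mul_even (even_mul_even h.metric.even' h.evenG') h.metricQ.even) h.evenG
    h.WJ h.GL h.GJ ?_ h.split ?_ ?_
  · have : HSi * J' * H * (Hi * G' * HQ) = HSi * (J' * (H * Hi) * G') * HQ := by
      simp only [Matrix.mul_assoc]
    rw [this, h.metric.mul, Matrix.mul_one, h.J'G', Matrix.mul_zero, Matrix.zero_mul]
  · rw [chernMatrix_zero, chernMatrix, Matrix.add_mul, Matrix.mul_add, Matrix.smul_mul,
      h.curv_mul_J, Matrix.one_mul, Matrix.mul_one, Matrix.mul_smul]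
  · rw [chernMatrix_zero, chernMatrix, Matrix.add_mul, Matrix.mul_add, Matrix.smul_mul,
      h.G_mul_curv, Matrix.one_mul, Matrix.mul_one, Matrix.mul_smul]

end BlockDet

/-! ## Change of frame and functoriality -/

section Gauge

variable {A : Type*} [Ring A] [Algebra ℂ A] [DiffSuperalgebra A] {m : ℕ}

/-- `g` is a holomorphic change of frame with inverse `gi` and conjugate transpose `g'`. -/
structure IsGauge (gi g g'i g' : Matrix (Fin m) (Fin m) A) : Prop where
  metric : IsMetric gi g
  metric' : IsMetric g'i g'
  db_eq : g.map db = 0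
  dl_eq' : g'.map dl = 0

variable {gi g g'i g' Hi H P : Matrix (Fin m) (Fin m) A} (hg : IsGauge gi g g'i g')
  (h : IsMetric Hi H)
include hg

theorem IsGauge.db_inv : gi.map db = 0 := by
  have h1 := congrArg (fun X => X.map db) hg.metric.mul'
  simp only [db_anti.even_mul hg.metric.even', db_anti.matrix_one, hg.db_eq, mul_zero,
    add_zero] at h1
  have h2 : gi.map db * g * gi = 0 := by rw [h1, zero_mul]
  rwa [mul_assoc, hg.metric.mul, mul_one] at h2

theorem IsGauge.dl_gi : gi.map dl = -(gi * g.map dl * gi) := hg.metric.dl_inv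

include h

/-- The affine transformation law of a connection. The factor `g'` leaves no derivative behind
because ∂g' = 0, `g'` standing for the conjugate transpose of a holomorphic matrix. -/
theorem IsGauge.conn_eq :
    conn (gi * Hi * g'i) (g' * H * g) = gi * conn Hi H * g + gi * g.map dl := by
  have e : (g' * H * g).map dl = g' * (H.map dl * g + H * g.map dl) := by
    rw [dl_anti.even_mul (even_mul_even hg.metric'.even h.even), dl_anti.even_mul hg.metric'.even,
      hg.dl_eq', zero_mul, zero_add, mul_add, ← mul_assoc, ← mul_assoc]
  rw [conn, e, conn]
  have : gi * Hi * g'i * (g' * (H.map dl * g + H * g.map dl)) =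
      gi * Hi * (g'i * g') * (H.map dl * g) + gi * (Hi * (g'i * g') * H) * g.map dl := by
    noncomm_ring
  rw [this, hg.metric'.mul', mul_one, mul_one, h.mul', mul_one]
  noncomm_ring

variable (hP : P.map parity = P)
include hP

/-- The inhomogeneous term of the transformed connection cancels against the derivatives of `gi` and
`g` in gi P g, so γ is tensorial. -/
theorem IsGauge.gam_eq :
    gam (gi * Hi * g'i) (g' * H * g) (gi * P * g) = gi * gam Hi H P * g := by
  have e : (gi * P * g).map dl = -(gi * g.map dl * gi * P * g) + gi * P.map dl * g +
      gi * P * g.map dl := by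
    rw [dl_anti.even_mul (even_mul_even hg.metric.even' hP), dl_anti.even_mul hg.metric.even',
      hg.dl_gi]
    noncomm_ring
  rw [gam, e, hg.conn_eq h, gam]
  have e1 : (gi * conn Hi H * g + gi * g.map dl) * (gi * P * g) =
      gi * conn Hi H * (g * gi) * P * g + gi * g.map dl * gi * P * g := by noncomm_ring
  have e2 : gi * P * g * (gi * conn Hi H * g + gi * g.map dl) =
      gi * P * (g * gi) * conn Hi H * g + gi * P * (g * gi) * g.map dl := by noncomm_ring
  rw [e1, e2, hg.metric.mul]
  noncomm_ring

theorem IsGauge.connμ_eq (μ : ℂ) :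
    connμ (gi * Hi * g'i) (g' * H * g) (gi * P * g) μ =
      gi * connμ Hi H P μ * g + gi * g.map dl := by
  rw [connμ, hg.gam_eq h hP, hg.conn_eq h, connμ, mul_sub, sub_mul, mul_smul_comm,
    smul_mul_assoc]
  abel

/-- The inhomogeneous term gi ∂g is ∂̄-closed, both `gi` and `g` being ∂̄-closed, and so it
disappears from the curvature. -/
theorem IsGauge.chernMatrix_eq (μ : ℂ) :
    chernMatrix (gi * Hi * g'i) (g' * H * g) (gi * P * g) μ =
      gi * chernMatrix Hi H P μ * g := by
  have hz : (0 : Matrix (Fin m) (Fin m) A).map dl = 0 := by ext; simp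
  have e : (gi * connμ Hi H P μ * g + gi * g.map dl).map db =
      gi * (connμ Hi H P μ).map db * g := by
    rw [matrix_map_add, db_anti.even_mul hg.metric.even', mdb_mdl, hg.db_eq, hz, hg.db_inv,
      db_anti.odd_mul (even_mul_odd hg.metric.even' (h.connμ_odd hP μ)),
      db_anti.even_mul hg.metric.even', hg.db_inv, hg.db_eq]
    simp
  rw [chernMatrix, hg.connμ_eq h hP, e, chernMatrix, mul_add, add_mul, mul_one, hg.metric.mul',
    mul_smul_comm, smul_mul_assoc]

omit h hP in
theorem IsGauge.ldet_eq {M : Matrix (Fin m) (Fin m) A} (hM : M.map parity = M) :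
    ldet (gi * M * g) = ldet M := by
  have h1 := hg.metric.mul'
  obtain ⟨M, rfl⟩ := exists_lift_even' hM
  obtain ⟨g, rfl⟩ := exists_lift_even' hg.metric.even
  obtain ⟨gi, rfl⟩ := exists_lift_even' hg.metric.even'
  rw [← Matrix.map_mul, ← Matrix.map_mul, ldet_coe, ldet_coe]
  congr 1
  have h1 : gi * g = 1 := by
    refine Matrix.map_injective (f := (evenPart A).val) Subtype.val_injective ?_
    dsimp only
    rw [Matrix.map_mul, h1, Matrix.map_one] <;> simp
  have h2 : gi.det * g.det = 1 := by rw [← Matrix.det_mul, h1, Matrix.det_one]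
  rw [Matrix.det_mul, Matrix.det_mul]
  linear_combination M.det * h2

omit h hP in
theorem IsGauge.ladj_eq {M : Matrix (Fin m) (Fin m) A} (hM : M.map parity = M) :
    ladj (gi * M * g) = gi * ladj M * g := by
  have h1 := hg.metric.mul'
  have h2 := hg.metric.mul
  obtain ⟨M, rfl⟩ := exists_lift_even' hM
  obtain ⟨g, rfl⟩ := exists_lift_even' hg.metric.even
  obtain ⟨gi, rfl⟩ := exists_lift_even' hg.metric.even'
  rw [← Matrix.map_mul, ← Matrix.map_mul, ladj_coe, ladj_coe, ← Matrix.map_mul, ← Matrix.map_mul]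
  congr 1
  have hinj := Matrix.map_injective (m := Fin m) (n := Fin m) (f := (evenPart A).val)
    Subtype.val_injective
  have h1 : gi * g = 1 := by
    refine hinj ?_
    dsimp only
    rw [Matrix.map_mul, h1, Matrix.map_one] <;> simp
  have h2 : g * gi = 1 := mul_eq_one_comm.1 h1
  have h3 : gi.det * g.det = 1 := by rw [← Matrix.det_mul, h1, Matrix.det_one]
  have h4 : g.adjugate = g.det • gi := by
    calc g.adjugate = g.adjugate * (g * gi) := by rw [h2, mul_one]
      _ = g.det • gi := by rw [← mul_assoc, Matrix.adjugate_mul, smul_mul_assoc, one_mul]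
  have h5 : gi.adjugate = gi.det • g := by
    calc gi.adjugate = gi.adjugate * (gi * g) := by rw [h1, mul_one]
      _ = gi.det • g := by rw [← mul_assoc, Matrix.adjugate_mul, smul_mul_assoc, one_mul]
  rw [Matrix.adjugate_mul_distrib, Matrix.adjugate_mul_distrib, h4, h5, smul_mul_assoc,
    mul_smul_comm, mul_smul_comm, smul_smul, mul_comm g.det, h3, one_smul, mul_assoc]

omit h hP in
theorem IsGauge.trace_eq (x : Matrix (Fin m) (Fin m) A) {M : Matrix (Fin m) (Fin m) A}
    (hM : M.map parity = M) :
    (gi * x * g * ladj (gi * M * g)).trace = (x * ladj M).trace := by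
  rw [hg.ladj_eq hM]
  have : gi * x * g * (gi * ladj M * g) = gi * (x * (g * gi) * ladj M * g) := by noncomm_ring
  rw [this, hg.metric.mul, mul_one, trace_mul_comm_even hg.metric.even']
  rw [mul_assoc (x * ladj M), hg.metric.mul, mul_one]

end Gauge

section Functoriality

variable {A B : Type*} [Ring A] [Algebra ℂ A] [DiffSuperalgebra A]
  [Ring B] [Algebra ℂ B] [DiffSuperalgebra B] {m : ℕ}

/-- Homomorphisms of differential superalgebras. -/
structure IsDiffHom (f : A →ₐ[ℂ] B) : Prop where
  parity : ∀ a, f (parity a) = BottChern.parity (f a)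
  dl : ∀ a, f (dl a) = BottChern.dl (f a)
  db : ∀ a, f (db a) = BottChern.db (f a)

variable {f : A →ₐ[ℂ] B} (hf : IsDiffHom f) (Hi H P : Matrix (Fin m) (Fin m) A)
include hf

theorem IsDiffHom.conn : (BottChern.conn Hi H).map f = BottChern.conn (Hi.map f) (H.map f) := by
  rw [BottChern.conn, BottChern.conn, Matrix.map_mul]
  congr 1
  ext i j
  simp [hf.dl]

theorem IsDiffHom.gam :
    (BottChern.gam Hi H P).map f = BottChern.gam (Hi.map f) (H.map f) (P.map f) := by
  rw [BottChern.gam, BottChern.gam, ← hf.conn, ← Matrix.map_mul, ← Matrix.map_mul]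
  ext i j
  simp only [Matrix.map_apply, Matrix.sub_apply, Matrix.add_apply, map_sub, map_add, hf.dl]

theorem IsDiffHom.connμ (μ : ℂ) :
    (BottChern.connμ Hi H P μ).map f = BottChern.connμ (Hi.map f) (H.map f) (P.map f) μ := by
  rw [BottChern.connμ, BottChern.connμ, ← hf.gam, ← hf.conn]
  ext i j
  simp

theorem IsDiffHom.chernMatrix (μ : ℂ) :
    (BottChern.chernMatrix Hi H P μ).map f =
      BottChern.chernMatrix (Hi.map f) (H.map f) (P.map f) μ := by
  rw [BottChern.chernMatrix, BottChern.chernMatrix, ← hf.connμ]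
  ext i j
  by_cases hij : i = j <;> simp [hij, hf.db]

end Functoriality

/-! ## Smooth forms on an open subset of a complex vector space -/

section NormedForms

variable {V : Type*} [NormedAddCommGroup V] [NormedSpace ℂ V] [FiniteDimensional ℂ V]

variable (V) in
/-- Left multiplication, in coordinates. -/
def leftMul : Form V →ₐ[ℂ]
    ((Finset (Fin (Module.finrank ℂ (Covec V))) → ℂ) →L[ℂ]
      (Finset (Fin (Module.finrank ℂ (Covec V))) → ℂ)) :=
  ((Module.End.toContinuousLinearMap _).toAlgHom.comp
    ((formBasis V).equivFun.conjAlgEquiv ℂ).toAlgHom).comp (Algebra.lmul ℂ (Form V))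

theorem leftMul_injective : Function.Injective (leftMul V) := by
  intro a b hab
  have h1 : Algebra.lmul ℂ (Form V) a = Algebra.lmul ℂ (Form V) b :=
    ((formBasis V).equivFun.conjAlgEquiv ℂ).injective
      ((Module.End.toContinuousLinearMap _).injective hab)
  simpa using LinearMap.congr_fun h1 1

/-- The norm is the operator norm of left multiplication. A submultiplicative norm makes the product
rule for Fréchet derivatives applicable to wedge products; in finite dimension the choice of norm
does not affect smoothness. -/
instance : NormedRing (Form V) := NormedRing.induced _ _ (leftMul V) leftMul_injective

instance : NormedAlgebra ℂ (Form V) := NormedAlgebra.induced ℂ _ _ (leftMul V)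

instance : Module.Finite ℂ (Form V) := Module.Finite.of_basis (formBasis V)

/-- A complex linear map out of the space of forms as a continuous real linear map. -/
def formCLM {F : Type*} [NormedAddCommGroup F] [NormedSpace ℂ F] (L : Form V →ₗ[ℂ] F) :
    Form V →L[ℝ] F := (LinearMap.toContinuousLinearMap L).restrictScalars ℝ

@[simp] theorem formCLM_apply {F : Type*} [NormedAddCommGroup F] [NormedSpace ℂ F]
    (L : Form V →ₗ[ℂ] F) (x : Form V) : formCLM L x = L x := rfl

/-- A complex linear map out of the space of covectors as a continuous real linear map. -/
def covecCLM {F : Type*} [NormedAddCommGroup F] [NormedSpace ℂ F] (L : Covec V →ₗ[ℂ] F) :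
    Covec V →L[ℝ] F :=
  haveI : FiniteDimensional ℂ (Covec V) := finite_covec
  (LinearMap.toContinuousLinearMap L).restrictScalars ℝ

theorem contDiffOn_form_iff {E : Type*} [NormedAddCommGroup E] [NormedSpace ℝ E] {n : WithTop ℕ∞}
    {f : E → Form V} {U : Set E} :
    ContDiffOn ℝ n f U ↔ ∀ s, ContDiffOn ℝ n (fun z => (formBasis V).repr (f z) s) U := by
  refine ⟨fun h s => (formCLM ((formBasis V).coord s)).contDiff.comp_contDiffOn h, fun h => ?_⟩
  have : f = fun z => ∑ s, (formBasis V).repr (f z) s • formBasis V s := by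
    ext z; exact ((formBasis V).sum_repr (f z)).symm
  rw [this]
  refine ContDiffOn.sum fun s _ => ?_
  have h2 : ContDiff ℝ n (fun c : ℂ => c • formBasis V s) :=
    ((LinearMap.toContinuousLinearMap
      (LinearMap.toSpanSingleton ℂ (Form V) (formBasis V s))).restrictScalars ℝ).contDiff
  exact h2.comp_contDiffOn (h s)

theorem dirDeriv_eq {f : V → Form V} {z : V} (hf : DifferentiableAt ℝ f z) (w : V) :
    dirDeriv f z w = fderiv ℝ f z w := by
  rw [dirDeriv, ← (formBasis V).sum_repr (fderiv ℝ f z w)]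
  refine Finset.sum_congr rfl fun s _ => ?_
  congr 1
  have := ((formCLM ((formBasis V).coord s)).hasFDerivAt.comp z hf.hasFDerivAt).fderiv
  exact DFunLike.congr_fun this w

end NormedForms

section SmoothForms

variable {V : Type*} [NormedAddCommGroup V] [NormedSpace ℂ V] [FiniteDimensional ℂ V]
  (U : TopologicalSpace.Opens V)

open Classical in
/-- Extension by zero. -/
def extendZero (f : U → Form V) (z : V) : Form V := if h : z ∈ U then f ⟨z, h⟩ else 0

variable {U}

omit [FiniteDimensional ℂ V] in
theorem extendZero_apply (f : U → Form V) (z : U) : extendZero U f z = f z :=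
  dif_pos z.2

omit [FiniteDimensional ℂ V] in
theorem eqOn_extendZero {f : U → Form V} {g : V → Form V} (h : ∀ z : U, f z = g z) :
    Set.EqOn (extendZero U f) g U := fun z hz => (extendZero_apply f ⟨z, hz⟩).trans (h ⟨z, hz⟩)

omit [FiniteDimensional ℂ V] in
theorem eventuallyEq_extendZero {f : U → Form V} {g : V → Form V} (h : ∀ z : U, f z = g z)
    (z : U) : extendZero U f =ᶠ[nhds (z : V)] g :=
  (eqOn_extendZero h).eventuallyEq_of_mem (U.isOpen.mem_nhds z.2)

variable (U) in
/-- The subalgebra of smooth forms among all the forms on `U`. -/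
def smoothSubalgebra : Subalgebra ℂ (U → Form V) where
  carrier := {f | ContDiffOn ℝ ∞ (extendZero U f) U}
  mul_mem' {f g} hf hg := (hf.mul hg).congr
    (eqOn_extendZero fun z => by simp [extendZero_apply])
  add_mem' {f g} hf hg := (hf.add hg).congr
    (eqOn_extendZero fun z => by simp [extendZero_apply])
  algebraMap_mem' r := (contDiffOn_const (c := algebraMap ℂ (Form V) r)).congr
    (eqOn_extendZero fun z => rfl)

variable (U) in
/-- The algebra of smooth forms on `U`. -/
def SmoothForms : Type _ := smoothSubalgebra U

namespace SmoothForms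

instance : Ring (SmoothForms U) := inferInstanceAs (Ring (smoothSubalgebra U))

instance : Algebra ℂ (SmoothForms U) := inferInstanceAs (Algebra ℂ (smoothSubalgebra U))

/-- The smooth form given by a function which is smooth on `U`. -/
def mk (f : V → Form V) (hf : ContDiffOn ℝ ∞ f U) : SmoothForms U :=
  ⟨fun z => f z, hf.congr (eqOn_extendZero fun _ => rfl)⟩

/-- Evaluation at a point. -/
def ev (z : U) : SmoothForms U →ₐ[ℂ] Form V :=
  (Pi.evalAlgHom ℂ (fun _ : U => Form V) z).comp (smoothSubalgebra U).val

theorem ev_mk (f : V → Form V) (hf : ContDiffOn ℝ ∞ f U) (z : U) : ev z (mk f hf) = f z := rfl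

theorem ext {a b : SmoothForms U} (h : ∀ z, ev z a = ev z b) : a = b :=
  Subtype.ext (funext h)

/-- A smooth form as a function on the vector space. -/
def toFun (a : SmoothForms U) : V → Form V := extendZero U a.1

theorem toFun_apply (a : SmoothForms U) (z : U) : toFun a z = ev z a := extendZero_apply a.1 z

theorem contDiffOn (a : SmoothForms U) : ContDiffOn ℝ ∞ (toFun a) U := a.2

theorem contDiffAt (a : SmoothForms U) (z : U) : ContDiffAt ℝ ∞ (toFun a) z :=
  (contDiffOn a).contDiffAt (U.isOpen.mem_nhds z.2)

theorem differentiableAt (a : SmoothForms U) (z : U) : DifferentiableAt ℝ (toFun a) z :=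
  (contDiffAt a z).differentiableAt (by simp)

theorem toFun_eventuallyEq {a : SmoothForms U} {g : V → Form V} (h : ∀ z : U, ev z a = g z)
    (z : U) : toFun a =ᶠ[nhds (z : V)] g := eventuallyEq_extendZero h z

theorem fderiv_toFun {a : SmoothForms U} {g : V → Form V} (h : ∀ z : U, ev z a = g z)
    (z : U) : fderiv ℝ (toFun a) z = fderiv ℝ g z := (toFun_eventuallyEq h z).fderiv_eq

variable (U) in
/-- Constant forms. -/
def const : Form V →ₐ[ℂ] SmoothForms U :=
  (Pi.constAlgHom ℂ U (Form V)).codRestrict _ fun x =>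
    (contDiffOn_const (c := x)).congr (eqOn_extendZero fun _ => rfl)

theorem ev_const (z : U) (x : Form V) : ev z (const U x) = x := rfl

/-- Pointwise application of an algebra endomorphism. -/
def mapForm (φ : Form V →ₐ[ℂ] Form V) : SmoothForms U →ₐ[ℂ] SmoothForms U :=
  ((φ.compLeft U).comp (smoothSubalgebra U).val).codRestrict _ fun a =>
    ((formCLM φ.toLinearMap).contDiff.comp_contDiffOn a.2).congr
      (eqOn_extendZero fun z => by simp [extendZero_apply])

theorem ev_mapForm (φ : Form V →ₐ[ℂ] Form V) (a : SmoothForms U) (z : U) :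
    ev z (mapForm φ a) = φ (ev z a) := rfl

instance : Superalgebra (SmoothForms U) where
  parity := mapForm parity
  parity_parity a := ext fun z => parity_parity (ev z a)
  mul_comm_of_even a b h := ext fun z =>
    mul_comm_of_even (ev z a) (ev z b) (congrArg (ev z) h)

theorem ev_parity (a : SmoothForms U) (z : U) : ev z (parity a) = parity (ev z a) := rfl

/-- Partial derivatives. -/
def pd (w : V) : SmoothForms U →ₗ[ℂ] SmoothForms U where
  toFun a := mk (fun z => fderiv ℝ (toFun a) z w)
    (((contDiffOn a).fderiv_of_isOpen U.isOpen (by simp)).clm_apply contDiffOn_const)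
  map_add' a b := ext fun z => by
    have : fderiv ℝ (toFun (a + b)) z = fderiv ℝ (toFun a + toFun b) z :=
      fderiv_toFun (fun z => by simp [toFun_apply]) z
    rw [map_add, ev_mk, ev_mk, ev_mk, this, fderiv_add (differentiableAt a z)
      (differentiableAt b z)]
    rfl
  map_smul' c a := ext fun z => by
    have : fderiv ℝ (toFun (c • a)) z = fderiv ℝ (c • toFun a) z :=
      fderiv_toFun (fun z => by simp [toFun_apply]) z
    rw [map_smul, ev_mk, ev_mk, this, fderiv_const_smul (differentiableAt a z)]
    rfl

theorem ev_pd (w : V) (a : SmoothForms U) (z : U) :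
    ev z (pd w a) = fderiv ℝ (toFun a) z w := rfl

theorem pd_mul (w : V) (a b : SmoothForms U) : pd w (a * b) = pd w a * b + a * pd w b :=
  ext fun z => by
    have : fderiv ℝ (toFun (a * b)) z = fderiv ℝ (toFun a * toFun b) z :=
      fderiv_toFun (fun z => by simp [toFun_apply]) z
    rw [map_add (ev z), map_mul (ev z), map_mul (ev z), ev_pd, this, fderiv_mul' (differentiableAt a z)
      (differentiableAt b z), ev_pd, ev_pd, add_comm, toFun_apply, toFun_apply]
    rfl

theorem pd_const (w : V) (x : Form V) : pd w (const U x) = 0 := ext fun z => by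
  have : fderiv ℝ (toFun (const U x)) z = fderiv ℝ (fun _ : V => x) z :=
    fderiv_toFun (fun z => rfl) z
  rw [ev_pd, this]
  simp

theorem pd_mapForm (w : V) (φ : Form V →ₐ[ℂ] Form V) (a : SmoothForms U) :
    pd w (mapForm φ a) = mapForm φ (pd w a) := ext fun z => by
  have : fderiv ℝ (toFun (mapForm φ a)) z = fderiv ℝ (formCLM φ.toLinearMap ∘ toFun a) z :=
    fderiv_toFun (fun z => by simp [toFun_apply, ev_mapForm]) z
  rw [ev_pd, this, ev_mapForm, ev_pd,
    ((formCLM φ.toLinearMap).hasFDerivAt.comp _ (differentiableAt a z).hasFDerivAt).fderiv]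
  rfl

theorem pd_comm (v w : V) (a : SmoothForms U) : pd v (pd w a) = pd w (pd v a) :=
  ext fun z => by
    have h : ∀ v w, ev z (pd v (pd w a)) = fderiv ℝ (fderiv ℝ (toFun a)) z v w := by
      intro v w
      have h1 : fderiv ℝ (toFun (pd w a)) z = fderiv ℝ (fun y => fderiv ℝ (toFun a) y w) z :=
        fderiv_toFun (fun z => rfl) z
      have h2 : DifferentiableAt ℝ (fderiv ℝ (toFun a)) z :=
        (((contDiffAt a z).fderiv_right (m := ∞) (by simp))).differentiableAt (by simp)
      rw [ev_pd, h1, fderiv_clm_apply h2 (differentiableAt_const w)]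
      simp
    rw [h, h]
    exact ((contDiffAt a z).isSymmSndFDerivAt (by simp; exact WithTop.coe_le_coe.2 le_top)).eq v w

/-- The first order operator `∑ τ(dx_i) ∧ ∂/∂x_i`. -/
def diffOp (τ : Covec V →ₗ[ℂ] Covec V) : SmoothForms U →ₗ[ℂ] SmoothForms U :=
  ∑ i, (LinearMap.mulLeft ℂ (const U (ExteriorAlgebra.ι ℂ (τ (dx i))))) ∘ₗ pd (realBasis V i)

theorem diffOp_apply (τ : Covec V →ₗ[ℂ] Covec V) (a : SmoothForms U) :
    diffOp τ a = ∑ i, const U (ExteriorAlgebra.ι ℂ (τ (dx i))) * pd (realBasis V i) a := by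
  simp [diffOp]

theorem const_ι_mul (α : Covec V) (a : SmoothForms U) :
    const U (ExteriorAlgebra.ι ℂ α) * a = parity a * const U (ExteriorAlgebra.ι ℂ α) :=
  ext fun z => by
    rw [map_mul, map_mul, ev_const, ev_parity]
    exact ι_mul α _

theorem parity_const_ι (α : Covec V) :
    parity (const U (ExteriorAlgebra.ι ℂ α)) = -const U (ExteriorAlgebra.ι ℂ α) :=
  ext fun z => by
    rw [ev_parity, map_neg, ev_const, parity_ι]

theorem diffOp_antiderivation (τ : Covec V →ₗ[ℂ] Covec V) :
    IsAntiderivation (diffOp (U := U) τ) where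
  mul a b := by
    simp only [diffOp_apply, Finset.sum_mul, Finset.mul_sum, ← Finset.sum_add_distrib]
    refine Finset.sum_congr rfl fun i _ => ?_
    rw [pd_mul, mul_add, ← mul_assoc, ← mul_assoc, ← mul_assoc, const_ι_mul _ a]
  parity_map a := by
    simp only [diffOp_apply, map_sum, ← Finset.sum_neg_distrib]
    refine Finset.sum_congr rfl fun i _ => ?_
    rw [map_mul, parity_const_ι, neg_mul]
    congr 2
    exact (pd_mapForm _ _ a).symm

/-- The coefficients τ(dx_i) are constant, partial derivatives commute and covectors anticommute.
Taking τ = σ gives square zero; the two type projections give ∂̄∂ = −∂∂̄. -/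
theorem diffOp_comm (τ σ : Covec V →ₗ[ℂ] Covec V) (a : SmoothForms U) :
    diffOp τ (diffOp σ a) = -diffOp σ (diffOp τ a) := by
  have h : ∀ τ σ : Covec V →ₗ[ℂ] Covec V, diffOp τ (diffOp σ a) =
      ∑ i, ∑ j, const U (ExteriorAlgebra.ι ℂ (τ (dx i)) * ExteriorAlgebra.ι ℂ (σ (dx j))) *
        pd (realBasis V i) (pd (realBasis V j) a) := by
    intro τ σ
    simp only [diffOp_apply, map_sum]
    rw [Finset.sum_comm]
    refine Finset.sum_congr rfl fun i _ => Finset.sum_congr rfl fun j _ => ?_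
    rw [pd_mul, pd_const, zero_mul, zero_add, map_mul (const U), mul_assoc]
  rw [h τ σ, h σ τ, Finset.sum_comm, ← Finset.sum_neg_distrib]
  refine Finset.sum_congr rfl fun i _ => ?_
  rw [← Finset.sum_neg_distrib]
  refine Finset.sum_congr rfl fun j _ => ?_
  rw [pd_comm, ← neg_mul, ← map_neg]
  congr 2
  exact eq_neg_of_add_eq_zero_left (ExteriorAlgebra.ι_add_mul_swap _ _)

theorem diffOp_diffOp (τ : Covec V →ₗ[ℂ] Covec V) (a : SmoothForms U) :
    diffOp τ (diffOp τ a) = 0 := by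
  have h : (2 : ℂ) • diffOp τ (diffOp τ a) = 0 := by
    rw [two_smul]
    nth_rewrite 1 [diffOp_comm]
    simp
  exact (smul_eq_zero.1 h).resolve_left two_ne_zero

/-- For odd `a` each summand τ(dx_i) ∧ ∂_i a is even with square zero, so a power exceeding the
number of summands vanishes. This makes det(I + ℵ∂̄N) invertible for an odd connection matrix N. -/
theorem diffOp_isNilpotent (τ : Covec V →ₗ[ℂ] Covec V) (a : SmoothForms U)
    (ha : parity a = -a) : IsNilpotent (diffOp τ a) := by
  have he : ∀ i, parity (const U (ExteriorAlgebra.ι ℂ (τ (dx i))) * pd (realBasis V i) a) =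
      const U (ExteriorAlgebra.ι ℂ (τ (dx i))) * pd (realBasis V i) a := by
    intro i
    rw [map_mul, parity_const_ι]
    have : parity (pd (realBasis V i) a) = -pd (realBasis V i) a := by
      rw [← map_neg, ← ha]; exact (pd_mapForm _ _ a).symm
    rw [this, neg_mul_neg]
  let y : Fin (Module.finrank ℝ V) → evenPart (SmoothForms U) := fun i => ⟨_, he i⟩
  have hy : ∀ i, y i * y i = 0 := fun i => Subtype.ext <| by
    change const U (ExteriorAlgebra.ι ℂ (τ (dx i))) * pd (realBasis V i) a *
      (const U (ExteriorAlgebra.ι ℂ (τ (dx i))) * pd (realBasis V i) a) = 0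
    nth_rewrite 1 [const_ι_mul]
    rw [mul_assoc, ← mul_assoc (const U _) (const U _), ← map_mul, ExteriorAlgebra.ι_sq_zero]
    simp
  refine ⟨(Finset.univ : Finset (Fin (Module.finrank ℝ V))).card + 1, ?_⟩
  have h := congrArg (evenPart (SmoothForms U)).val
    (sum_pow_card_of_sq_eq_zero Finset.univ y hy).2
  rw [map_pow, map_sum, map_zero] at h
  rw [diffOp_apply]
  exact h

instance : DiffSuperalgebra (SmoothForms U) where
  dl := diffOp covec10
  db := diffOp covec01
  dl_anti := diffOp_antiderivation _
  db_anti := diffOp_antiderivation _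
  dl_dl := diffOp_diffOp _
  db_db := diffOp_diffOp _
  db_dl := diffOp_comm _ _
  db_nilpotent := diffOp_isNilpotent _

theorem ev_diffOp (τ : Covec V →ₗ[ℂ] Covec V) (a : SmoothForms U) (z : U) :
    ev z (diffOp τ a) =
      ∑ i, ExteriorAlgebra.ι ℂ (τ (dx i)) * dirDeriv (toFun a) z (realBasis V i) := by
  simp only [diffOp_apply, map_sum, map_mul, ev_const, ev_pd, dirDeriv_eq (differentiableAt a z)]

theorem dirDeriv_toFun {a : SmoothForms U} {g : V → Form V} (h : ∀ z : U, ev z a = g z)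
    (z : U) (w : V) : dirDeriv (toFun a) z w = dirDeriv g z w := by
  rw [dirDeriv_eq (differentiableAt a z), fderiv_toFun h, dirDeriv_eq]
  exact (differentiableAt a z).congr_of_eventuallyEq (toFun_eventuallyEq h z).symm

theorem ev_dl {a : SmoothForms U} {g : V → Form V} (h : ∀ z : U, ev z a = g z) (z : U) :
    ev z (dl a) = delL g z := by
  change ev z (diffOp covec10 a) = _
  rw [ev_diffOp, delL]
  simp only [dirDeriv_toFun h]

theorem ev_db {a : SmoothForms U} {g : V → Form V} (h : ∀ z : U, ev z a = g z) (z : U) :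
    ev z (db a) = dbarL g z := by
  change ev z (diffOp covec01 a) = _
  rw [ev_diffOp, dbarL]
  simp only [dirDeriv_toFun h]

omit [FiniteDimensional ℂ V] in
theorem covec10_add_covec01 (α : Covec V) : covec10 α + covec01 α = α := by
  simp only [covec10, covec01, LinearMap.smul_apply, LinearMap.sub_apply, LinearMap.add_apply,
    LinearMap.id_apply, ← smul_add]
  rw [sub_add_add_cancel, ← two_smul ℂ, smul_smul]
  norm_num

theorem diffOp_id (a : SmoothForms U) : diffOp LinearMap.id a = dl a + db a := by
  change _ = diffOp covec10 a + diffOp covec01 a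
  simp only [diffOp_apply, ← Finset.sum_add_distrib, ← add_mul, ← map_add, covec10_add_covec01,
    LinearMap.id_apply]

theorem ev_d {a : SmoothForms U} {g : V → Form V} (h : ∀ z : U, ev z a = g z) (z : U) :
    ev z (dl a + db a) = extDL g z := by
  rw [← diffOp_id, ev_diffOp, extDL]
  simp only [dirDeriv_toFun h, LinearMap.id_apply]

end SmoothForms

end SmoothForms

/-! ## Scalar functions and pullbacks -/

section Covectors

variable {V : Type*} [NormedAddCommGroup V] [NormedSpace ℂ V]

theorem covec10_apply (α : Covec V) (v : V) :
    covec10 α v = (1 / 2 : ℂ) * (α v - Complex.I * α (Complex.I • v)) := rfl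

theorem covec01_apply (α : Covec V) (v : V) :
    covec01 α v = (1 / 2 : ℂ) * (α v + Complex.I * α (Complex.I • v)) := rfl

theorem covec01_eq_zero {α : Covec V} (h : ∀ v, α (Complex.I • v) = Complex.I * α v) :
    covec01 α = 0 := by
  ext v
  rw [covec01_apply, h, ← mul_assoc, Complex.I_mul_I]
  simp

theorem covec10_eq_zero {α : Covec V} (h : ∀ v, α (Complex.I • v) = -(Complex.I * α v)) :
    covec10 α = 0 := by
  ext v
  rw [covec10_apply, h, mul_neg, ← mul_assoc, Complex.I_mul_I]
  simp

theorem covec10_I (α : Covec V) (v : V) :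
    covec10 α (Complex.I • v) = Complex.I * covec10 α v := by
  rw [covec10_apply, covec10_apply, smul_smul, Complex.I_mul_I, neg_one_smul, map_neg]
  linear_combination (1 / 2 : ℂ) * α (Complex.I • v) * Complex.I_mul_I

theorem covec01_I (α : Covec V) (v : V) :
    covec01 α (Complex.I • v) = -(Complex.I * covec01 α v) := by
  rw [covec01_apply, covec01_apply, smul_smul, Complex.I_mul_I, neg_one_smul, map_neg]
  linear_combination (1 / 2 : ℂ) * α (Complex.I • v) * Complex.I_mul_I

theorem covec10_comp (α : Covec V) {T : V →L[ℝ] V}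
    (hT : ∀ v, T (Complex.I • v) = Complex.I • T v) :
    covec10 (pullCovec T α) = pullCovec T (covec10 α) := by
  ext v
  change covec10 (α.comp T) v = covec10 α (T v)
  rw [covec10_apply, covec10_apply]
  simp [hT]

theorem covec01_comp (α : Covec V) {T : V →L[ℝ] V}
    (hT : ∀ v, T (Complex.I • v) = Complex.I • T v) :
    covec01 (pullCovec T α) = pullCovec T (covec01 α) := by
  ext v
  change covec01 (α.comp T) v = covec01 α (T v)
  rw [covec01_apply, covec01_apply]
  simp [hT]

theorem pullForm_ι (T : V →L[ℝ] V) (α : Covec V) :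
    pullForm T (ExteriorAlgebra.ι ℂ α) = ExteriorAlgebra.ι ℂ (α.comp T) :=
  ExteriorAlgebra.map_apply_ι _ _

theorem pullForm_comp (S T : V →L[ℝ] V) (x : Form V) :
    pullForm (S.comp T) x = pullForm T (pullForm S x) := by
  have : (pullForm T).comp (pullForm S) = pullForm (S.comp T) :=
    ExteriorAlgebra.map_comp_map _ _
  exact (DFunLike.congr_fun this x).symm

theorem pullForm_id (x : Form V) : pullForm (ContinuousLinearMap.id ℝ V) x = x := by
  have : pullForm (ContinuousLinearMap.id ℝ V) = AlgHom.id ℂ (Form V) :=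
    ExteriorAlgebra.map_id
  rw [this]; rfl

variable [FiniteDimensional ℂ V]

theorem sum_smul_dx (α : Covec V) : ∑ i, α (realBasis V i) • dx i = α := by
  ext v
  conv_rhs => rw [← (realBasis V).sum_repr v, map_sum]
  rw [_root_.sum_apply]
  refine Finset.sum_congr rfl fun i _ => ?_
  rw [map_smul]
  simp [dx, mul_comm]

/-- The pullback of a constant form is polynomial in the linear map, by induction on the form. A
general form is expanded in the constant basis. -/
theorem contDiffOn_pullForm {U : Set V} {A : V → V →L[ℝ] V} (hA : ContDiffOn ℝ ∞ A U)
    {f : V → Form V} (hf : ContDiffOn ℝ ∞ f U) :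
    ContDiffOn ℝ ∞ (fun z => pullForm (A z) (f z)) U := by
  have hc : ∀ c : Form V, ContDiffOn ℝ ∞ (fun z => pullForm (A z) c) U := by
    intro c
    induction c using ExteriorAlgebra.induction with
    | algebraMap r => simp only [AlgHom.commutes]; exact contDiffOn_const
    | ι α =>
      simp only [pullForm_ι]
      have h1 : ContDiffOn ℝ ∞ (fun z => α.comp (A z)) U :=
        contDiffOn_const.clm_comp hA
      exact (covecCLM (ExteriorAlgebra.ι ℂ)).contDiff.comp_contDiffOn h1
    | mul a b ha hb => simp only [map_mul]; exact ha.mul hb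
    | add a b ha hb => simp only [map_add]; exact ha.add hb
  have : (fun z => pullForm (A z) (f z)) =
      fun z => ∑ s, (formBasis V).repr (f z) s • pullForm (A z) (formBasis V s) := by
    ext z
    conv_lhs => rw [← (formBasis V).sum_repr (f z), map_sum]
    simp only [map_smul]
  rw [this]
  refine ContDiffOn.sum fun s _ => ?_
  exact (contDiffOn_form_iff.1 hf s).smul (hc _)

end Covectors

namespace SmoothForms

variable {V : Type*} [NormedAddCommGroup V] [NormedSpace ℂ V] [FiniteDimensional ℂ V]
  {U U' : TopologicalSpace.Opens V}

theorem contDiff_algebraMap : ContDiff ℝ ∞ (algebraMap ℂ (Form V)) :=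
  ((LinearMap.toContinuousLinearMap (Algebra.linearMap ℂ (Form V))).restrictScalars ℝ).contDiff

/-- A smooth function as a form of degree zero. -/
def scalar (h : V → ℂ) (hh : ContDiffOn ℝ ∞ h U) : SmoothForms U :=
  mk (fun z => algebraMap ℂ (Form V) (h z)) (contDiff_algebraMap.comp_contDiffOn hh)

theorem ev_scalar (h : V → ℂ) (hh : ContDiffOn ℝ ∞ h U) (z : U) :
    ev z (scalar h hh) = algebraMap ℂ (Form V) (h z) := rfl

theorem ev_diffOp_scalar (τ : Covec V →ₗ[ℂ] Covec V) (h : V → ℂ) (hh : ContDiffOn ℝ ∞ h U)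
    (z : U) : ev z (diffOp τ (scalar h hh)) = ExteriorAlgebra.ι ℂ (τ (fderiv ℝ h z)) := by
  rw [ev_diffOp]
  have hd : DifferentiableAt ℝ h z :=
    (hh.contDiffAt (U.isOpen.mem_nhds z.2)).differentiableAt (by simp)
  have h1 : ∀ w, dirDeriv (toFun (scalar h hh)) z w =
      algebraMap ℂ (Form V) (fderiv ℝ h z w) := by
    intro w
    rw [dirDeriv_eq (differentiableAt _ z), fderiv_toFun (g := fun z => algebraMap ℂ (Form V) (h z)) (ev_scalar h hh) z]
    have := (((LinearMap.toContinuousLinearMap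
      (Algebra.linearMap ℂ (Form V))).restrictScalars ℝ).hasFDerivAt.comp (z : V)
        hd.hasFDerivAt).fderiv
    exact DFunLike.congr_fun this w
  simp only [h1]
  conv_rhs => rw [← sum_smul_dx (fderiv ℝ h z)]
  simp only [map_sum, map_smul]
  refine Finset.sum_congr rfl fun i _ => ?_
  rw [← Algebra.commutes, Algebra.smul_def]

theorem fderiv_real_eq {E F : Type*} [NormedAddCommGroup E] [NormedSpace ℂ E]
    [NormedAddCommGroup F] [NormedSpace ℂ F] {U : TopologicalSpace.Opens E} {h : E → F}
    (hh : ContDiffOn ℂ ∞ h U) (z : U) :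
    fderiv ℝ h z = (fderiv ℂ h z).restrictScalars ℝ :=
  ((hh.contDiffAt (U.isOpen.mem_nhds z.2)).differentiableAt (by simp)).fderiv_restrictScalars ℝ

theorem db_scalar {h : V → ℂ} (hh : ContDiffOn ℂ ∞ h U) :
    db (scalar h (hh.restrict_scalars ℝ)) = 0 := ext fun z => by
  change ev z (diffOp covec01 _) = _
  rw [ev_diffOp_scalar, fderiv_real_eq hh, covec01_eq_zero, map_zero, map_zero]
  intro v
  simp

omit [FiniteDimensional ℂ V] in
theorem contDiffOn_star {h : V → ℂ} (hh : ContDiffOn ℝ ∞ h U) :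
    ContDiffOn ℝ ∞ (fun z => star (h z)) U :=
  Complex.conjCLE.contDiff.comp_contDiffOn hh

theorem dl_scalar_star {h : V → ℂ} (hh : ContDiffOn ℂ ∞ h U) :
    dl (scalar (fun z => star (h z)) (contDiffOn_star (hh.restrict_scalars ℝ))) = 0 :=
  ext fun z => by
    change ev z (diffOp covec10 _) = _
    have hd : DifferentiableAt ℝ h z :=
      ((hh.restrict_scalars ℝ).contDiffAt (U.isOpen.mem_nhds z.2)).differentiableAt (by simp)
    have h1 : fderiv ℝ (fun z => star (h z)) z =
        (Complex.conjCLE : ℂ →L[ℝ] ℂ).comp (fderiv ℝ h z) :=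
      (((Complex.conjCLE : ℂ →L[ℝ] ℂ).hasFDerivAt (x := h z)).comp (z : V) hd.hasFDerivAt).fderiv
    rw [ev_diffOp_scalar, h1, fderiv_real_eq hh, covec10_eq_zero, map_zero, map_zero]
    intro v
    simp

/-- Pullback of smooth forms. -/
def pull (φ : V → V) (hφ : ContDiffOn ℝ ∞ φ U) (hm : ∀ z ∈ U, φ z ∈ U') :
    SmoothForms U' →ₐ[ℂ] SmoothForms U where
  toFun a := mk (fun z => pullForm (fderiv ℝ φ z) (toFun a (φ z)))
    (contDiffOn_pullForm (hφ.fderiv_of_isOpen U.isOpen (by simp))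
      ((contDiffOn a).comp hφ hm))
  map_one' := ext fun z => by
    rw [ev_mk, toFun_apply _ ⟨_, hm z z.2⟩]; simp
  map_mul' a b := ext fun z => by
    rw [ev_mk, map_mul, ev_mk, ev_mk, toFun_apply _ ⟨_, hm z z.2⟩, toFun_apply _ ⟨_, hm z z.2⟩,
      toFun_apply _ ⟨_, hm z z.2⟩, map_mul, map_mul]
  map_zero' := ext fun z => by
    rw [ev_mk, toFun_apply _ ⟨_, hm z z.2⟩]; simp
  map_add' a b := ext fun z => by
    rw [ev_mk, map_add, ev_mk, ev_mk, toFun_apply _ ⟨_, hm z z.2⟩, toFun_apply _ ⟨_, hm z z.2⟩,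
      toFun_apply _ ⟨_, hm z z.2⟩, map_add, map_add]
  commutes' r := ext fun z => by
    rw [ev_mk, toFun_apply _ ⟨_, hm z z.2⟩]; simp

section Pull

variable {φ : V → V} (hφ : ContDiffOn ℂ ∞ φ U) (hm : ∀ z ∈ U, φ z ∈ U')

theorem ev_pull (hφ : ContDiffOn ℝ ∞ φ U) (a : SmoothForms U') (z : U) :
    ev z (pull φ hφ hm a) = pullForm (fderiv ℝ φ z) (ev ⟨φ z, hm z z.2⟩ a) := by
  rw [← toFun_apply a ⟨φ z, hm z z.2⟩]; rfl

theorem pull_scalar (hφ : ContDiffOn ℝ ∞ φ U) (h : V → ℂ) (hh : ContDiffOn ℝ ∞ h U') :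
    pull φ hφ hm (scalar h hh) = scalar (h ∘ φ) (hh.comp hφ hm) := ext fun z => by
  rw [ev_pull, ev_scalar, ev_scalar, AlgHom.commutes]; rfl

omit [FiniteDimensional ℂ V] in
include hφ in
theorem fderiv_I (z : U) (v : V) :
    fderiv ℝ φ z (Complex.I • v) = Complex.I • fderiv ℝ φ z v := by
  rw [fderiv_real_eq hφ]; simp

/-- The operators `∂` and `∂̄` commute with pullback of functions. -/
theorem diffOp_pull_scalar {τ : Covec V →ₗ[ℂ] Covec V}
    (hτ : ∀ (α : Covec V) (T : V →L[ℝ] V), (∀ v, T (Complex.I • v) = Complex.I • T v) →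
      τ (pullCovec T α) = pullCovec T (τ α)) (h : V → ℂ) (hh : ContDiffOn ℝ ∞ h U') :
    diffOp τ (pull φ (hφ.restrict_scalars ℝ) hm (scalar h hh)) =
      pull φ (hφ.restrict_scalars ℝ) hm (diffOp τ (scalar h hh)) := ext fun z => by
  have hd : DifferentiableAt ℝ φ z :=
    ((hφ.restrict_scalars ℝ).contDiffAt (U.isOpen.mem_nhds z.2)).differentiableAt (by simp)
  have hd' : DifferentiableAt ℝ h (φ z) :=
    (hh.contDiffAt (U'.isOpen.mem_nhds (hm z z.2))).differentiableAt (by simp)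
  rw [pull_scalar, ev_diffOp_scalar, ev_pull, ev_diffOp_scalar, pullForm_ι,
    fderiv_comp _ hd' hd]
  congr 1
  exact hτ _ _ (fderiv_I hφ z)

theorem pull_const_ι (hφ : ContDiffOn ℝ ∞ φ U) (α : Covec V) :
    pull φ hφ hm (const U' (ExteriorAlgebra.ι ℂ α)) =
      dl (scalar (α ∘ φ) (α.contDiff.comp_contDiffOn hφ)) +
        db (scalar (α ∘ φ) (α.contDiff.comp_contDiffOn hφ)) := ext fun z => by
  have hd : DifferentiableAt ℝ φ z :=
    (hφ.contDiffAt (U.isOpen.mem_nhds z.2)).differentiableAt (by simp)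
  rw [← diffOp_id, ev_diffOp_scalar, ev_pull, ev_const, pullForm_ι,
    (α.hasFDerivAt.comp _ hd.hasFDerivAt).fderiv]
  rfl

-- A real-linear function α is the sum of a complex-linear and a conjugate-linear one; composed with
-- the holomorphic `φ` these become holomorphic and antiholomorphic, so α ∘ φ is pluriharmonic. As
-- the pullback of the constant form α is d(α ∘ φ), that pullback is killed by both ∂ and ∂̄.
include hφ in
theorem dl_db_comp (α : Covec V) :
    dl (db (scalar (U := U) (α ∘ φ)
      (α.contDiff.comp_contDiffOn (hφ.restrict_scalars ℝ)))) = 0 := by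
  have h1 : scalar (U := U) (α ∘ φ) (α.contDiff.comp_contDiffOn (hφ.restrict_scalars ℝ)) =
      scalar (covec10 α ∘ φ) ((covec10 α).contDiff.comp_contDiffOn (hφ.restrict_scalars ℝ)) +
      scalar (covec01 α ∘ φ) ((covec01 α).contDiff.comp_contDiffOn (hφ.restrict_scalars ℝ)) := by
    refine ext fun z => ?_
    rw [map_add, ev_scalar, ev_scalar, ev_scalar, ← map_add]
    congr 1
    conv_lhs => rw [← covec10_add_covec01 α]
    rfl
  have hd : ∀ z : U, DifferentiableAt ℝ φ z := fun z =>
    ((hφ.restrict_scalars ℝ).contDiffAt (U.isOpen.mem_nhds z.2)).differentiableAt (by simp)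
  have h2 : db (scalar (U := U) (covec10 α ∘ φ)
      ((covec10 α).contDiff.comp_contDiffOn (hφ.restrict_scalars ℝ))) = 0 := ext fun z => by
    change ev z (diffOp covec01 _) = _
    rw [ev_diffOp_scalar, ((covec10 α).hasFDerivAt.comp _ (hd z).hasFDerivAt).fderiv,
      covec01_eq_zero, map_zero, map_zero]
    intro v
    simp [fderiv_I hφ, covec10_I]
  have h3 : dl (scalar (U := U) (covec01 α ∘ φ)
      ((covec01 α).contDiff.comp_contDiffOn (hφ.restrict_scalars ℝ))) = 0 := ext fun z => by
    change ev z (diffOp covec10 _) = _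
    rw [ev_diffOp_scalar, ((covec01 α).hasFDerivAt.comp _ (hd z).hasFDerivAt).fderiv,
      covec10_eq_zero, map_zero, map_zero]
    intro v
    simp [fderiv_I hφ, covec01_I]
  rw [h1, map_add, map_add, h2, map_zero, zero_add, ← neg_eq_zero, ← db_dl, h3, map_zero]

/-- A form is a sum of functions times constant forms. An antiderivation therefore commutes with
pullback as soon as it does so on functions and kills both constant forms and their pullbacks; by
the Leibniz rule the latter need be checked on covectors only. -/
theorem diffOp_pull {d : ∀ U : TopologicalSpace.Opens V, SmoothForms U →ₗ[ℂ] SmoothForms U}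
    (hd : ∀ U, IsAntiderivation (d U))
    (h0 : ∀ (α : Covec V), d U (pull φ (hφ.restrict_scalars ℝ) hm
      (const U' (ExteriorAlgebra.ι ℂ α))) = 0)
    (h0' : ∀ c, d U' (const U' c) = 0)
    (h1 : ∀ (h : V → ℂ) (hh : ContDiffOn ℝ ∞ h U'),
      d U (pull φ (hφ.restrict_scalars ℝ) hm (scalar h hh)) =
      pull φ (hφ.restrict_scalars ℝ) hm (d U' (scalar h hh))) (a : SmoothForms U') :
    pull φ (hφ.restrict_scalars ℝ) hm (d U' a) = d U (pull φ (hφ.restrict_scalars ℝ) hm a) := by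
  have hc : ∀ c : Form V, d U (pull φ (hφ.restrict_scalars ℝ) hm (const U' c)) = 0 := by
    intro c
    induction c using ExteriorAlgebra.induction with
    | algebraMap r =>
      rw [AlgHom.commutes, AlgHom.commutes, Algebra.algebraMap_eq_smul_one, map_smul, (hd U).one,
        smul_zero]
    | ι α => exact h0 α
    | mul a b ha hb => rw [map_mul, map_mul, (hd U).mul, ha, hb]; simp
    | add a b ha hb => rw [map_add, map_add, map_add, ha, hb, add_zero]
  have hs : ∀ s, ContDiffOn ℝ ∞ (fun z => (formBasis V).repr (toFun a z) s) U' :=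
    contDiffOn_form_iff.1 (contDiffOn a)
  have ha : a = ∑ s, scalar _ (hs s) * const U' (formBasis V s) := by
    refine ext fun z => ?_
    conv_lhs => rw [← (formBasis V).sum_repr (ev z a)]
    rw [map_sum]
    refine Finset.sum_congr rfl fun s _ => ?_
    rw [map_mul, ev_scalar, ev_const, toFun_apply, Algebra.smul_def]
  conv_lhs => rw [ha]
  conv_rhs => rw [ha]
  simp only [map_sum, map_mul, (hd U).mul, (hd U').mul, hc, h0', mul_zero, add_zero, h1]

theorem diffOp_const (τ : Covec V →ₗ[ℂ] Covec V) (c : Form V) :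
    diffOp τ (const U c) = 0 := by
  simp [diffOp_apply, pd_const]

theorem isDiffHom_pull : IsDiffHom (pull φ (hφ.restrict_scalars ℝ) hm) where
  parity a := ext fun z => by
    rw [ev_pull, ev_parity, ev_parity, ev_pull]
    exact (parity_map _ _).symm
  dl a := by
    refine diffOp_pull hφ hm (d := fun U => dl (A := SmoothForms U)) (fun U => dl_anti) ?_
      (diffOp_const covec10)
      (diffOp_pull_scalar hφ hm fun α T hT => covec10_comp α hT) a
    intro α
    rw [pull_const_ι, map_add, dl_dl, dl_db_comp hφ, add_zero]
  db a := by
    refine diffOp_pull hφ hm (d := fun U => db (A := SmoothForms U)) (fun U => db_anti) ?_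
      (diffOp_const covec01)
      (diffOp_pull_scalar hφ hm fun α T hT => covec01_comp α hT) a
    intro α
    rw [pull_const_ι, map_add, db_db, db_dl, dl_db_comp hφ, neg_zero, zero_add]

end Pull

end SmoothForms

/-! ## Extraction of coefficients of polynomials -/

section Coefficients

variable {M M' : Type*} [AddCommGroup M] [Module ℂ M] [AddCommGroup M'] [Module ℂ M']

/-- The coefficient of `λ^l` of a polynomial `f` of degree less than `N`, computed from the
values of `f` at `0, …, N - 1` by means of the inverse of the Vandermonde matrix. -/
def polyCoeff (N : ℕ) (f : ℂ → M) (l : ℕ) : M :=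
  if h : l < N then
    ∑ i : Fin N, (Matrix.vandermonde fun i : Fin N => (i : ℂ))⁻¹ ⟨l, h⟩ i • f i
  else 0

theorem polyCoeff_eq {N : ℕ} {f : ℂ → M} {w : ℕ → M}
    (hf : ∀ t : ℂ, f t = ∑ k ∈ Finset.range N, t ^ k • w k) {l : ℕ} (hl : l < N) :
    polyCoeff N f l = w l := by
  rw [polyCoeff, dif_pos hl]
  set A := Matrix.vandermonde fun i : Fin N => (i : ℂ) with hA
  have hdet : IsUnit A.det := by
    rw [isUnit_iff_ne_zero, hA, Matrix.det_vandermonde_ne_zero_iff]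
    intro i j hij
    simp only at hij
    exact Fin.ext (by exact_mod_cast hij)
  have h1 : ∀ i : Fin N, f i = ∑ k : Fin N, A i k • w k := by
    intro i
    rw [hf, Finset.sum_range]
    simp [hA, Matrix.vandermonde_apply]
  simp only [h1, Finset.smul_sum, smul_smul]
  rw [Finset.sum_comm]
  simp only [← Finset.sum_smul, ← Matrix.mul_apply, Matrix.nonsing_inv_mul _ hdet]
  rw [Finset.sum_eq_single ⟨l, hl⟩]
  · simp
  · intro k _ hk
    rw [Matrix.one_apply_ne hk.symm, zero_smul]
  · simp

/-- A coefficient obtained by interpolation is a fixed linear combination of values, and so it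
commutes with ∂, ∂̄, evaluation at a point and pullback. -/
theorem map_polyCoeff (L : M →ₗ[ℂ] M') (N : ℕ) (f : ℂ → M) (l : ℕ) :
    L (polyCoeff N f l) = polyCoeff N (fun t => L (f t)) l := by
  unfold polyCoeff
  split_ifs with h
  · simp
  · simp

end Coefficients

/-! ### Divided powers and the expansion of traces and determinants -/

section DividedPowers

variable {V : Type*} [NormedAddCommGroup V] [NormedSpace ℂ V] {m : ℕ}

theorem divPow_smul (c : ℂ) (x : BigForm V m) (k : ℕ) :
    divPow (c • x) k = c ^ k • divPow x k := by
  rw [divPow, divPow, smul_pow, smul_comm]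

theorem divPow_neg (x : BigForm V m) (k : ℕ) : divPow (-x) k = (-1 : ℂ) ^ k • divPow x k := by
  rw [← divPow_smul, neg_one_smul]

theorem divPow_add {x y : BigForm V m} (h : Commute x y) (n : ℕ) :
    divPow (x + y) n = ∑ l ∈ Finset.range (n + 1), divPow x (n - l) * divPow y l := by
  rw [divPow, add_comm x y, h.symm.add_pow, Finset.smul_sum]
  refine Finset.sum_congr rfl fun l hl => ?_
  have hln : l ≤ n := Nat.lt_succ_iff.1 (Finset.mem_range.1 hl)
  rw [divPow, divPow, smul_mul_smul_comm, (h.pow_pow _ _).eq.symm, ← nsmul_eq_mul',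
    ← Nat.cast_smul_eq_nsmul ℂ, smul_smul]
  congr 1
  have h1 : (l.factorial : ℂ) ≠ 0 := by exact_mod_cast l.factorial_ne_zero
  have h2 : ((n - l).factorial : ℂ) ≠ 0 := by exact_mod_cast (n - l).factorial_ne_zero
  have h3 : (n.factorial : ℂ) ≠ 0 := by exact_mod_cast n.factorial_ne_zero
  rw [Nat.cast_choose ℂ hln]
  field_simp

theorem mul_divPow (x : BigForm V m) (k : ℕ) :
    x * divPow x k = ((k : ℂ) + 1) • divPow x (k + 1) := by
  rw [divPow, divPow, mul_smul_comm, ← pow_succ', smul_smul]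
  congr 1
  have h1 : (k.factorial : ℂ) ≠ 0 := by exact_mod_cast k.factorial_ne_zero
  have h2 : (k : ℂ) + 1 ≠ 0 := by exact_mod_cast k.succ_ne_zero
  rw [Nat.factorial_succ]
  push_cast
  field_simp

variable {A B : Matrix (Fin m) (Fin m) (Form V)} (x : Matrix (Fin m) (Fin m) (Form V))
  (hA : ∀ i j, parity (A i j) = A i j) (hB : ∀ i j, parity (B i j) = B i j)

variable (A B) in
/-- The coefficient of `λ^l` in `tr (x adj (A + λ B))`. -/
def traceCoeff (l : ℕ) : Form V :=
  if l < m then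
    berezinₗ V m (snake x * divPow (snake A) (m - l - 1) * divPow (snake B) l) else 0

variable (A B) in
/-- The coefficient of `λ^l` in `det (A + λ B)`. -/
def detCoeff (l : ℕ) : Form V := berezinₗ V m (divPow (snake A) (m - l) * divPow (snake B) l)

theorem even_add_smul {A B : Matrix (Fin m) (Fin m) (Form V)}
    (hA : ∀ i j, parity (A i j) = A i j) (hB : ∀ i j, parity (B i j) = B i j) (t : ℂ)
    (i j : Fin m) : parity ((A + t • B) i j) = (A + t • B) i j := by
  simp [hA, hB]

include hA

theorem commute_snake : Commute (snake A) (snake B) :=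
  mul_comm_of_even _ _ (snake_even A hA)

include hB

/-- Through tr(x adj B) = ∫_e x̃ ∧ B̃_{m-1} this is the binomial formula for divided powers of two
commuting elements. -/
theorem trace_ladj_add (t : ℂ) :
    (x * ladj (A + t • B)).trace = ∑ l ∈ Finset.range m, t ^ l • traceCoeff A B x l := by
  rcases Nat.eq_zero_or_pos m with hm | hm
  · subst hm; simp [Matrix.trace]
  obtain ⟨n, rfl⟩ : ∃ n, m = n + 1 := ⟨m - 1, by omega⟩
  rw [← berezin_snake_mul_pow rfl x _ (even_add_smul hA hB t), snake_add, snake_smul,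
    divPow_add ((commute_snake hA).smul_right t), Finset.mul_sum, map_sum]
  refine Finset.sum_congr rfl fun l hl => ?_
  rw [traceCoeff, if_pos (Finset.mem_range.1 hl), divPow_smul, mul_smul_comm, mul_smul_comm,
    map_smul, show n + 1 - l - 1 = n - l by omega, mul_assoc]

theorem ldet_add (t : ℂ) :
    ldet (A + t • B) = ∑ l ∈ Finset.range (m + 1), t ^ l • detCoeff A B l := by
  rw [← berezin_divPow_snake _ (even_add_smul hA hB t), snake_add, snake_smul,
    divPow_add ((commute_snake hA).smul_right t), map_sum]
  refine Finset.sum_congr rfl fun l hl => ?_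
  rw [detCoeff, divPow_smul, mul_smul_comm, map_smul]

omit hB in
theorem traceCoeff_self {l : ℕ} (hl : l < m) :
    traceCoeff A B B l = ((l : ℂ) + 1) • detCoeff A B (l + 1) := by
  rw [traceCoeff, if_pos hl, detCoeff, ← map_smul, ← mul_smul_comm, ← mul_divPow]
  congr 1
  have h : snake B * divPow (snake A) (m - l - 1) = divPow (snake A) (m - l - 1) * snake B := by
    rw [divPow, mul_smul_comm, smul_mul_assoc, ((commute_snake hA).pow_left _).eq]
  rw [h, mul_assoc, Nat.sub_sub]

/-- The integrated form of Jacobi's formula: det(A + B) − det A is the integral of tr(B adj(A + tB))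
over [0,1], taken coefficient by coefficient. -/
theorem ldet_add_sub :
    ldet (A + B) - ldet A = ∑ l ∈ Finset.range m, ((l : ℂ) + 1)⁻¹ • traceCoeff A B B l := by
  have h1 := ldet_add hA hB 1
  have h0 := ldet_add hA hB 0
  rw [Finset.sum_range_succ'] at h1 h0
  simp only [one_smul, zero_smul, add_zero, one_pow, pow_zero, pow_succ, mul_zero,
    Finset.sum_const_zero, zero_add] at h1 h0
  rw [h1, h0, add_sub_cancel_right]
  refine Finset.sum_congr rfl fun l hl => ?_
  have h2 : (l : ℂ) + 1 ≠ 0 := by exact_mod_cast l.succ_ne_zero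
  rw [traceCoeff_self hA (Finset.mem_range.1 hl), smul_smul, inv_mul_cancel₀ h2, mul_one]

end DividedPowers

/-! ### The integral over the unit interval -/

section Integral

variable {V : Type*} [NormedAddCommGroup V] [NormedSpace ℂ V] [FiniteDimensional ℂ V] {m : ℕ}

theorem formIntegral_pow (N : ℕ) (w : ℕ → Form V) :
    formIntegral (fun t => ∑ l ∈ Finset.range N, (1 - (t : ℂ)) ^ l • w l) =
      ∑ l ∈ Finset.range N, ((l : ℂ) + 1)⁻¹ • w l := by
  have h1 : ∀ l : ℕ, ∫ t in (0 : ℝ)..1, (1 - (t : ℂ)) ^ l = ((l : ℂ) + 1)⁻¹ := by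
    intro l
    have := intervalIntegral.integral_comp_sub_left (a := 0) (b := 1)
      (fun t : ℝ => ((t ^ l : ℝ) : ℂ)) 1
    rw [sub_self, sub_zero, intervalIntegral.integral_ofReal (f := fun t : ℝ => t ^ l),
      integral_pow] at this
    simpa using this
  have h2 : ∀ s, (∫ t in (0 : ℝ)..1, (formBasis V).repr
      (∑ l ∈ Finset.range N, (1 - (t : ℂ)) ^ l • w l) s) =
      (formBasis V).repr (∑ l ∈ Finset.range N, ((l : ℂ) + 1)⁻¹ • w l) s := by
    intro s
    simp only [map_sum, map_smul, Finsupp.coe_finsetSum, Finset.sum_apply, Finsupp.smul_apply,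
      smul_eq_mul]
    rw [intervalIntegral.integral_finsetSum]
    · refine Finset.sum_congr rfl fun l _ => ?_
      rw [intervalIntegral.integral_mul_const, h1]
    · intro l _
      apply Continuous.intervalIntegrable
      fun_prop
  simp only [formIntegral, h2]
  exact (formBasis V).sum_repr _

/-- The integral defining `b`, evaluated. -/
theorem formIntegral_berezin_exp {A B : Matrix (Fin m) (Fin m) (Form V)}
    (hA : ∀ i j, parity (A i j) = A i j) (hB : ∀ i j, parity (B i j) = B i j)
    (x : Matrix (Fin m) (Fin m) (Form V)) :
    formIntegral (fun t => berezinₗ V m (snake x *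
      IsNilpotent.exp (snake (A + (1 - (t : ℂ)) • B)))) =
      ∑ l ∈ Finset.range m, ((l : ℂ) + 1)⁻¹ • traceCoeff A B x l := by
  rw [← formIntegral_pow]
  congr 1
  ext t
  rw [← trace_ladj_add x hA hB]
  have he := even_add_smul hA hB (1 - (t : ℂ))
  -- By nilpotence the exponential is a finite sum of divided powers. Since x̃ already supplies one
  -- pair `e_j ∧ e_k^*`, the fiber integral retains only the term of degree m − 1, and no term at
  -- all when m = 0.
  rw [IsNilpotent.exp_eq_sum (snake_pow_eq_zero _ he), Finset.mul_sum, map_sum]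
  have h1 : ∀ n : ℕ, ((n.factorial : ℚ)⁻¹ • snake (A + (1 - (t : ℂ)) • B) ^ n : BigForm V m) =
      divPow (snake (A + (1 - (t : ℂ)) • B)) n := by
    intro n
    have := ratCast_smul_eq (E := BigForm V m) ℚ ℂ (n.factorial : ℚ)⁻¹
      (snake (A + (1 - (t : ℂ)) • B) ^ n)
    rw [divPow]
    simpa using this
  simp only [h1]
  rcases Nat.eq_zero_or_pos m with hm | hm
  · subst hm
    rw [Finset.sum_eq_zero fun n _ => berezin_snake_mul_pow_of_ne (by omega) _ _]
    simp [Matrix.trace]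
  · rw [Finset.sum_eq_single (m - 1), berezin_snake_mul_pow (by omega) _ _ he]
    · intro n _ hn
      exact berezin_snake_mul_pow_of_ne (by omega) _ _
    · intro h
      exact absurd (Finset.mem_range.2 (by omega)) h

end Integral

/-! ## The transgression forms in a differential superalgebra -/

section Transgression

variable {A B : Type*} [Ring A] [Algebra ℂ A] [DiffSuperalgebra A]
  [Ring B] [Algebra ℂ B] [DiffSuperalgebra B] {m : ℕ}

/-- `tr (x adj (I + ℵ (Θ - (1 - t) ∂̄γ)))`. -/
def traceFun (Hi H P x : Matrix (Fin m) (Fin m) A) (t : ℂ) : A :=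
  (x * ladj (chernMatrix Hi H P (1 - t))).trace

/-- The Chern form. -/
def chernAbs (Hi H : Matrix (Fin m) (Fin m) A) : A := ldet (chernMatrix Hi H 0 0)

/-- The form `v`. -/
def vAbs (Hi H P : Matrix (Fin m) (Fin m) A) : A :=
  ∑ l ∈ Finset.Icc 1 (m - 1), (1 / (2 * l) : ℂ) • polyCoeff (m + 1) (traceFun Hi H P P) l

/-- The form `b`. -/
def bAbs (Hi H P : Matrix (Fin m) (Fin m) A) : A :=
  aleph • ∑ l ∈ Finset.range m,
    ((l : ℂ) + 1)⁻¹ • polyCoeff (m + 1) (traceFun Hi H P (gam Hi H P)) l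

theorem chernMatrix_one_sub (Hi H P : Matrix (Fin m) (Fin m) A) (t : ℂ) :
    chernMatrix Hi H P (1 - t) =
      chernMatrix Hi H P 1 + t • (aleph • (gam Hi H P).map db) := by
  simp only [chernMatrix, connμ, matrix_map_sub, matrix_map_smul]
  module

section

variable {f : A →ₐ[ℂ] B} (hf : IsDiffHom f) (Hi H P x : Matrix (Fin m) (Fin m) A)
include hf

theorem IsDiffHom.traceFun (t : ℂ) :
    f (traceFun Hi H P x t) = BottChern.traceFun (Hi.map f) (H.map f) (P.map f) (x.map f) t := by
  rw [BottChern.traceFun, BottChern.traceFun, ← hf.chernMatrix, ← map_ladj, ← Matrix.map_mul]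
  simp only [Matrix.trace, Matrix.diag_apply, Matrix.map_apply, map_sum]

theorem IsDiffHom.chernAbs : f (chernAbs Hi H) = BottChern.chernAbs (Hi.map f) (H.map f) := by
  rw [BottChern.chernAbs, BottChern.chernAbs, map_ldet, hf.chernMatrix, Matrix.map_zero _ (map_zero f)]

theorem IsDiffHom.vAbs :
    f (vAbs Hi H P) = BottChern.vAbs (Hi.map f) (H.map f) (P.map f) := by
  have : ∀ l, f (polyCoeff (m + 1) (BottChern.traceFun Hi H P P) l) = polyCoeff (m + 1)
      (BottChern.traceFun (Hi.map f) (H.map f) (P.map f) (P.map f)) l := fun l => by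
    refine (map_polyCoeff f.toLinearMap _ _ l).trans ?_
    congr 1
    ext1 t
    exact hf.traceFun ..
  simp only [BottChern.vAbs, map_sum, map_smul, this]

theorem IsDiffHom.bAbs :
    f (bAbs Hi H P) = BottChern.bAbs (Hi.map f) (H.map f) (P.map f) := by
  have : ∀ l, f (polyCoeff (m + 1) (BottChern.traceFun Hi H P (BottChern.gam Hi H P)) l) =
      polyCoeff (m + 1) (BottChern.traceFun (Hi.map f) (H.map f) (P.map f)
        (BottChern.gam (Hi.map f) (H.map f) (P.map f))) l := fun l => by
    refine (map_polyCoeff f.toLinearMap _ _ l).trans ?_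
    congr 1
    ext1 t
    rw [← hf.gam]
    exact hf.traceFun ..
  simp only [BottChern.bAbs, map_sum, map_smul, this]

end

section

variable {gi g g'i g' Hi H P : Matrix (Fin m) (Fin m) A} (hg : IsGauge gi g g'i g')
  (h : IsMetric Hi H) (hP : P.map parity = P)
include hg h

theorem IsGauge.chernAbs_eq :
    chernAbs (gi * Hi * g'i) (g' * H * g) = chernAbs Hi H := by
  have hz : (0 : Matrix (Fin m) (Fin m) A).map parity = 0 := by ext; simp
  have h1 := hg.chernMatrix_eq h hz 0
  rw [mul_zero, zero_mul] at h1
  rw [chernAbs, chernAbs, h1, hg.ldet_eq (h.chernMatrix_even hz 0)]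

include hP

theorem IsGauge.traceFun_eq (x : Matrix (Fin m) (Fin m) A) (t : ℂ) :
    traceFun (gi * Hi * g'i) (g' * H * g) (gi * P * g) (gi * x * g) t = traceFun Hi H P x t := by
  rw [traceFun, traceFun, hg.chernMatrix_eq h hP, hg.trace_eq _ (h.chernMatrix_even hP _)]

theorem IsGauge.vAbs_eq :
    vAbs (gi * Hi * g'i) (g' * H * g) (gi * P * g) = vAbs Hi H P := by
  have : traceFun (gi * Hi * g'i) (g' * H * g) (gi * P * g) (gi * P * g) = traceFun Hi H P P :=
    funext (hg.traceFun_eq h hP P)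
  rw [vAbs, vAbs, this]

theorem IsGauge.bAbs_eq :
    bAbs (gi * Hi * g'i) (g' * H * g) (gi * P * g) = bAbs Hi H P := by
  have : traceFun (gi * Hi * g'i) (g' * H * g) (gi * P * g)
      (gam (gi * Hi * g'i) (g' * H * g) (gi * P * g)) = traceFun Hi H P (gam Hi H P) := by
    rw [hg.gam_eq h hP]
    exact funext (hg.traceFun_eq h hP _)
  rw [bAbs, bAbs, this]

end

end Transgression

/-! ## Transgression for smooth forms on an open set -/

namespace SmoothForms

variable {V : Type*} [NormedAddCommGroup V] [NormedSpace ℂ V] [FiniteDimensional ℂ V]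
  {U : TopologicalSpace.Opens V} {m : ℕ}
  {Hi H P : Matrix (Fin m) (Fin m) (SmoothForms U)}

section Expansion

variable (h : IsMetric Hi H) (hP : P.map parity = P) (x : Matrix (Fin m) (Fin m) (SmoothForms U))
include h hP

omit h hP in
theorem ev_traceFun (z : U) (t : ℂ) :
    ev z (traceFun Hi H P x t) = (x.map (ev z) * ladj ((chernMatrix Hi H P 1).map (ev z) +
      t • (aleph • ((gam Hi H P).map db).map (ev z)))).trace := by
  have h1 : ((chernMatrix Hi H P 1).map (ev z) +
      t • (aleph • ((gam Hi H P).map db).map (ev z))) = (chernMatrix Hi H P (1 - t)).map (ev z) := by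
    rw [chernMatrix_one_sub]
    ext i j
    simp
  rw [h1, ← map_ladj, ← Matrix.map_mul, traceFun]
  simp only [Matrix.trace, Matrix.diag_apply, Matrix.map_apply, map_sum]

theorem ev_chernMatrix_even (z : U) (i j : Fin m) :
    parity ((chernMatrix Hi H P 1).map (ev z) i j) = (chernMatrix Hi H P 1).map (ev z) i j := by
  rw [Matrix.map_apply, ← ev_parity]
  exact congrArg (ev z) (congrFun (congrFun (h.chernMatrix_even hP 1) i) j)

theorem ev_dbGam_even (z : U) (i j : Fin m) :
    parity ((aleph • ((gam Hi H P).map db).map (ev z)) i j) =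
      (aleph • ((gam Hi H P).map db).map (ev z)) i j := by
  rw [Matrix.smul_apply, map_smul, Matrix.map_apply, ← ev_parity]
  exact congrArg (fun a => aleph • ev z a)
    (congrFun (congrFun (db_anti.odd_map (h.gam_odd hP)) i) j)

theorem ev_traceFun_eq_sum (z : U) (t : ℂ) :
    ev z (traceFun Hi H P x t) = ∑ l ∈ Finset.range m, t ^ l •
      traceCoeff ((chernMatrix Hi H P 1).map (ev z)) (aleph • ((gam Hi H P).map db).map (ev z))
        (x.map (ev z)) l := by
  rw [ev_traceFun, trace_ladj_add _ (ev_chernMatrix_even h hP z) (ev_dbGam_even h hP z)]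

theorem ev_polyCoeff (z : U) {l : ℕ} (hl : l < m + 1) :
    ev z (polyCoeff (m + 1) (traceFun Hi H P x) l) =
      traceCoeff ((chernMatrix Hi H P 1).map (ev z)) (aleph • ((gam Hi H P).map db).map (ev z))
        (x.map (ev z)) l := by
  have h1 : ev z (polyCoeff (m + 1) (traceFun Hi H P x) l) =
      polyCoeff (m + 1) (fun t => ev z (traceFun Hi H P x t)) l :=
    map_polyCoeff (ev z).toLinearMap _ _ l
  rw [h1]
  refine polyCoeff_eq (fun t => ?_) hl
  rw [ev_traceFun_eq_sum h hP, Finset.sum_range_succ]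
  have h2 : traceCoeff ((chernMatrix Hi H P 1).map (ev z))
      (aleph • ((gam Hi H P).map db).map (ev z)) (x.map (ev z)) m = 0 := by
    rw [traceCoeff, if_neg (lt_irrefl m)]
  rw [h2, smul_zero, add_zero]

theorem traceFun_eq_sum (t : ℂ) : traceFun Hi H P x t =
    ∑ l ∈ Finset.range m, t ^ l • polyCoeff (m + 1) (traceFun Hi H P x) l := ext fun z => by
  rw [ev_traceFun_eq_sum h hP, map_sum]
  refine Finset.sum_congr rfl fun l hl => ?_
  rw [map_smul, ev_polyCoeff h hP _ _ (by have := Finset.mem_range.1 hl; omega)]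

/-- The entries of the adjugate have degree at most m − 1 in t. Interpolation at m + 1 points, one
more than necessary, makes this vanishing coefficient available to `dl_vAbs`. -/
theorem polyCoeff_self : polyCoeff (m + 1) (traceFun Hi H P x) m = 0 := ext fun z => by
  rw [ev_polyCoeff h hP _ _ (Nat.lt_succ_self m), traceCoeff, if_neg (lt_irrefl m), map_zero]

/-- `∂̄b = c(D_E) - c(D_E - γ)`. -/
theorem db_bAbs : db (bAbs Hi H P) = chernAbs Hi H - ldet (chernMatrix Hi H P 1) := ext fun z => by
  have h1 : ∀ l, db (polyCoeff (m + 1) (traceFun Hi H P (gam Hi H P)) l) =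
      polyCoeff (m + 1) (traceFun Hi H P ((gam Hi H P).map db)) l := by
    intro l
    rw [map_polyCoeff]
    congr 1
    ext1 t
    exact h.db_trace_gam hP _
  -- At μ = 0 the projection does not enter. Writing 0 as 1 − 1 places this matrix at t = 1 of the
  -- pencil A + tB with A the matrix at μ = 1 and B = ℵ∂̄γ, so that `ldet_add_sub` compares the two
  -- ends.
  have h2 : chernMatrix Hi H 0 0 = chernMatrix Hi H P (1 - 1) := by
    rw [sub_self, chernMatrix_zero, chernMatrix_zero]
  have h3 : ev z (ldet (chernMatrix Hi H P (1 - 1))) = ldet ((chernMatrix Hi H P 1).map (ev z) +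
      aleph • ((gam Hi H P).map db).map (ev z)) := by
    rw [chernMatrix_one_sub, map_ldet]
    congr 1
    ext i j
    simp
  rw [map_sub, chernAbs, h2, h3, map_ldet, ldet_add_sub (ev_chernMatrix_even h hP z)
    (ev_dbGam_even h hP z), bAbs, map_smul, map_smul, map_sum, map_sum, Finset.smul_sum]
  refine Finset.sum_congr rfl fun l hl => ?_
  have hl' := Finset.mem_range.1 hl
  rw [map_smul, map_smul, h1, ev_polyCoeff h hP _ _ (by omega), smul_comm]
  congr 1
  rw [traceCoeff, traceCoeff, if_pos hl', if_pos hl', snake_smul aleph]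
  simp only [smul_mul_assoc, map_smul]

variable (hPP : P * P = P) (hPγ : P * gam Hi H P = 0)
include hPP hPγ

/-- With μ = 1 − t, `IsMetric.dl_trace` says that ∂ turns the trace with P into t times the trace
with γ. The factor t shifts coefficients by one. -/
theorem dl_polyCoeff {l : ℕ} (hl : l < m) :
    dl (polyCoeff (m + 1) (traceFun Hi H P P) (l + 1)) =
      polyCoeff (m + 1) (traceFun Hi H P (gam Hi H P)) l := by
  rw [map_polyCoeff]
  let w : ℕ → SmoothForms U := fun k =>
    if k = 0 then 0 else polyCoeff (m + 1) (traceFun Hi H P (gam Hi H P)) (k - 1)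
  have h1 := polyCoeff_eq (N := m + 1) (f := fun t => dl (traceFun Hi H P P t)) (w := w) ?_
    (Nat.succ_lt_succ hl)
  · simpa [w] using h1
  · intro t
    rw [Finset.sum_range_succ']
    have h2 : dl (traceFun Hi H P P t) = t • traceFun Hi H P (gam Hi H P) t := by
      rw [traceFun, h.dl_trace hP hPP hPγ, sub_sub_cancel]; rfl
    rw [h2, traceFun_eq_sum h hP, Finset.smul_sum]
    simp [w, pow_succ', smul_smul]

/-- `2ℵ ∂v = b`. -/
theorem dl_vAbs : (2 * aleph) • dl (vAbs Hi H P) = bAbs Hi H P := by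
  rcases Nat.eq_zero_or_pos m with hm | hm
  · subst hm
    simp [vAbs, bAbs]
  obtain ⟨n, rfl⟩ : ∃ n, m = n + 1 := ⟨m - 1, by omega⟩
  -- The sum for b has one term more than the derivative of v accounts for. That top term is ∂ of
  -- the coefficient of t^m in the trace with P, which is zero.
  have h1 : polyCoeff (n + 1 + 1) (traceFun Hi H P (gam Hi H P)) n = 0 := by
    rw [← dl_polyCoeff h hP hPP hPγ (Nat.lt_succ_self n), polyCoeff_self h hP, map_zero]
  rw [vAbs, bAbs, Finset.sum_range_succ, h1, smul_zero, add_zero, map_sum, mul_comm, mul_smul]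
  congr 1
  rw [Nat.add_sub_cancel, Finset.smul_sum, ← Finset.Ico_add_one_right_eq_Icc,
    Finset.sum_Ico_eq_sum_range, Nat.add_sub_cancel]
  refine Finset.sum_congr rfl fun l hl => ?_
  have hl' : (l : ℂ) + 1 ≠ 0 := Nat.cast_add_one_ne_zero l
  rw [map_smul, add_comm 1 l, dl_polyCoeff h hP hPP hPγ
    ((Finset.mem_range.1 hl).trans (Nat.lt_succ_self n)), smul_smul]
  congr 1
  push_cast
  field_simp

end Expansion

theorem db_chernAbs (h : IsMetric Hi H) : db (chernAbs Hi H) = 0 :=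
  h.db_ldet (by ext; simp) 0

theorem dl_chernAbs (h : IsMetric Hi H) : dl (chernAbs Hi H) = 0 := by
  have hz : (0 : Matrix (Fin m) (Fin m) (SmoothForms U)).map parity = 0 := by ext; simp
  have h1 : connμ Hi H 0 0 = conn Hi H := by rw [connμ, zero_smul, sub_zero]
  exact dl_ldet_eq_zero (h.chernMatrix_even hz 0)
    (h.dl_chernMatrix hz 0 (by rw [h1, h.dl_conn]))

end SmoothForms

/-! ## Local formulas as elements of the algebra of smooth forms -/

namespace SmoothForms

variable {V : Type*} [NormedAddCommGroup V] [NormedSpace ℂ V] [FiniteDimensional ℂ V]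
  {U : TopologicalSpace.Opens V} {k l n m : ℕ}

/-- The matrix `M` of forms of degree zero is given by the matrix of functions `H`. -/
def Represents (M : Matrix (Fin k) (Fin l) (SmoothForms U))
    (H : V → Matrix (Fin k) (Fin l) ℂ) : Prop :=
  ∀ (z : U) i j, ev z (M i j) = algebraMap ℂ (Form V) (H z i j)

theorem Represents.mul {M : Matrix (Fin k) (Fin l) (SmoothForms U)}
    {N : Matrix (Fin l) (Fin n) (SmoothForms U)} {H : V → Matrix (Fin k) (Fin l) ℂ}
    {K : V → Matrix (Fin l) (Fin n) ℂ} (hM : Represents M H) (hN : Represents N K) :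
    Represents (M * N) (fun z => H z * K z) := fun z i j => by
  dsimp only
  rw [Matrix.mul_apply, Matrix.mul_apply, map_sum, map_sum]
  exact Finset.sum_congr rfl fun a _ => by rw [map_mul, map_mul, hM, hN]

theorem Represents.add {M N : Matrix (Fin k) (Fin l) (SmoothForms U)}
    {H K : V → Matrix (Fin k) (Fin l) ℂ} (hM : Represents M H) (hN : Represents N K) :
    Represents (M + N) (fun z => H z + K z) := fun z i j => by
  dsimp only
  rw [Matrix.add_apply, Matrix.add_apply, map_add, map_add, hM, hN]

theorem Represents.zero : Represents (U := U) (0 : Matrix (Fin k) (Fin l) _) (fun _ => 0) :=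
  fun z i j => by simp

theorem Represents.one : Represents (U := U) (1 : Matrix (Fin k) (Fin k) _) (fun _ => 1) :=
  fun z i j => by by_cases h : i = j <;> simp [h, Matrix.one_apply]

theorem Represents.eq {M N : Matrix (Fin k) (Fin l) (SmoothForms U)}
    {H K : V → Matrix (Fin k) (Fin l) ℂ} (hM : Represents M H) (hN : Represents N K)
    (h : ∀ z ∈ U, H z = K z) : M = N := by
  ext i j
  exact ext fun z => by rw [hM, hN, h z z.2]

theorem Represents.congr {M : Matrix (Fin k) (Fin l) (SmoothForms U)}
    {H K : V → Matrix (Fin k) (Fin l) ℂ} (hM : Represents M H)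
    (h : ∀ z ∈ U, H z = K z) : Represents M K := fun z i j => by rw [hM, h z z.2]

theorem Represents.even {M : Matrix (Fin k) (Fin l) (SmoothForms U)}
    {H : V → Matrix (Fin k) (Fin l) ℂ} (hM : Represents M H) : M.map parity = M := by
  ext i j
  exact ext fun z => by rw [Matrix.map_apply, ev_parity, hM, AlgHom.commutes]

theorem Represents.isMetric {M N : Matrix (Fin k) (Fin k) (SmoothForms U)}
    {H : V → Matrix (Fin k) (Fin k) ℂ} (hM : Represents M H)
    (hN : Represents N (fun z => (H z)⁻¹)) (h : ∀ z ∈ U, IsUnit (H z).det) : IsMetric N M where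
  even := hM.even
  even' := hN.even
  mul := (hM.mul hN).eq .one fun z hz => Matrix.mul_nonsing_inv _ (h z hz)
  mul' := (hN.mul hM).eq .one fun z hz => Matrix.nonsing_inv_mul _ (h z hz)

/-- A smooth matrix valued function, as a matrix of forms. -/
def scalarMatrix (H : V → Matrix (Fin k) (Fin l) ℂ)
    (hH : ∀ i j, ContDiffOn ℝ ∞ (fun z => H z i j) U) : Matrix (Fin k) (Fin l) (SmoothForms U) :=
  Matrix.of fun i j => scalar _ (hH i j)

theorem represents_scalarMatrix (H : V → Matrix (Fin k) (Fin l) ℂ)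
    (hH : ∀ i j, ContDiffOn ℝ ∞ (fun z => H z i j) U) : Represents (scalarMatrix H hH) H :=
  fun _ _ _ => rfl

theorem represents_pull {U' : TopologicalSpace.Opens V} {φ : V → V} (hφ : ContDiffOn ℝ ∞ φ U)
    (hm : ∀ z ∈ U, φ z ∈ U') {M : Matrix (Fin k) (Fin l) (SmoothForms U')}
    {H : V → Matrix (Fin k) (Fin l) ℂ} (hM : Represents M H) :
    Represents (M.map (pull φ hφ hm)) (fun z => H (φ z)) := fun z i j => by
  rw [Matrix.map_apply, ev_pull, hM, AlgHom.commutes]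

omit [FiniteDimensional ℂ V] in
theorem contDiffOn_det {H : V → Matrix (Fin k) (Fin k) ℂ}
    (hH : ∀ i j, ContDiffOn ℝ ∞ (fun z => H z i j) U) : ContDiffOn ℝ ∞ (fun z => (H z).det) U := by
  simp only [Matrix.det_apply']
  exact ContDiffOn.sum fun σ _ => contDiffOn_const.mul (contDiffOn_prod fun i _ => hH _ _)

omit [FiniteDimensional ℂ V] in
theorem contDiffOn_inv {H : V → Matrix (Fin k) (Fin k) ℂ}
    (hH : ∀ i j, ContDiffOn ℝ ∞ (fun z => H z i j) U) (h : ∀ z ∈ U, IsUnit (H z).det) (i j) :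
    ContDiffOn ℝ ∞ (fun z => (H z)⁻¹ i j) U := by
  simp only [Matrix.inv_def, Matrix.smul_apply, Ring.inverse_eq_inv', Matrix.adjugate_apply,
    smul_eq_mul]
  refine ((contDiffOn_det hH).inv fun z hz => (h z hz).ne_zero).mul
    (contDiffOn_det fun a b => ?_)
  by_cases ha : a = j
  · subst ha
    simp only [Matrix.updateRow_self]
    exact contDiffOn_const
  · simp only [Matrix.updateRow_ne ha]
    exact hH a b

section Evaluation

variable {Hi Hm Pm : Matrix (Fin m) (Fin m) (SmoothForms U)} {H P : V → Matrix (Fin m) (Fin m) ℂ}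
  (hH : Represents Hm H) (hHi : Represents Hi (fun z => (H z)⁻¹))
include hH hHi

theorem ev_conn (z : U) : (conn Hi Hm).map (ev z) = chernConnection H z := by
  ext i j
  rw [conn, Matrix.map_apply, Matrix.mul_apply, map_sum, chernConnection]
  refine Finset.sum_congr rfl fun a _ => ?_
  rw [map_mul, hHi, Matrix.map_apply, ev_dl (g := fun y => algebraMap ℂ (Form V) (H y a j)) (fun z => hH z a j),
    Algebra.smul_def]

/-- The ∂θ part of dθ cancels θ ∧ θ by `IsMetric.dl_conn`, leaving ∂̄θ. -/
theorem ev_curvature (hu : ∀ z ∈ U, IsUnit (H z).det) (z : U) :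
    ((conn Hi Hm).map db).map (ev z) = curvature H z := by
  ext i j
  have h1 := congrFun (congrFun (hH.isMetric hHi hu).dl_conn i) j
  have h2 : ∀ y : U, ∀ a b, ev y (conn Hi Hm a b) = chernConnection H y a b := fun y a b =>
    congrFun (congrFun (ev_conn hH hHi y) a) b
  rw [curvature, ← ev_d (h2 · i j) z, map_add]
  simp only [← h2]
  rw [Matrix.map_apply] at h1
  rw [h1, Matrix.neg_apply, Matrix.mul_apply, map_neg, map_sum]
  simp

theorem ev_chernAbs (hu : ∀ z ∈ U, IsUnit (H z).det) (z : U) :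
    ev z (chernAbs Hi Hm) = chernFormL H z := by
  rw [chernAbs, chernMatrix_zero, map_ldet]
  change _ = ldet (aleph • curvature H z + 1)
  rw [← ev_curvature hH hHi hu, add_comm]
  congr 1
  ext i j
  by_cases h : i = j <;> simp [h]

variable (hP : Represents Pm P)
include hP

theorem ev_gam (z : U) : (gam Hi Hm Pm).map (ev z) = gammaL H P z := by
  have h1 : Pm.map (ev z) = toForms (P z) := by ext i j; exact hP z i j
  have h2 : (Pm.map dl).map (ev z) =
      Matrix.of (fun i j => delL (fun y => algebraMap ℂ (Form V) (P y i j)) z) := by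
    ext i j
    exact ev_dl (fun z => hP z i j) z
  rw [gammaL, ← h1, ← h2, ← ev_conn hH hHi, ← Matrix.map_mul, ← Matrix.map_mul, gam]
  ext i j
  simp only [Matrix.map_apply, Matrix.sub_apply, Matrix.add_apply, map_sub, map_add]

theorem ev_dbGam (z : U) : ((gam Hi Hm Pm).map db).map (ev z) = dbarGammaL H P z := by
  ext i j
  exact ev_db (fun y => congrFun (congrFun (ev_gam hH hHi hP y) i) j) z

variable (hu : ∀ z ∈ U, IsUnit (H z).det)
include hu

theorem ev_chernMatrix_one (z : U) : (chernMatrix Hi Hm Pm 1).map (ev z) =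
    1 + aleph • curvature H z - aleph • dbarGammaL H P z := by
  rw [← ev_curvature hH hHi hu, ← ev_dbGam hH hHi hP]
  ext i j
  by_cases h : i = j <;> simp [chernMatrix, connμ, h, smul_sub, add_sub_assoc]

theorem ev_vAbs (z : U) : ev z (vAbs Hi Hm Pm) = vFormL H P z := by
  have hm := hH.isMetric hHi hu
  have h1 : Pm.map (ev z) = toForms (P z) := by ext i j; exact hP z i j
  rw [vAbs, map_sum, vFormL]
  refine Finset.sum_congr rfl fun l hl => ?_
  have hl' := Finset.mem_Icc.1 hl
  rw [map_smul, ev_polyCoeff hm hP.even _ _ (by omega), ev_chernMatrix_one hH hHi hP hu,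
    ev_dbGam hH hHi hP, traceCoeff, if_pos (by omega), h1, berezin_eq, divPow_neg,
    snake_smul, mul_smul_comm, map_smul, smul_smul]
  congr 1
  -- The sign (−1)^l in front cancels the one coming from the divided power of −ℵ∂̄γ̃; this is why
  -- `vAbs` has weights 1/(2l).
  · rw [div_mul_eq_mul_div, ← mul_pow]
    norm_num
  · rw [sub_eq_add_neg, snake_add, snake_add, snake_smul, ← neg_smul,
      snake_smul, neg_smul, ← sub_eq_add_neg]

theorem ev_bAbs (z : U) : ev z (bAbs Hi Hm Pm) = bFormL H P z := by
  have hm := hH.isMetric hHi hu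
  have h1 := formIntegral_berezin_exp (ev_chernMatrix_even hm hP.even z)
    (ev_dbGam_even hm hP.even z) (aleph • (gam Hi Hm Pm).map (ev z))
  rw [bFormL]
  refine Eq.trans ?_ (h1.symm.trans ?_)
  · rw [bAbs, map_smul, map_sum, Finset.smul_sum]
    refine Finset.sum_congr rfl fun l hl => ?_
    have hl' := Finset.mem_range.1 hl
    rw [map_smul, ev_polyCoeff hm hP.even _ _ (by omega), smul_comm, traceCoeff, traceCoeff,
      if_pos hl', if_pos hl', snake_smul aleph ((gam Hi Hm Pm).map (ev z))]
    simp only [smul_mul_assoc, map_smul]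
  · congr 1
    ext1 t
    rw [← berezin_eq, snake_smul, ev_gam hH hHi hP, ev_dbGam hH hHi hP,
      ev_chernMatrix_one hH hHi hP hu]
    -- The exponent at time t is A + (1 − t)B, where A = I + ℵΘ − ℵ∂̄γ and B = ℵ∂̄γ.
    have : (1 + aleph • curvature H z - aleph • dbarGammaL H P z) +
        (1 - (t : ℂ)) • aleph • dbarGammaL H P z =
        1 + aleph • curvature H z + (-(t : ℂ)) • aleph • dbarGammaL H P z := by module
    rw [this, snake_add, snake_add, snake_smul, snake_smul, snake_smul, neg_smul,
      ← sub_eq_add_neg]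

end Evaluation

end SmoothForms

/-! ## Forms of type `(k, k)` -/

section Bidegree

variable (V : Type*) [NormedAddCommGroup V] [NormedSpace ℂ V]

/-- The covectors of type `(1,0)`, as forms. -/
def forms10 : Submodule ℂ (Form V) :=
  (LinearMap.range (covec10 (V := V))).map (ExteriorAlgebra.ι ℂ)

/-- The covectors of type `(0,1)`, as forms. -/
def forms01 : Submodule ℂ (Form V) :=
  (LinearMap.range (covec01 (V := V))).map (ExteriorAlgebra.ι ℂ)

variable {V}

theorem ι_covec10_mem (α : Covec V) : ExteriorAlgebra.ι ℂ (covec10 α) ∈ forms10 V :=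
  ⟨_, ⟨α, rfl⟩, rfl⟩

theorem ι_covec01_mem (α : Covec V) : ExteriorAlgebra.ι ℂ (covec01 α) ∈ forms01 V :=
  ⟨_, ⟨α, rfl⟩, rfl⟩

theorem ι_anticomm {M : Type*} [AddCommGroup M] [Module ℂ M] (a b : M) :
    ExteriorAlgebra.ι ℂ a * ExteriorAlgebra.ι ℂ b =
      -(ExteriorAlgebra.ι ℂ b * ExteriorAlgebra.ι ℂ a) := by
  rw [ι_mul, parity_ι, neg_mul]

theorem commute_forms (W W' : Submodule ℂ (Covec V)) :
    Commute (W.map (ExteriorAlgebra.ι ℂ)) (W'.map (ExteriorAlgebra.ι ℂ)) := by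
  have key : ∀ W W' : Submodule ℂ (Covec V), W.map (ExteriorAlgebra.ι ℂ) *
      W'.map (ExteriorAlgebra.ι ℂ) ≤ W'.map (ExteriorAlgebra.ι ℂ) *
      W.map (ExteriorAlgebra.ι ℂ) := fun W W' => by
    rw [Submodule.mul_le]
    rintro _ ⟨a, ha, rfl⟩ _ ⟨b, hb, rfl⟩
    rw [ι_anticomm]
    exact neg_mem (Submodule.mul_mem_mul ⟨b, hb, rfl⟩ ⟨a, ha, rfl⟩)
  exact le_antisymm (key W W') (key W' W)

theorem bidegree_mul (p q p' q' : ℕ) :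
    bidegree V p q * bidegree V p' q' = bidegree V (p + p') (q + q') := by
  have h := ((commute_forms (LinearMap.range (covec01 (V := V)))
    (LinearMap.range (covec10 (V := V)))).pow_pow q p').eq
  rw [bidegree, bidegree, bidegree, mul_assoc, ← mul_assoc (_ ^ q), h, pow_add, pow_add]
  simp only [mul_assoc]

variable (V) in
/-- The subalgebra of the sums of forms of type `(k, k)`. -/
def formsKK : Subalgebra ℂ (Form V) :=
  (⨆ k : ℕ, bidegree V k k).toSubalgebra
    (Submodule.mem_iSup_of_mem 0 (by simp [bidegree, Submodule.one_le.1 le_rfl]))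
    (fun x y hx hy => by
      have h := Submodule.mul_mem_mul hx hy
      rw [Submodule.iSup_mul] at h
      refine (iSup_le fun k => ?_ : _ ≤ (⨆ k : ℕ, bidegree V k k)) h
      rw [Submodule.mul_iSup]
      refine iSup_le fun l => ?_
      rw [bidegree_mul]
      exact le_iSup (fun k => bidegree V k k) (k + l))

theorem mem_formsKK {x : Form V} : x ∈ formsKK V ↔ x ∈ ⨆ k : ℕ, bidegree V k k := Iff.rfl

theorem mul_mem_formsKK {x y : Form V} (hx : x ∈ forms01 V) (hy : y ∈ forms10 V) :
    x * y ∈ formsKK V := by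
  refine mem_formsKK.2 (Submodule.mem_iSup_of_mem 1 ?_)
  rw [bidegree, pow_one, pow_one, (commute_forms _ _).eq]
  exact Submodule.mul_mem_mul hx hy

/-- An algebra homomorphism which acts on `(p, q)` forms by `c^p c'^q` when it does so on
covectors. -/
theorem map_bidegree {f : Form V →ₐ[ℂ] Form V} {c c' : ℂ} (h : ∀ x ∈ forms10 V, f x = c • x)
    (h' : ∀ x ∈ forms01 V, f x = c' • x) (p q : ℕ) {x : Form V} (hx : x ∈ bidegree V p q) :
    f x = (c ^ p * c' ^ q) • x := by
  have key : ∀ (W : Submodule ℂ (Form V)) (a : ℂ), (∀ x ∈ W, f x = a • x) → ∀ n : ℕ,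
      ∀ x ∈ W ^ n, f x = a ^ n • x := by
    intro W a hW n
    induction n with
    | zero =>
      intro x hx
      obtain ⟨r, rfl⟩ := Submodule.mem_one.1 (by simpa using hx)
      simp
    | succ n ih =>
      intro x hx
      rw [pow_succ] at hx
      induction hx using Submodule.mul_induction_on' with
      | mem_mul_mem x hx y hy =>
        rw [map_mul, ih x hx, hW y hy, smul_mul_smul_comm, pow_succ]
      | add x _ y _ hx hy => rw [map_add, hx, hy, smul_add]
  induction hx using Submodule.mul_induction_on' with
  | mem_mul_mem x hx y hy =>
    rw [map_mul, key _ _ h p x hx, key _ _ h' q y hy, smul_mul_smul_comm]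
  | add x _ y _ hx hy => rw [map_add, hx, hy, smul_add]

/-- On type (k, k) such a map acts by (c c')^k. The weights (−1, −1) show that these forms are even,
and the weights (2, 1/2) serve to tell ∂ from ∂̄. -/
theorem map_formsKK {f : Form V →ₐ[ℂ] Form V} {c c' : ℂ} (h : ∀ x ∈ forms10 V, f x = c • x)
    (h' : ∀ x ∈ forms01 V, f x = c' • x) (hc : c * c' = 1) {x : Form V} (hx : x ∈ formsKK V) :
    f x = x := by
  rw [mem_formsKK] at hx
  induction hx using Submodule.iSup_induction' with
  | mem k x hx => rw [map_bidegree h h' k k hx, ← mul_pow, hc, one_pow, one_smul]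
  | zero => exact map_zero f
  | add x y _ _ hx hy => rw [map_add, hx, hy]

theorem parity_formsKK {x : Form V} (hx : x ∈ formsKK V) : parity x = x := by
  refine map_formsKK (f := parity) (c := -1) (c' := -1) ?_ ?_ (by norm_num) hx
  · rintro _ ⟨a, _, rfl⟩
    rw [parity_ι, neg_one_smul]
  · rintro _ ⟨a, _, rfl⟩
    rw [parity_ι, neg_one_smul]

theorem pullForm_mem_formsKK {T : V →L[ℝ] V} (hT : ∀ v, T (Complex.I • v) = Complex.I • T v)
    {x : Form V} (hx : x ∈ formsKK V) : pullForm T x ∈ formsKK V := by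
  have h10 : (forms10 V).map (pullForm T).toLinearMap ≤ forms10 V := by
    rintro _ ⟨_, ⟨_, ⟨a, rfl⟩, rfl⟩, rfl⟩
    rw [AlgHom.toLinearMap_apply]
    have h := ι_covec10_mem (pullCovec T a)
    rw [covec10_comp a hT] at h
    rw [pullForm_ι]
    exact h
  have h01 : (forms01 V).map (pullForm T).toLinearMap ≤ forms01 V := by
    rintro _ ⟨_, ⟨_, ⟨a, rfl⟩, rfl⟩, rfl⟩
    rw [AlgHom.toLinearMap_apply]
    have h := ι_covec01_mem (pullCovec T a)
    rw [covec01_comp a hT] at h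
    rw [pullForm_ι]
    exact h
  have hk : ∀ k, (bidegree V k k).map (pullForm T).toLinearMap ≤ bidegree V k k := fun k => by
    rw [bidegree, Submodule.map_mul, Submodule.map_pow, Submodule.map_pow]
    exact mul_le_mul' (pow_le_pow_left' h10 k) (pow_le_pow_left' h01 k)
  have h : (⨆ k : ℕ, bidegree V k k).map (pullForm T).toLinearMap ≤ ⨆ k : ℕ, bidegree V k k := by
    rw [Submodule.map_iSup]
    exact iSup_mono hk
  exact h ⟨x, hx, rfl⟩

variable (V) in
/-- The algebra automorphism acting by `2^(p - q)` on forms of type `(p, q)`. -/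
def scaleBidegree : Form V →ₐ[ℂ] Form V :=
  ExteriorAlgebra.map ((2 : ℂ) • covec10 + (1 / 2 : ℂ) • covec01)

theorem scaleBidegree_10 {x : Form V} (hx : x ∈ forms10 V) :
    scaleBidegree V x = (2 : ℂ) • x := by
  obtain ⟨_, ⟨a, rfl⟩, rfl⟩ := hx
  have h1 : covec01 (covec10 a) = 0 := covec01_eq_zero (covec10_I a)
  have h2 : covec10 (covec10 a) = covec10 a := by
    conv_rhs => rw [← SmoothForms.covec10_add_covec01 (covec10 a), h1, add_zero]
  rw [scaleBidegree, ExteriorAlgebra.map_apply_ι, LinearMap.add_apply, LinearMap.smul_apply,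
    LinearMap.smul_apply, h1, h2, smul_zero, add_zero, map_smul]

theorem scaleBidegree_01 {x : Form V} (hx : x ∈ forms01 V) :
    scaleBidegree V x = (1 / 2 : ℂ) • x := by
  obtain ⟨_, ⟨a, rfl⟩, rfl⟩ := hx
  have h1 : covec10 (covec01 a) = 0 := covec10_eq_zero (covec01_I a)
  have h2 : covec01 (covec01 a) = covec01 a := by
    conv_rhs => rw [← SmoothForms.covec10_add_covec01 (covec01 a), h1, zero_add]
  rw [scaleBidegree, ExteriorAlgebra.map_apply_ι, LinearMap.add_apply, LinearMap.smul_apply,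
    LinearMap.smul_apply, h1, h2, smul_zero, zero_add, map_smul]

theorem scaleBidegree_KK {x : Form V} (hx : x ∈ formsKK V) : scaleBidegree V x = x :=
  map_formsKK (fun _ => scaleBidegree_10) (fun _ => scaleBidegree_01) (by norm_num) hx

end Bidegree

namespace SmoothForms

variable {V : Type*} [NormedAddCommGroup V] [NormedSpace ℂ V] [FiniteDimensional ℂ V]
  {U : TopologicalSpace.Opens V} {m : ℕ}

/-- A linear projection onto `W` fixes `a` pointwise and commutes with differentiation. -/
theorem pd_mem (W : Submodule ℂ (Form V)) {a : SmoothForms U} (h : ∀ z, ev z a ∈ W) (w : V)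
    (z : U) : ev z (pd w a) ∈ W := by
  obtain ⟨g, hg⟩ := LinearMap.exists_leftInverse_of_injective W.subtype W.ker_subtype
  have hp : ∀ x ∈ W, (W.subtype ∘ₗ g) x = x := fun x hx =>
    congrArg W.subtype (DFunLike.congr_fun hg (⟨x, hx⟩ : W))
  have h1 : fderiv ℝ (toFun a) z = fderiv ℝ (formCLM (W.subtype ∘ₗ g) ∘ toFun a) z :=
    fderiv_toFun (fun y => by
      rw [Function.comp_apply, toFun_apply, formCLM_apply, hp _ (h y)]) z
  rw [ev_pd, h1, ((formCLM (W.subtype ∘ₗ g)).hasFDerivAt.comp _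
    (differentiableAt a z).hasFDerivAt).fderiv]
  exact (g _).2

theorem dl_mem (W : Submodule ℂ (Form V)) {a : SmoothForms U} (h : ∀ z, ev z a ∈ W) (z : U) :
    ev z (dl a) ∈ forms10 V * W := by
  change ev z (diffOp covec10 a) ∈ _
  rw [diffOp_apply, map_sum]
  exact sum_mem fun i _ => by
    rw [map_mul]
    exact Submodule.mul_mem_mul (ι_covec10_mem _) (pd_mem W h _ z)

theorem db_mem (W : Submodule ℂ (Form V)) {a : SmoothForms U} (h : ∀ z, ev z a ∈ W) (z : U) :
    ev z (db a) ∈ forms01 V * W := by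
  change ev z (diffOp covec01 a) ∈ _
  rw [diffOp_apply, map_sum]
  exact sum_mem fun i _ => by
    rw [map_mul]
    exact Submodule.mul_mem_mul (ι_covec01_mem _) (pd_mem W h _ z)

theorem db_mem_formsKK {a : SmoothForms U} (h : ∀ z, ev z a ∈ forms10 V) (z : U) :
    ev z (db a) ∈ formsKK V := by
  refine (Submodule.mul_le (P := Subalgebra.toSubmodule (formsKK V))).2 ?_ (db_mem _ h z)
  exact fun x hx y hy => mul_mem_formsKK hx hy

/-- For forms of type `(k, k)`, `dω = 0` implies `∂ω = 0` and `∂̄ω = 0`. -/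
theorem dl_eq_zero_and_db_eq_zero {a : SmoothForms U} (h : ∀ z, ev z a ∈ formsKK V)
    (hd : dl a + db a = 0) : dl a = 0 ∧ db a = 0 := by
  have h0 : mapForm (scaleBidegree V) a = a := ext fun z => by
    rw [ev_mapForm, scaleBidegree_KK (h z)]
  -- The scaling fixes `a`, hence multiplies ∂a by 2 and ∂̄a by 1/2. Elements of different weights
  -- with sum zero both vanish.
  have key : ∀ (τ : Covec V →ₗ[ℂ] Covec V) (c : ℂ), (∀ α, scaleBidegree V
      (ExteriorAlgebra.ι ℂ (τ α)) = c • ExteriorAlgebra.ι ℂ (τ α)) →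
      mapForm (scaleBidegree V) (diffOp τ a) = c • diffOp τ a := by
    intro τ c hτ
    simp only [diffOp_apply, map_sum, map_mul, Finset.smul_sum, ← pd_mapForm, h0]
    refine Finset.sum_congr rfl fun i _ => ?_
    rw [← smul_mul_assoc]
    congr 1
    exact ext fun z => by rw [ev_mapForm, ev_const, hτ, map_smul, ev_const]
  have h1 : mapForm (scaleBidegree V) (dl a) = (2 : ℂ) • dl a :=
    key covec10 2 fun α => scaleBidegree_10 (ι_covec10_mem α)
  have h2 : mapForm (scaleBidegree V) (db a) = (1 / 2 : ℂ) • db a :=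
    key covec01 _ fun α => scaleBidegree_01 (ι_covec01_mem α)
  have h3 := congrArg (mapForm (scaleBidegree V)) hd
  rw [map_add, map_zero, h1, h2, eq_neg_of_add_eq_zero_right hd, smul_neg, ← sub_eq_add_neg,
    ← sub_smul] at h3
  have h4 : dl a = 0 := (smul_eq_zero.1 h3).resolve_left (by norm_num)
  rw [h4, zero_add] at hd
  exact ⟨h4, hd⟩

section Entries

variable {Hi H P : Matrix (Fin m) (Fin m) (SmoothForms U)}
  (hHi : ∀ z i j, ev z (Hi i j) ∈ (⊥ : Subalgebra ℂ (Form V)))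
  (hH : ∀ z i j, ev z (H i j) ∈ (⊥ : Subalgebra ℂ (Form V)))
  (hP : ∀ z i j, ev z (P i j) ∈ (⊥ : Subalgebra ℂ (Form V)))

theorem Represents.mem_bot {M : Matrix (Fin m) (Fin m) (SmoothForms U)}
    {K : V → Matrix (Fin m) (Fin m) ℂ} (h : Represents M K) (z : U) (i j : Fin m) :
    ev z (M i j) ∈ (⊥ : Subalgebra ℂ (Form V)) := by
  rw [h]
  exact Subalgebra.algebraMap_mem _ _

theorem dl_mem_forms10 {a : SmoothForms U} (h : ∀ z, ev z a ∈ (⊥ : Subalgebra ℂ (Form V)))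
    (z : U) : ev z (dl a) ∈ forms10 V := by
  have := dl_mem (Subalgebra.toSubmodule ⊥) h z
  rwa [Algebra.toSubmodule_bot, mul_one] at this

omit [FiniteDimensional ℂ V] in
theorem mul_mem_forms10 {x y : Form V} (hx : x ∈ (⊥ : Subalgebra ℂ (Form V)))
    (hy : y ∈ forms10 V) : x * y ∈ forms10 V := by
  obtain ⟨c, rfl⟩ := Algebra.mem_bot.1 hx
  rw [← Algebra.smul_def]
  exact Submodule.smul_mem _ _ hy

omit [FiniteDimensional ℂ V] in
theorem mul_mem_forms10' {x y : Form V} (hx : x ∈ forms10 V)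
    (hy : y ∈ (⊥ : Subalgebra ℂ (Form V))) : x * y ∈ forms10 V := by
  obtain ⟨c, rfl⟩ := Algebra.mem_bot.1 hy
  rw [← Algebra.commutes, ← Algebra.smul_def]
  exact Submodule.smul_mem _ _ hx

include hHi hH in
theorem conn_mem (z : U) (i j : Fin m) : ev z (conn Hi H i j) ∈ forms10 V := by
  rw [conn, Matrix.mul_apply, map_sum]
  exact sum_mem fun k _ => by
    rw [map_mul]
    exact mul_mem_forms10 (hHi z i k) (dl_mem_forms10 (fun z => hH z k j) z)

include hHi hH hP

theorem gam_mem (z : U) (i j : Fin m) : ev z (gam Hi H P i j) ∈ forms10 V := by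
  rw [gam, Matrix.sub_apply, Matrix.add_apply, map_sub, map_add, Matrix.mul_apply,
    Matrix.mul_apply, map_sum, map_sum]
  refine sub_mem (add_mem (dl_mem_forms10 (fun z => hP z i j) z) (sum_mem fun k _ => ?_))
    (sum_mem fun k _ => ?_)
  · rw [map_mul]
    exact mul_mem_forms10' (conn_mem hHi hH z i k) (hP z k j)
  · rw [map_mul]
    exact mul_mem_forms10 (hP z i k) (conn_mem hHi hH z k j)

theorem chernMatrix_mem (μ : ℂ) (z : U) (i j : Fin m) :
    ev z (chernMatrix Hi H P μ i j) ∈ formsKK V := by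
  rw [chernMatrix, Matrix.add_apply, map_add, Matrix.smul_apply, map_smul]
  refine add_mem ?_ ((formsKK V).smul_mem (db_mem_formsKK (fun z => ?_) z) _)
  · by_cases h : i = j <;> simp [Matrix.one_apply, h, one_mem, zero_mem]
  · rw [connμ, Matrix.sub_apply, Matrix.smul_apply, map_sub, map_smul]
    exact sub_mem (conn_mem hHi hH z i j)
      (Submodule.smul_mem _ _ (gam_mem hHi hH hP z i j))

/-- The entries of `P` have degree zero and those of the Chern matrix are sums of (k, k) forms; v is
a polynomial expression in them. -/
theorem vAbs_mem (z : U) : ev z (vAbs Hi H P) ∈ formsKK V := by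
  rw [vAbs, map_sum]
  refine sum_mem fun l _ => ?_
  rw [map_smul]
  refine (formsKK V).smul_mem ?_ _
  rw [polyCoeff]
  split_ifs with hl
  · rw [map_sum]
    refine sum_mem fun i _ => ?_
    rw [map_smul]
    refine (formsKK V).smul_mem ?_ _
    rw [traceFun, Matrix.trace, map_sum]
    refine sum_mem fun a _ => ?_
    rw [Matrix.diag_apply, Matrix.mul_apply, map_sum]
    refine sum_mem fun b _ => ?_
    rw [map_mul]
    refine mul_mem (bot_le (a := formsKK V) (hP z a b)) ?_
    have h1 := congrFun (congrFun (map_ladj (ev z) (chernMatrix Hi H P (1 - (i : ℂ)))) b) a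
    rw [Matrix.map_apply] at h1
    rw [h1]
    exact ladj_mem _ (fun c d => chernMatrix_mem hHi hH hP _ z c d) _ _
  · rw [map_zero]
    exact zero_mem _

omit hP in
theorem chernAbs_mem (z : U) : ev z (chernAbs Hi H) ∈ formsKK V := by
  rw [chernAbs, map_ldet]
  exact ldet_mem _ fun i j => chernMatrix_mem hHi hH (fun z i j => by simp [zero_mem]) 0 z i j

end Entries

end SmoothForms

/-! ## Forms on a complex manifold in coordinates -/

section Coordinates

variable {V : Type*} [NormedAddCommGroup V] [NormedSpace ℂ V]
  {X : Type*} [TopologicalSpace X] [ChartedSpace V X]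

/-- The domain of the change of coordinates from the chart at `x` to the chart at `p`. -/
def transitionSource (V : Type*) [NormedAddCommGroup V] [NormedSpace ℂ V]
    {X : Type*} [TopologicalSpace X] [ChartedSpace V X] (x p : X) : TopologicalSpace.Opens V :=
  ⟨((chartAt V x).symm.trans (chartAt V p)).source, OpenPartialHomeomorph.open_source _⟩

/-- The change of coordinates from the chart at `x` to the chart at `p`. -/
def transition (V : Type*) [NormedAddCommGroup V] [NormedSpace ℂ V]
    {X : Type*} [TopologicalSpace X] [ChartedSpace V X] (x p : X) : V → V :=
  chartAt V p ∘ (chartAt V x).symm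

/-- The domain of the coordinates at `x`. -/
def chartTarget (V : Type*) [NormedAddCommGroup V] [NormedSpace ℂ V]
    {X : Type*} [TopologicalSpace X] [ChartedSpace V X] (x : X) : TopologicalSpace.Opens V :=
  ⟨(chartAt V x).target, (chartAt V x).open_target⟩

theorem mem_transitionSource {x p : X} {z : V} : z ∈ transitionSource V x p ↔
    z ∈ (chartAt V x).target ∧ (chartAt V x).symm z ∈ (chartAt V p).source := by
  change z ∈ ((chartAt V x).symm.trans (chartAt V p)).source ↔ _
  simp

theorem mem_chartTarget_self (x : X) : chartAt V x x ∈ chartTarget V x :=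
  mem_chart_target V x

theorem transition_mem {x p : X} {z : V} (hz : z ∈ transitionSource V x p) :
    transition V x p z ∈ chartTarget V p :=
  (chartAt V p).map_source (mem_transitionSource.1 hz).2

theorem symm_transition {x p : X} {z : V} (hz : z ∈ transitionSource V x p) :
    (chartAt V p).symm (transition V x p z) = (chartAt V x).symm z :=
  (chartAt V p).left_inv (mem_transitionSource.1 hz).2

theorem mem_transitionSource_symm {x : X} {z : V} (hz : z ∈ chartTarget V x) :
    z ∈ transitionSource V x ((chartAt V x).symm z) :=
  mem_transitionSource.2 ⟨hz, mem_chart_source V _⟩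

variable [IsManifold 𝓘(ℂ, V) ω X]

theorem contDiffOn_transition (x p : X) :
    ContDiffOn ℂ ∞ (transition V x p) (transitionSource V x p) := by
  have h := contDiffOn_ext_coord_change (I := 𝓘(ℂ, V)) (n := ω) p x
  simp only [mfld_simps] at h
  refine ContDiffOn.of_le ?_ (n := ω) le_top
  change ContDiffOn ℂ ω _ ((chartAt V x).symm.trans (chartAt V p)).source
  simpa only [transition, mfld_simps] using h

theorem differentiableAt_transition {x p : X} {z : V} (hz : z ∈ transitionSource V x p) :
    DifferentiableAt ℝ (transition V x p) z :=
  ((((contDiffOn_transition x p).restrict_scalars ℝ).contDiffAt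
    ((transitionSource V x p).isOpen.mem_nhds hz)).differentiableAt (by simp))

theorem fderiv_transition_I {x p : X} {z : V} (hz : z ∈ transitionSource V x p) (v : V) :
    fderiv ℝ (transition V x p) z (Complex.I • v) =
      Complex.I • fderiv ℝ (transition V x p) z v :=
  SmoothForms.fderiv_I (contDiffOn_transition x p) ⟨z, hz⟩ v

/-- Transformation of the coordinate expression of a form under change of coordinates. -/
theorem coordForm_transition (w : X → Form V) {x p : X} {z : V}
    (hz : z ∈ transitionSource V x p) :
    coordForm w x z =
      pullForm (fderiv ℝ (transition V x p) z) (coordForm w p (transition V x p z)) := by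
  set y := (chartAt V x).symm z with hy
  have hsymm : (chartAt V p).symm (transition V x p z) = y := symm_transition hz
  have hz' : transition V x p z ∈ transitionSource V p y :=
    mem_transitionSource.2 ⟨transition_mem hz, by rw [hsymm]; exact mem_chart_source V y⟩
  rw [coordForm, coordForm, hsymm, ← hy, ← pullForm_comp]
  congr 2
  -- Both coordinate expressions are pullbacks of the value at `y`, which is written in the chart at
  -- `y`. What remains is the chain rule for the three charts at `x`, `p` and `y`.
  change fderiv ℝ (transition V x y) z = (fderiv ℝ (transition V p y) (transition V x p z)).comp _
  rw [← fderiv_comp z (differentiableAt_transition hz') (differentiableAt_transition hz)]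
  refine Filter.EventuallyEq.fderiv_eq ?_
  filter_upwards [(transitionSource V x p).isOpen.mem_nhds hz] with z' hz'
  rw [Function.comp_apply, transition, transition, Function.comp_apply, Function.comp_apply,
    symm_transition hz']

omit [IsManifold 𝓘(ℂ, V) ω X] in
theorem coordForm_self (w : X → Form V) (x : X) : coordForm w x (chartAt V x x) = w x := by
  have h1 : (chartAt V x).symm (chartAt V x x) = x :=
    (chartAt V x).left_inv (mem_chart_source V x)
  have h2 : fderiv ℝ (chartAt V x ∘ (chartAt V x).symm) (chartAt V x x) =
      ContinuousLinearMap.id ℝ V := by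
    rw [← fderiv_id (𝕜 := ℝ) (x := chartAt V x x)]
    refine Filter.EventuallyEq.fderiv_eq ?_
    filter_upwards [(chartAt V x).open_target.mem_nhds (mem_chart_target V x)] with z hz
    exact (chartAt V x).right_inv hz
  rw [coordForm, h1, h2, pullForm_id]

omit [IsManifold 𝓘(ℂ, V) ω X] in
theorem coordForm_symm (w : X → Form V) (x : X) {z : V} :
    coordForm w x z = pullForm (fderiv ℝ (transition V x ((chartAt V x).symm z)) z)
      (w ((chartAt V x).symm z)) := rfl

section Algebra

omit [IsManifold 𝓘(ℂ, V) ω X]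

variable (w w' : X → Form V) (x : X) (z : V)

theorem coordForm_add : coordForm (w + w') x z = coordForm w x z + coordForm w' x z :=
  map_add _ _ _

theorem coordForm_sub : coordForm (w - w') x z = coordForm w x z - coordForm w' x z :=
  map_sub _ _ _

theorem coordForm_mul : coordForm (w * w') x z = coordForm w x z * coordForm w' x z :=
  map_mul _ _ _

theorem coordForm_smul (c : ℂ) : coordForm (c • w) x z = c • coordForm w x z :=
  map_smul (pullForm _) c _

theorem coordForm_zero : coordForm (0 : X → Form V) x z = 0 := map_zero _

end Algebra

theorem coordForm_mem_formsKK {w : X → Form V} (hw : ∀ x, w x ∈ formsKK V) (x : X) {z : V}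
    (hz : z ∈ chartTarget V x) : coordForm w x z ∈ formsKK V := by
  rw [coordForm_symm]
  exact pullForm_mem_formsKK (fderiv_transition_I (mem_transitionSource_symm hz)) (hw _)

end Coordinates

section Manifold

variable {V : Type*} [NormedAddCommGroup V] [NormedSpace ℂ V] [FiniteDimensional ℂ V]
  {X : Type*} [TopologicalSpace X] [ChartedSpace V X] [IsManifold 𝓘(ℂ, V) ω X]

omit [IsManifold 𝓘(ℂ, V) ω X] in
theorem isSmoothForm_iff {w : X → Form V} : IsSmoothForm w ↔
    ∀ x, ContDiffOn ℝ ∞ (coordForm w x) (chartTarget V x) :=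
  forall_congr' fun _ => contDiffOn_form_iff.symm

/-- Smoothness may be checked near the center of each chart. -/
theorem isSmoothForm_of_local {w : X → Form V} (hw : ∀ x, ∃ W : TopologicalSpace.Opens V,
    chartAt V x x ∈ W ∧ ContDiffOn ℝ ∞ (coordForm w x) W) : IsSmoothForm w := by
  refine isSmoothForm_iff.2 fun x z hz => ?_
  -- Smoothness at `z` is checked in the chart centered at the corresponding point of X and
  -- transported back along the change of coordinates.
  obtain ⟨W, hzW, hW⟩ := hw ((chartAt V x).symm z)
  set p := (chartAt V x).symm z
  have hφ := (contDiffOn_transition (V := V) x p).restrict_scalars ℝ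
  have hopen : IsOpen ((transitionSource V x p : Set V) ∩ transition V x p ⁻¹' W) :=
    hφ.continuousOn.isOpen_inter_preimage (transitionSource V x p).isOpen W.isOpen
  have h2 : ContDiffOn ℝ ∞ (fderiv ℝ (transition V x p))
      ((transitionSource V x p : Set V) ∩ transition V x p ⁻¹' W) :=
    (hφ.fderiv_of_isOpen (transitionSource V x p).isOpen (by simp)).mono Set.inter_subset_left
  have h3 := contDiffOn_pullForm h2
    (hW.comp (hφ.mono Set.inter_subset_left) (fun y hy => hy.2))
  have h1 : ContDiffOn ℝ ∞ (coordForm w x)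
      ((transitionSource V x p : Set V) ∩ transition V x p ⁻¹' W) :=
    h3.congr fun y hy => coordForm_transition w hy.1
  exact (h1.contDiffAt (hopen.mem_nhds ⟨mem_transitionSource_symm hz, hzW⟩)).contDiffWithinAt

open SmoothForms

/-- The coordinate expression of a smooth form. -/
def chartForm {w : X → Form V} (hw : IsSmoothForm w) (x : X) : SmoothForms (chartTarget V x) :=
  mk (coordForm w x) (isSmoothForm_iff.1 hw x)

omit [IsManifold 𝓘(ℂ, V) ω X] in
theorem ev_chartForm {w : X → Form V} (hw : IsSmoothForm w) (x : X) (z : chartTarget V x) :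
    ev z (chartForm hw x) = coordForm w x z := rfl

theorem ev_pull_chartForm {w : X → Form V} (hw : IsSmoothForm w) (x p : X)
    (z : transitionSource V x p) :
    ev z (pull (transition V x p) ((contDiffOn_transition x p).restrict_scalars ℝ)
      (fun _ => transition_mem) (chartForm hw p)) = coordForm w x z := by
  rw [ev_pull, ev_chartForm, ← coordForm_transition w z.2]

theorem isDiffHom_transition (x p : X) : IsDiffHom (pull (transition V x p)
    ((contDiffOn_transition x p).restrict_scalars ℝ) (fun _ => transition_mem)) :=
  isDiffHom_pull (contDiffOn_transition x p) _

/-- `∂` in coordinates. -/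
theorem coordForm_del {w : X → Form V} (hw : IsSmoothForm w) (x : X) (z : chartTarget V x) :
    coordForm (del w) x z = ev z (dl (chartForm hw x)) := by
  set p := (chartAt V x).symm z with hp
  have hz : (z : V) ∈ transitionSource V x p := mem_transitionSource_symm z.2
  -- At the point `p` the form `del w` is computed in the chart at `p`. Pullback along the
  -- holomorphic change of charts commutes with ∂ and carries this value to the chart at `x`; the
  -- next theorem does the same for ∂̄.
  rw [ev_dl (ev_chartForm hw x), ← ev_dl (ev_pull_chartForm hw x p) ⟨z, hz⟩,
    ← (isDiffHom_transition x p).dl, ev_pull, ev_dl (ev_chartForm hw p)]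
  rfl

/-- `∂̄` in coordinates. -/
theorem coordForm_dbar {w : X → Form V} (hw : IsSmoothForm w) (x : X) (z : chartTarget V x) :
    coordForm (dbar w) x z = ev z (db (chartForm hw x)) := by
  set p := (chartAt V x).symm z with hp
  have hz : (z : V) ∈ transitionSource V x p := mem_transitionSource_symm z.2
  rw [ev_db (ev_chartForm hw x), ← ev_db (ev_pull_chartForm hw x p) ⟨z, hz⟩,
    ← (isDiffHom_transition x p).db, ev_pull, ev_db (ev_chartForm hw p)]
  rfl

omit [IsManifold 𝓘(ℂ, V) ω X] in
theorem isSmoothForm_of_ev {w : X → Form V} (h : ∀ x, ∃ a : SmoothForms (chartTarget V x),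
    ∀ z : chartTarget V x, coordForm w x z = ev z a) : IsSmoothForm w := isSmoothForm_iff.2 fun x => by
  obtain ⟨a, ha⟩ := h x
  exact (contDiffOn a).congr fun z hz => (ha ⟨z, hz⟩).trans (toFun_apply a ⟨z, hz⟩).symm

theorem IsSmoothForm.del {w : X → Form V} (hw : IsSmoothForm w) : IsSmoothForm (del w) :=
  isSmoothForm_of_ev fun x => ⟨_, coordForm_del hw x⟩

theorem IsSmoothForm.dbar {w : X → Form V} (hw : IsSmoothForm w) : IsSmoothForm (dbar w) :=
  isSmoothForm_of_ev fun x => ⟨_, coordForm_dbar hw x⟩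

section Algebra

omit [IsManifold 𝓘(ℂ, V) ω X]

variable {w w' : X → Form V} (hw : IsSmoothForm w) (hw' : IsSmoothForm w')

include hw in
theorem IsSmoothForm.smul (c : ℂ) : IsSmoothForm (c • w) :=
  isSmoothForm_of_ev fun x => ⟨c • chartForm hw x, fun z => by
    rw [coordForm_smul, map_smul, ev_chartForm]⟩

include hw hw'

theorem IsSmoothForm.add : IsSmoothForm (w + w') :=
  isSmoothForm_of_ev fun x => ⟨chartForm hw x + chartForm hw' x, fun z => by
    rw [coordForm_add, map_add, ev_chartForm, ev_chartForm]⟩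

theorem IsSmoothForm.sub : IsSmoothForm (w - w') :=
  isSmoothForm_of_ev fun x => ⟨chartForm hw x - chartForm hw' x, fun z => by
    rw [coordForm_sub, map_sub, ev_chartForm, ev_chartForm]⟩

theorem IsSmoothForm.mul : IsSmoothForm (w * w') :=
  isSmoothForm_of_ev fun x => ⟨chartForm hw x * chartForm hw' x, fun z => by
    rw [coordForm_mul, map_mul, ev_chartForm, ev_chartForm]⟩

end Algebra

omit [IsManifold 𝓘(ℂ, V) ω X] in
theorem isSmoothForm_zero : IsSmoothForm (0 : X → Form V) :=
  isSmoothForm_of_ev fun x => ⟨0, fun z => by rw [coordForm_zero, map_zero]⟩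

section ExteriorDerivative

variable {w : X → Form V} (hw : IsSmoothForm w)
include hw

theorem IsSmoothForm.dc : IsSmoothForm (dc w) := (hw.dbar.sub hw.del).smul aleph

omit [IsManifold 𝓘(ℂ, V) ω X] in
theorem extD_apply (x : X) : extD w x =
    ev ⟨_, mem_chartTarget_self x⟩ (dl (chartForm hw x) + db (chartForm hw x)) := by
  rw [ev_d (ev_chartForm hw x)]
  rfl

omit [IsManifold 𝓘(ℂ, V) ω X] in
theorem extD_eq : extD w = del w + dbar w := by
  ext1 x
  rw [extD_apply hw, map_add, ev_dl (ev_chartForm hw x), ev_db (ev_chartForm hw x)]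
  rfl

theorem chartForm_dc (x : X) : chartForm hw.dc x =
    aleph • (db (chartForm hw x) - dl (chartForm hw x)) := SmoothForms.ext fun z => by
  rw [ev_chartForm, dc, coordForm_smul, coordForm_sub, coordForm_del hw, coordForm_dbar hw,
    map_smul, map_sub]

theorem ddc_apply (x : X) : ddc w x =
    ev ⟨_, mem_chartTarget_self x⟩ ((2 * aleph) • dl (db (chartForm hw x))) := by
  rw [ddc, extD_apply hw.dc, chartForm_dc hw]
  congr 1
  rw [map_smul, map_smul, map_sub, map_sub, dl_dl, db_db, db_dl, mul_smul, ← smul_add,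
    smul_comm (2 : ℂ), two_smul]
  congr 1
  abel

/-- `-dd^c = 2ℵ ∂̄∂`. -/
theorem neg_ddc : -ddc w = dbar ((2 * aleph) • del w) := by
  ext1 x
  have h : ∀ z, ev z ((2 * aleph) • dl (chartForm hw x)) =
      coordForm ((2 * aleph) • del w) x z := fun z => by
    rw [map_smul, coordForm_smul, coordForm_del hw]
  rw [Pi.neg_apply, ddc_apply hw, ← map_neg, ← smul_neg, ← db_dl, ← map_smul, ev_db h]
  rfl

variable {w' : X → Form V} (hw' : IsSmoothForm w')
include hw'

theorem ddc_add : ddc (w + w') = ddc w + ddc w' := by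
  ext1 x
  have h : chartForm (hw.add hw') x = chartForm hw x + chartForm hw' x :=
    SmoothForms.ext fun z => by rw [map_add, ev_chartForm, ev_chartForm, ev_chartForm,
      coordForm_add]
  rw [Pi.add_apply, ddc_apply hw, ddc_apply hw', ddc_apply (hw.add hw'), h, map_add, map_add,
    smul_add, map_add]

theorem ddc_sub : ddc (w - w') = ddc w - ddc w' := by
  ext1 x
  have h : chartForm (hw.sub hw') x = chartForm hw x - chartForm hw' x :=
    SmoothForms.ext fun z => by rw [map_sub, ev_chartForm, ev_chartForm, ev_chartForm,
      coordForm_sub]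
  rw [Pi.sub_apply, ddc_apply hw, ddc_apply hw', ddc_apply (hw.sub hw'), h, map_sub, map_sub,
    smul_sub, map_sub]

end ExteriorDerivative

theorem ddc_zero : ddc (0 : X → Form V) = 0 := by
  have h := ddc_sub (X := X) (V := V) isSmoothForm_zero isSmoothForm_zero
  rwa [sub_self, sub_self] at h

theorem IsClosedKK.del_eq_zero {w : X → Form V} (hw : IsClosedKK w) (x : X) :
    dl (chartForm hw.1.1 x) = 0 ∧ db (chartForm hw.1.1 x) = 0 := by
  refine dl_eq_zero_and_db_eq_zero (fun z => coordForm_mem_formsKK hw.1.2 x z.2) ?_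
  refine SmoothForms.ext fun z => ?_
  rw [map_add, ← coordForm_del hw.1.1, ← coordForm_dbar hw.1.1, ← coordForm_add,
    ← extD_eq hw.1.1, hw.2, coordForm_zero, map_zero]

/-- A closed form of type (k, k) is even and is killed by ∂ and ∂̄ separately, so it acts as a
constant for dd^c = 2ℵ∂∂̄. -/
theorem ddc_mul {a u : X → Form V} (ha : IsClosedKK a) (hu : IsSmoothForm u) :
    ddc (a * u) = a * ddc u := by
  ext1 x
  have h : chartForm (ha.1.1.mul hu) x = chartForm ha.1.1 x * chartForm hu x :=
    SmoothForms.ext fun z => by rw [map_mul, ev_chartForm, ev_chartForm, ev_chartForm,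
      coordForm_mul]
  have he : parity (chartForm ha.1.1 x) = chartForm ha.1.1 x := SmoothForms.ext fun z =>
    parity_formsKK (coordForm_mem_formsKK ha.1.2 x z.2)
  obtain ⟨h1, h2⟩ := ha.del_eq_zero x
  rw [Pi.mul_apply, ddc_apply (ha.1.1.mul hu), ddc_apply hu, h, db_anti.mul, h2, zero_mul, zero_add,
    he, dl_anti.mul, h1, zero_mul, zero_add, he, ← mul_smul_comm, map_mul, ev_chartForm,
    coordForm_self]

/-! ### Bott–Chern classes and their product -/

section Classes

variable {a b c : X → Form V}

omit [IsManifold 𝓘(ℂ, V) ω X] in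
theorem IsSmoothKK.add (ha : IsSmoothKK a) (hb : IsSmoothKK b) : IsSmoothKK (a + b) :=
  ⟨ha.1.add hb.1, fun x => add_mem (ha.2 x) (hb.2 x)⟩

omit [IsManifold 𝓘(ℂ, V) ω X] in
theorem IsSmoothKK.sub (ha : IsSmoothKK a) (hb : IsSmoothKK b) : IsSmoothKK (a - b) :=
  ⟨ha.1.sub hb.1, fun x => sub_mem (ha.2 x) (hb.2 x)⟩

omit [IsManifold 𝓘(ℂ, V) ω X] in
theorem IsSmoothKK.mul (ha : IsSmoothKK a) (hb : IsSmoothKK b) : IsSmoothKK (a * b) :=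
  ⟨ha.1.mul hb.1, fun x => (formsKK V).mul_mem (ha.2 x) (hb.2 x)⟩

omit [IsManifold 𝓘(ℂ, V) ω X] in
theorem isSmoothKK_zero : IsSmoothKK (0 : X → Form V) :=
  ⟨isSmoothForm_zero, fun _ => zero_mem _⟩

theorem self_mem_bcClass (ha : IsClosedKK a) : a ∈ bcClass a :=
  ⟨ha, 0, isSmoothKK_zero, by rw [sub_self, ddc_zero]⟩

omit [IsManifold 𝓘(ℂ, V) ω X] in
theorem IsSmoothKK.mul_comm (ha : IsSmoothKK a) (b : X → Form V) : a * b = b * a :=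
  funext fun x => mul_comm_of_even _ _ (parity_formsKK (ha.2 x))

/-- If `c` and `a b` differ by some `dd^c v`, then the class of `c` is the product of the
classes of `a` and `b`. -/
theorem bcClass_eq_bcMul (ha : IsClosedKK a) (hb : IsClosedKK b) {v : X → Form V}
    (hv : IsSmoothKK v) (h : -ddc v = c - a * b) :
    bcClass c = bcMul (bcClass a) (bcClass b) := by
  ext w
  constructor
  · rintro ⟨hw, u, hu, h1⟩
    refine ⟨a, self_mem_bcClass ha, b, self_mem_bcClass hb, hw, u - v, hu.sub hv, ?_⟩
    rw [ddc_sub hu.1 hv.1, ← h1, sub_eq_add_neg _ (ddc v), h]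
    abel
  · rintro ⟨a', ⟨ha', u₁, hu₁, h₁⟩, b', ⟨hb', u₂, hu₂, h₂⟩, hw, u, hu, h₃⟩
    have hm₂ : IsSmoothKK (a' * u₂) := ha'.1.mul hu₂
    have hm₁ : IsSmoothKK (b * u₁) := hb.1.mul hu₁
    -- The witness comes from w − c = (w − a'b') + a'(b' − b) + b(a' − a) + (ab − c), each bracket
    -- being a dd^c and the factors `a'` and `b` passing through it.
    refine ⟨hw, u + a' * u₂ + b * u₁ + v, ((hu.add hm₂).add hm₁).add hv, ?_⟩
    rw [ddc_add ((hu.add hm₂).add hm₁).1 hv.1, ddc_add (hu.add hm₂).1 hm₁.1,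
      ddc_add hu.1 hm₂.1, ddc_mul ha' hu₂.1, ddc_mul hb hu₁.1, ← h₁, ← h₂, ← h₃,
      ← neg_neg (ddc v), h, mul_sub, mul_sub, hb.1.mul_comm, hb.1.mul_comm]
    abel

end Classes

end Manifold

/-! ## Bundle maps and Hermitian metrics in frames -/

theorem sesq_ext {k l : ℕ} {A B : Matrix (Fin k) (Fin l) ℂ}
    (h : ∀ v w, star w ⬝ᵥ A *ᵥ v = star w ⬝ᵥ B *ᵥ v) : A = B := by
  ext i j
  simpa [← Pi.single_star, Matrix.mulVec_single_one] using h (Pi.single j 1) (Pi.single i 1)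

section Frames

variable {V : Type*} [NormedAddCommGroup V] [NormedSpace ℂ V]
  {X : Type*} [TopologicalSpace X] [ChartedSpace V X]
  {r m q : ℕ}
  {S : X → Type*} [∀ x, AddCommGroup (S x)] [∀ x, Module ℂ (S x)]
  [∀ x, TopologicalSpace (S x)] [TopologicalSpace (TotalSpace (Fin r → ℂ) S)]
  [FiberBundle (Fin r → ℂ) S] [VectorBundle ℂ (Fin r → ℂ) S]
  {E : X → Type*} [∀ x, AddCommGroup (E x)] [∀ x, Module ℂ (E x)]
  [∀ x, TopologicalSpace (E x)] [TopologicalSpace (TotalSpace (Fin m → ℂ) E)]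
  [FiberBundle (Fin m → ℂ) E] [VectorBundle ℂ (Fin m → ℂ) E]
  {Q : X → Type*} [∀ x, AddCommGroup (Q x)] [∀ x, Module ℂ (Q x)]
  [∀ x, TopologicalSpace (Q x)] [TopologicalSpace (TotalSpace (Fin q → ℂ) Q)]
  [FiberBundle (Fin q → ℂ) Q] [VectorBundle ℂ (Fin q → ℂ) Q]
  {e : Trivialization (Fin r → ℂ) (π (Fin r → ℂ) S)} [MemTrivializationAtlas e]
  {e' : Trivialization (Fin m → ℂ) (π (Fin m → ℂ) E)} [MemTrivializationAtlas e']
  {e'' : Trivialization (Fin q → ℂ) (π (Fin q → ℂ) Q)} [MemTrivializationAtlas e'']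

variable (e e') in
omit [∀ x, Module ℂ (S x)] [VectorBundle ℂ (Fin r → ℂ) S] [∀ x, Module ℂ (E x)]
  [VectorBundle ℂ (Fin m → ℂ) E] [MemTrivializationAtlas e] [MemTrivializationAtlas e'] 
  [∀ x, TopologicalSpace (S x)] [∀ x, TopologicalSpace (E x)] in
/-- The matrix of a bundle map in two frames. -/
def coeffMatrix (j : ∀ x, S x → E x) (y : X) : Matrix (Fin m) (Fin r) ℂ :=
  fun i k => (e' ⟨y, j y (e.symm y (Pi.single k 1))⟩).2 i

variable (e) in
/-- The Gram matrix of a frame. -/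
def gramAt (h : HermitianMetric V r S) (y : X) : Matrix (Fin r) (Fin r) ℂ :=
  fun k j => h.form y (e.symm y (Pi.single j 1)) (e.symm y (Pi.single k 1))

theorem symm_eq_sum {y : X} (hy : y ∈ e.baseSet) (v : Fin r → ℂ) :
    e.symm y v = ∑ k, v k • e.symm y (Pi.single k 1) := by
  rw [← e.coe_symmₗ (R := ℂ) hy]
  conv_lhs => rw [pi_eq_sum_univ' v, map_sum]
  exact Finset.sum_congr rfl fun k _ => by rw [map_smul]

omit [∀ x, Module ℂ (S x)] [∀ x, TopologicalSpace (S x)] [FiberBundle (Fin r → ℂ) S]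
  [VectorBundle ℂ (Fin r → ℂ) S] [MemTrivializationAtlas e] in
theorem symm_injective {y : X} (hy : y ∈ e.baseSet) : Function.Injective (e.symm y) :=
  fun v w h => by
    have h1 := congrArg (fun u => (e ⟨y, u⟩).2) h
    simpa only [e.apply_mk_symm hy] using h1

theorem apply_symm {j : ∀ x, S x →ₗ[ℂ] E x} {y : X} (hy : y ∈ e.baseSet) (hy' : y ∈ e'.baseSet)
    (v : Fin r → ℂ) :
    j y (e.symm y v) = e'.symm y (coeffMatrix e e' (fun x => j x) y *ᵥ v) := by
  have h1 : ∀ k, j y (e.symm y (Pi.single k 1)) =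
      e'.symm y (fun i => coeffMatrix e e' (fun x => j x) y i k) := fun k =>
    (e'.symm_apply_apply_mk hy' _).symm
  have h2 : coeffMatrix e e' (fun x => j x) y *ᵥ v =
      ∑ k, v k • fun i => coeffMatrix e e' (fun x => j x) y i k := by
    ext i
    simp [Matrix.mulVec, dotProduct, mul_comm]
  rw [symm_eq_sum hy, map_sum, h2, ← e'.coe_symmₗ (R := ℂ) hy', map_sum]
  refine Finset.sum_congr rfl fun k _ => ?_
  rw [map_smul, map_smul, h1, e'.coe_symmₗ (R := ℂ) hy']

theorem coeffMatrix_eq {j : ∀ x, S x →ₗ[ℂ] E x} {y : X} (hy : y ∈ e.baseSet)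
    (hy' : y ∈ e'.baseSet) {M : Matrix (Fin m) (Fin r) ℂ}
    (h : ∀ v, j y (e.symm y v) = e'.symm y (M *ᵥ v)) :
    coeffMatrix e e' (fun x => j x) y = M := by
  have h1 : ∀ v, coeffMatrix e e' (fun x => j x) y *ᵥ v = M *ᵥ v := fun v =>
    symm_injective hy' ((apply_symm hy hy' v).symm.trans (h v))
  exact Matrix.ext_of_mulVec_single fun i => h1 _

theorem coeffMatrix_mul {j : ∀ x, S x →ₗ[ℂ] E x} {g : ∀ x, E x →ₗ[ℂ] Q x} {y : X}
    (hy : y ∈ e.baseSet) (hy' : y ∈ e'.baseSet) (hy'' : y ∈ e''.baseSet) :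
    coeffMatrix e' e'' (fun x => g x) y * coeffMatrix e e' (fun x => j x) y =
      coeffMatrix e e'' (fun x => g x ∘ₗ j x) y := by
  refine (coeffMatrix_eq (j := fun x => g x ∘ₗ j x) hy hy'' fun v => ?_).symm
  rw [LinearMap.comp_apply, apply_symm hy hy', apply_symm hy' hy'', Matrix.mulVec_mulVec]

theorem coeffMatrix_id {y : X} (hy : y ∈ e.baseSet) :
    coeffMatrix e e (fun _ => LinearMap.id (R := ℂ)) y = 1 :=
  coeffMatrix_eq (j := fun _ => LinearMap.id) hy hy fun v => by simp

theorem form_symm (h : HermitianMetric V r S) {y : X} (hy : y ∈ e.baseSet) (v w : Fin r → ℂ) :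
    h.form y (e.symm y v) (e.symm y w) = star w ⬝ᵥ gramAt e h y *ᵥ v := by
  rw [symm_eq_sum hy v, symm_eq_sum hy w]
  simp only [map_sum, map_smul, LinearMap.sum_apply, LinearMap.smul_apply, map_smulₛₗ,
    smul_eq_mul, dotProduct, Matrix.mulVec, Finset.mul_sum, gramAt, Pi.star_apply]
  refine Finset.sum_congr rfl fun k _ => Finset.sum_congr rfl fun l _ => ?_
  rw [starRingEnd_apply]
  ring

omit [VectorBundle ℂ (Fin r → ℂ) S] [MemTrivializationAtlas e] in
theorem gramAt_conjTranspose (h : HermitianMetric V r S) (y : X) :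
    (gramAt e h y)ᴴ = gramAt e h y := by
  ext i j
  rw [Matrix.conjTranspose_apply, gramAt, gramAt, h.symm y (e.symm y (Pi.single j 1))]
  rfl

theorem isUnit_det_gramAt (h : HermitianMetric V r S) {y : X} (hy : y ∈ e.baseSet) :
    IsUnit (gramAt e h y).det := by
  rw [isUnit_iff_ne_zero]
  intro h0
  obtain ⟨v, hv, h1⟩ := Matrix.exists_mulVec_eq_zero_iff.2 h0
  have h2 : e.symm y v ≠ 0 := fun h3 => hv (symm_injective hy (by
    rw [h3, ← e.coe_symmₗ (R := ℂ) hy, map_zero]))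
  have h3 := h.pos y _ h2
  rw [form_symm h hy, h1, dotProduct_zero] at h3
  simp at h3

theorem gramAt_eq (h : HermitianMetric V r S) {y : X} (hy : y ∈ e.baseSet)
    {M : Matrix (Fin r) (Fin r) ℂ}
    (hM : ∀ v w, h.form y (e.symm y v) (e.symm y w) = star w ⬝ᵥ M *ᵥ v) : gramAt e h y = M :=
  sesq_ext fun v w => (form_symm h hy v w).symm.trans (hM v w)

theorem sesq_conjTranspose_mul {k l : ℕ} (J : Matrix (Fin k) (Fin l) ℂ)
    (H : Matrix (Fin k) (Fin k) ℂ) (v w : Fin l → ℂ) :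
    star (J *ᵥ w) ⬝ᵥ H *ᵥ (J *ᵥ v) = star w ⬝ᵥ (Jᴴ * H * J) *ᵥ v := by
  rw [Matrix.star_mulVec, ← Matrix.dotProduct_mulVec, Matrix.mulVec_mulVec, Matrix.mulVec_mulVec,
    Matrix.mul_assoc]

/-- The Gram matrix of an induced metric. -/
theorem gramAt_induced {hS : HermitianMetric V r S} {hE : HermitianMetric V m E}
    {j : ∀ x, S x →ₗ[ℂ] E x} {y : X} (h : ∀ s t : S y, hS.form y s t = hE.form y (j y s) (j y t))
    (hy : y ∈ e.baseSet) (hy' : y ∈ e'.baseSet) :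
    gramAt e hS y = (coeffMatrix e e' (fun x => j x) y)ᴴ * gramAt e' hE y *
      coeffMatrix e e' (fun x => j x) y :=
  gramAt_eq hS hy fun v w => by
    rw [h, apply_symm hy hy', apply_symm hy hy', form_symm hE hy', sesq_conjTranspose_mul]

end Frames

/-! ### Matrix identities for the quotient metric -/

section Quotient

variable {r m q : ℕ} {HE : Matrix (Fin m) (Fin m) ℂ} {HS : Matrix (Fin r) (Fin r) ℂ}
  {HQ : Matrix (Fin q) (Fin q) ℂ} {J : Matrix (Fin m) (Fin r) ℂ} {G : Matrix (Fin q) (Fin m) ℂ}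

theorem orthogonal_proj (huS : IsUnit HS.det) (hind : HS = Jᴴ * HE * J) :
    Jᴴ * HE * (1 - J * (HS⁻¹ * Jᴴ * HE)) = 0 := by
  have : Jᴴ * HE * (J * (HS⁻¹ * Jᴴ * HE)) = (Jᴴ * HE * J) * HS⁻¹ * (Jᴴ * HE) := by
    simp only [Matrix.mul_assoc]
  rw [Matrix.mul_sub, this, ← hind, Matrix.mul_nonsing_inv _ huS, Matrix.mul_one, Matrix.one_mul,
    sub_self]

/-- By `hquot` the metric of Q is that of E on the orthogonal complement of S. By orthogonality the
right side of `hquot` equals H_E(1 − P), and cancelling H_E yields g^*g = 1 − jj^*. -/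
theorem split_of_quotient (hE : HEᴴ = HE) (hS : HSᴴ = HS) (huE : IsUnit HE.det)
    (huS : IsUnit HS.det) (hind : HS = Jᴴ * HE * J)
    (hquot : Gᴴ * HQ * G = (1 - J * (HS⁻¹ * Jᴴ * HE))ᴴ * HE * (1 - J * (HS⁻¹ * Jᴴ * HE))) :
    J * (HS⁻¹ * Jᴴ * HE) + (HE⁻¹ * Gᴴ * HQ) * G = 1 := by
  have h1 : (J * (HS⁻¹ * Jᴴ * HE))ᴴ * HE = HE * J * HS⁻¹ * (Jᴴ * HE) := by
    simp only [Matrix.conjTranspose_mul, Matrix.conjTranspose_nonsing_inv, hE, hS,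
      Matrix.conjTranspose_conjTranspose, Matrix.mul_assoc]
  have h2 : (1 - J * (HS⁻¹ * Jᴴ * HE))ᴴ * HE * (1 - J * (HS⁻¹ * Jᴴ * HE)) =
      HE * (1 - J * (HS⁻¹ * Jᴴ * HE)) := by
    rw [Matrix.conjTranspose_sub, Matrix.conjTranspose_one, Matrix.sub_mul _ _ HE, h1,
      Matrix.sub_mul, Matrix.mul_assoc _ (Jᴴ * HE), orthogonal_proj huS hind, Matrix.mul_zero,
      sub_zero, Matrix.one_mul]
  have h3 : HE⁻¹ * Gᴴ * HQ * G = 1 - J * (HS⁻¹ * Jᴴ * HE) := by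
    have : HE⁻¹ * Gᴴ * HQ * G = HE⁻¹ * (Gᴴ * HQ * G) := by simp only [Matrix.mul_assoc]
    rw [this, hquot, h2, ← Matrix.mul_assoc, Matrix.nonsing_inv_mul _ huE, Matrix.one_mul]
  rw [h3, add_sub_cancel]

/-- Placing the splitting between `G` and its right inverse `L` kills the term with `J` and leaves G
H_E⁻¹ Gᴴ H_Q = 1. -/
theorem inv_of_split {L : Matrix (Fin m) (Fin q) ℂ} (hGL : G * L = 1)
    (hGJ : G * J = 0) (hsplit : J * (HS⁻¹ * Jᴴ * HE) + (HE⁻¹ * Gᴴ * HQ) * G = 1) :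
    HQ⁻¹ = G * HE⁻¹ * Gᴴ := by
  refine Matrix.inv_eq_left_inv ?_
  have h1 := congrArg (fun M => G * M * L) hsplit
  simp only [Matrix.mul_add, ← Matrix.mul_assoc, hGJ, Matrix.zero_mul, zero_add, Matrix.mul_one,
    hGL] at h1
  rwa [Matrix.mul_assoc _ G, hGL, Matrix.mul_one] at h1

end Quotient

/-! ## Independence of the frame and of the coordinates -/

namespace SmoothForms

variable {V : Type*} [NormedAddCommGroup V] [NormedSpace ℂ V] [FiniteDimensional ℂ V]
  {U : TopologicalSpace.Opens V} {m k l : ℕ}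

theorem scalarMatrix_db {K : V → Matrix (Fin k) (Fin l) ℂ}
    (hK : ∀ i j, ContDiffOn ℂ ∞ (fun z => K z i j) U) :
    (scalarMatrix K fun i j => (hK i j).restrict_scalars ℝ).map db = 0 := by
  ext i j
  exact db_scalar (hK i j)

theorem scalarMatrix_conjTranspose_dl {K : V → Matrix (Fin k) (Fin l) ℂ}
    (hK : ∀ i j, ContDiffOn ℂ ∞ (fun z => K z i j) U) :
    (scalarMatrix (fun z => (K z)ᴴ)
      fun i j => contDiffOn_star ((hK j i).restrict_scalars ℝ)).map dl = 0 := by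
  ext i j
  exact dl_scalar_star (hK j i)

theorem isGauge_scalarMatrix {g : V → Matrix (Fin m) (Fin m) ℂ}
    (hg : ∀ i j, ContDiffOn ℂ ∞ (fun z => g z i j) U) (hu : ∀ z ∈ U, IsUnit (g z).det)
    (hg' : ∀ z ∈ U, IsUnit ((g z)ᴴ).det) :
    IsGauge
      (scalarMatrix (fun z => (g z)⁻¹)
        (contDiffOn_inv (fun i j => (hg i j).restrict_scalars ℝ) hu))
      (scalarMatrix g fun i j => (hg i j).restrict_scalars ℝ)
      (scalarMatrix (fun z => ((g z)ᴴ)⁻¹)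
        (contDiffOn_inv (fun i j => contDiffOn_star ((hg j i).restrict_scalars ℝ)) hg'))
      (scalarMatrix (fun z => (g z)ᴴ)
        fun i j => contDiffOn_star ((hg j i).restrict_scalars ℝ)) where
  metric := (represents_scalarMatrix _ _).isMetric (represents_scalarMatrix _ _) hu
  metric' := (represents_scalarMatrix _ _).isMetric (represents_scalarMatrix _ _) hg'
  db_eq := scalarMatrix_db hg
  dl_eq' := scalarMatrix_conjTranspose_dl hg

variable {W : TopologicalSpace.Opens V} {φ : V → V} (hφ : ContDiffOn ℂ ∞ φ W)
  (hm : ∀ z ∈ W, φ z ∈ U) {H H' P P' g : V → Matrix (Fin m) (Fin m) ℂ}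
  (hg : ∀ i j, ContDiffOn ℂ ∞ (fun z => g z i j) W) (hu : ∀ z ∈ W, IsUnit (g z).det)
  (hH : ∀ i j, ContDiffOn ℝ ∞ (fun z => H z i j) U) (huH : ∀ z ∈ U, IsUnit (H z).det)
  (hH' : ∀ z ∈ W, H' z = (g z)ᴴ * H (φ z) * g z)

include hφ hm hg hu hH huH hH'

/-- Realizes in the algebra of forms on `W` both the metric pulled back by `φ` and the change of
frame. The three lemmas after it then combine invariance under gauge with functoriality under
pullback. -/
theorem exists_gauge : ∃ (gi gm g'i g' Hi Hm : Matrix (Fin m) (Fin m) (SmoothForms W))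
    (Hi₀ Hm₀ : Matrix (Fin m) (Fin m) (SmoothForms U)),
    Hi = Hi₀.map (pull φ (hφ.restrict_scalars ℝ) hm) ∧
    Hm = Hm₀.map (pull φ (hφ.restrict_scalars ℝ) hm) ∧
    IsGauge gi gm g'i g' ∧ IsMetric Hi Hm ∧
    Represents Hi₀ (fun z => (H z)⁻¹) ∧ Represents Hm₀ H ∧
    Represents gi (fun z => (g z)⁻¹) ∧ Represents gm g ∧
    Represents (gi * Hi * g'i) (fun z => (H' z)⁻¹) ∧ Represents (g' * Hm * gm) H' := by
  have hu' : ∀ z ∈ W, IsUnit ((g z)ᴴ).det := fun z hz => by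
    rw [Matrix.det_conjTranspose]
    exact (hu z hz).star
  have h0 := represents_scalarMatrix H hH
  have h1 := represents_scalarMatrix (fun z => (H z)⁻¹) (contDiffOn_inv hH huH)
  have h2 := represents_pull (hφ.restrict_scalars ℝ) hm h0
  have h3 := represents_pull (hφ.restrict_scalars ℝ) hm h1
  refine ⟨_, _, _, _, _, _, _, _, rfl, rfl, isGauge_scalarMatrix hg hu hu',
    h2.isMetric h3 (fun z hz => huH _ (hm z hz)), h1, h0, represents_scalarMatrix _ _,
    represents_scalarMatrix _ _, ?_, ?_⟩
  · refine (((represents_scalarMatrix _ _).mul h3).mul (represents_scalarMatrix _ _)).congr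
      fun z hz => ?_
    rw [hH' z hz, Matrix.mul_inv_rev, Matrix.mul_inv_rev, Matrix.mul_assoc]
  · exact (((represents_scalarMatrix _ _).mul h2).mul (represents_scalarMatrix _ _)).congr
      fun z hz => (hH' z hz).symm

omit [NormedSpace ℂ V] [FiniteDimensional ℂ V] hφ hg hH in
theorem isUnit_det_gauge : ∀ z ∈ W, IsUnit (H' z).det := fun z hz => by
  rw [hH' z hz, Matrix.det_mul, Matrix.det_mul, Matrix.det_conjTranspose]
  exact ((hu z hz).star.mul (huH _ (hm z hz))).mul (hu z hz)

/-- The Chern form is independent of the frame and of the coordinates. -/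
theorem chernFormL_pull (z : W) :
    chernFormL H' z = pullForm (fderiv ℝ φ z) (chernFormL H (φ z)) := by
  obtain ⟨gi, gm, g'i, g', Hi, Hm, Hi₀, Hm₀, hHi, hHm, hG, hM, h1, h2, h3, h4, h5, h6⟩ :=
    exists_gauge hφ hm hg hu hH huH hH'
  rw [← ev_chernAbs h6 h5 (isUnit_det_gauge hm hu huH hH'), hG.chernAbs_eq hM, hHi, hHm,
    ← (isDiffHom_pull hφ hm).chernAbs, ev_pull, ev_chernAbs h2 h1 huH]

variable (hP : ∀ i j, ContDiffOn ℝ ∞ (fun z => P z i j) U)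
  (hP' : ∀ z ∈ W, P' z = (g z)⁻¹ * P (φ z) * g z)
include hP hP'

theorem vFormL_pull (z : W) :
    vFormL H' P' z = pullForm (fderiv ℝ φ z) (vFormL H P (φ z)) := by
  obtain ⟨gi, gm, g'i, g', Hi, Hm, Hi₀, Hm₀, hHi, hHm, hG, hM, h1, h2, h3, h4, h5, h6⟩ :=
    exists_gauge hφ hm hg hu hH huH hH'
  have hp := represents_scalarMatrix P hP
  have hp₁ := represents_pull (hφ.restrict_scalars ℝ) hm hp
  have hp₂ := ((h3.mul hp₁).mul h4).congr fun z hz => (hP' z hz).symm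
  rw [← ev_vAbs h6 h5 hp₂ (isUnit_det_gauge hm hu huH hH'), hG.vAbs_eq hM hp₁.even, hHi,
    hHm, ← (isDiffHom_pull hφ hm).vAbs, ev_pull, ev_vAbs h2 h1 hp huH]

theorem bFormL_pull (z : W) :
    bFormL H' P' z = pullForm (fderiv ℝ φ z) (bFormL H P (φ z)) := by
  obtain ⟨gi, gm, g'i, g', Hi, Hm, Hi₀, Hm₀, hHi, hHm, hG, hM, h1, h2, h3, h4, h5, h6⟩ :=
    exists_gauge hφ hm hg hu hH huH hH'
  have hp := represents_scalarMatrix P hP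
  have hp₁ := represents_pull (hφ.restrict_scalars ℝ) hm hp
  have hp₂ := ((h3.mul hp₁).mul h4).congr fun z hz => (hP' z hz).symm
  rw [← ev_bAbs h6 h5 hp₂ (isUnit_det_gauge hm hu huH hH'), hG.bAbs_eq hM hp₁.even, hHi,
    hHm, ← (isDiffHom_pull hφ hm).bAbs, ev_pull, ev_bAbs h2 h1 hp huH]

end SmoothForms

/-! ## Smoothness of matrices in frames -/

section Frames

variable {V : Type*} [NormedAddCommGroup V] [NormedSpace ℂ V]
  {X : Type*} [TopologicalSpace X] [ChartedSpace V X] [IsManifold 𝓘(ℂ, V) ω X]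
  {r m : ℕ}
  {S : X → Type*} [∀ x, AddCommGroup (S x)] [∀ x, Module ℂ (S x)]
  [∀ x, TopologicalSpace (S x)] [TopologicalSpace (TotalSpace (Fin r → ℂ) S)]
  [FiberBundle (Fin r → ℂ) S] [VectorBundle ℂ (Fin r → ℂ) S]
  [ContMDiffVectorBundle ω (Fin r → ℂ) S 𝓘(ℂ, V)]
  {E : X → Type*} [∀ x, AddCommGroup (E x)] [∀ x, Module ℂ (E x)]
  [∀ x, TopologicalSpace (E x)] [TopologicalSpace (TotalSpace (Fin m → ℂ) E)]
  [FiberBundle (Fin m → ℂ) E] [VectorBundle ℂ (Fin m → ℂ) E]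
  [ContMDiffVectorBundle ω (Fin m → ℂ) E 𝓘(ℂ, V)]

omit [IsManifold 𝓘(ℂ, V) ω X] in
theorem contMDiffOn_coeffMatrix (e : Trivialization (Fin r → ℂ) (π (Fin r → ℂ) S))
    [MemTrivializationAtlas e] (e' : Trivialization (Fin m → ℂ) (π (Fin m → ℂ) E))
    [MemTrivializationAtlas e'] {j : ∀ x, S x →ₗ[ℂ] E x} (hj : IsHolomorphicHom V r m j)
    (v : Fin r → ℂ) : ContMDiffOn 𝓘(ℂ, V) 𝓘(ℂ, Fin m → ℂ) ω
      (fun y => (e' ⟨y, j y (e.symm y v)⟩).2) (e.baseSet ∩ e'.baseSet) := by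
  have h1 : ContMDiffOn 𝓘(ℂ, V) (𝓘(ℂ, V).prod 𝓘(ℂ, Fin r → ℂ)) ω
      (fun y => (⟨y, e.symm y v⟩ : TotalSpace (Fin r → ℂ) S)) (e.baseSet ∩ e'.baseSet) :=
    ((e.contMDiffOn_symm (IB := 𝓘(ℂ, V)) (n := ω)).comp (s := e.baseSet ∩ e'.baseSet)
      (f := fun y => (y, v)) (contMDiffOn_id.prodMk contMDiffOn_const)
      (fun y hy => e.mem_target.2 hy.1)).congr fun y hy => (e.mk_symm hy.1 v)
  have h2 := hj.comp_contMDiffOn h1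
  have h3 := (e'.contMDiffOn (IB := 𝓘(ℂ, V)) (n := ω)).comp h2
    (fun y hy => e'.mem_source.2 hy.2)
  exact contMDiff_snd.comp_contMDiffOn h3

theorem contDiffOn_coeffMatrix (e : Trivialization (Fin r → ℂ) (π (Fin r → ℂ) S))
    [MemTrivializationAtlas e] (e' : Trivialization (Fin m → ℂ) (π (Fin m → ℂ) E))
    [MemTrivializationAtlas e'] {j : ∀ x, S x →ₗ[ℂ] E x} (hj : IsHolomorphicHom V r m j)
    (x : X) {W : Set V} (hW : W ⊆ (chartAt V x).target)
    (hW' : ∀ z ∈ W, (chartAt V x).symm z ∈ e.baseSet ∩ e'.baseSet) (i k) :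
    ContDiffOn ℂ ∞ (fun z => coeffMatrix e e' (fun x => j x) ((chartAt V x).symm z) i k) W := by
  have h1 := (contMDiffOn_coeffMatrix e e' hj (Pi.single k 1)).comp
    ((contMDiffOn_chart_symm (I := 𝓘(ℂ, V)) (n := ω) (x := x)).mono hW) hW'
  exact (contDiffOn_pi.1 (contMDiffOn_iff_contDiffOn.1 h1) i).of_le le_top

theorem isManifold_real : IsManifold 𝓘(ℝ, V) ∞ X :=
  isManifold_of_contDiffOn _ _ _ fun e e' he he' => by
    have h := ((mem_groupoid_of_pregroupoid).1
      (StructureGroupoid.compatible (contDiffGroupoid ω 𝓘(ℂ, V)) he he')).1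
    change ContDiffOn ℂ ω _ _ at h
    have h' := (h.of_le (m := ∞) le_top).restrict_scalars ℝ
    simpa using h'

omit [VectorBundle ℂ (Fin r → ℂ) S]
  [ContMDiffVectorBundle ω (Fin r → ℂ) S 𝓘(ℂ, V)] in
theorem contDiffOn_gram (h : HermitianMetric V r S) (x : X) {W : Set V}
    (hW : W ⊆ (chartAt V x).target)
    (hW' : ∀ z ∈ W, (chartAt V x).symm z ∈ (trivializationAt (Fin r → ℂ) S x).baseSet) (i j) :
    ContDiffOn ℝ ∞ (fun z => gram h x z i j) W := by
  have : IsManifold 𝓘(ℝ, V) ∞ X := isManifold_real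
  have h1 := (h.smooth x (Pi.single j 1) (Pi.single i 1)).comp
    ((contMDiffOn_chart_symm (I := 𝓘(ℝ, V)) (n := ∞) (x := x)).mono hW) hW'
  exact contMDiffOn_iff_contDiffOn.1 h1

omit [IsManifold 𝓘(ℂ, V) ω X] [VectorBundle ℂ (Fin r → ℂ) S]
  [ContMDiffVectorBundle ω (Fin r → ℂ) S 𝓘(ℂ, V)] in
theorem gram_eq_gramAt (h : HermitianMetric V r S) (x : X) (z : V) :
    gram h x z = gramAt (trivializationAt (Fin r → ℂ) S x) h ((chartAt V x).symm z) := rfl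

omit [NormedSpace ℂ V] [IsManifold 𝓘(ℂ, V) ω X] [VectorBundle ℂ (Fin r → ℂ) S]
  [ContMDiffVectorBundle ω (Fin r → ℂ) S 𝓘(ℂ, V)] [VectorBundle ℂ (Fin m → ℂ) E]
  [ContMDiffVectorBundle ω (Fin m → ℂ) E 𝓘(ℂ, V)] in
theorem homMatrix_eq_coeffMatrix (j : ∀ x, S x →ₗ[ℂ] E x) (x : X) (z : V) :
    homMatrix r m j x z = coeffMatrix (trivializationAt (Fin r → ℂ) S x)
      (trivializationAt (Fin m → ℂ) E x) (fun x => j x) ((chartAt V x).symm z) := rfl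

omit [IsManifold 𝓘(ℂ, V) ω X] [VectorBundle ℂ (Fin m → ℂ) E]
  [ContMDiffVectorBundle ω (Fin m → ℂ) E 𝓘(ℂ, V)] in
theorem isHolomorphicHom_id : IsHolomorphicHom V m m (fun x => LinearMap.id (R := ℂ) (M := E x)) :=
  contMDiff_id

end Frames

/-! ## The forms of a short exact sequence in coordinates -/

/-- As an endomorphism of E, jj^* does not depend on the frame of S, and a change of the frame of E
conjugates it. -/
theorem proj_change {m r : ℕ} {HE HE' gE : Matrix (Fin m) (Fin m) ℂ}
    {HS HS' gS : Matrix (Fin r) (Fin r) ℂ} {J J' : Matrix (Fin m) (Fin r) ℂ}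
    (huE : IsUnit gE.det) (huS : IsUnit gS.det) (hJ : gE * J' = J * gS)
    (hE : HE' = gEᴴ * HE * gE) (hS : HS' = gSᴴ * HS * gS) :
    J' * (HS'⁻¹ * J'ᴴ * HE') = gE⁻¹ * (J * (HS⁻¹ * Jᴴ * HE)) * gE := by
  have huS' : IsUnit (gSᴴ).det := by
    rw [Matrix.det_conjTranspose]
    exact huS.star
  have h1 : J' = gE⁻¹ * (J * gS) := by
    rw [← hJ, ← Matrix.mul_assoc, Matrix.nonsing_inv_mul _ huE, Matrix.one_mul]
  have h2 : J'ᴴ * gEᴴ = gSᴴ * Jᴴ := by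
    rw [← Matrix.conjTranspose_mul, hJ, Matrix.conjTranspose_mul]
  calc J' * (HS'⁻¹ * J'ᴴ * HE')
      = J' * HS'⁻¹ * (J'ᴴ * gEᴴ) * HE * gE := by rw [hE]; simp only [Matrix.mul_assoc]
    _ = gE⁻¹ * J * (gS * gS⁻¹) * HS⁻¹ * (gSᴴ⁻¹ * gSᴴ) * Jᴴ * HE * gE := by
        rw [h2, hS, Matrix.mul_inv_rev, Matrix.mul_inv_rev]
        conv_lhs => rw [h1]
        simp only [Matrix.mul_assoc]
    _ = gE⁻¹ * (J * (HS⁻¹ * Jᴴ * HE)) * gE := by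
        rw [Matrix.mul_nonsing_inv _ huS, Matrix.nonsing_inv_mul _ huS']
        simp only [Matrix.mul_assoc, Matrix.one_mul]

theorem contDiffOn_matrix_mul {V : Type*} [NormedAddCommGroup V] [NormedSpace ℝ V] {U : Set V}
    {k l n : ℕ} {A : V → Matrix (Fin k) (Fin l) ℂ} {B : V → Matrix (Fin l) (Fin n) ℂ}
    (hA : ∀ i j, ContDiffOn ℝ ∞ (fun z => A z i j) U)
    (hB : ∀ i j, ContDiffOn ℝ ∞ (fun z => B z i j) U) (i j) :
    ContDiffOn ℝ ∞ (fun z => (A z * B z) i j) U := by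
  simp only [Matrix.mul_apply]
  exact ContDiffOn.sum fun a _ => (hA i a).mul (hB a j)

namespace SmoothForms

variable {V : Type*} [NormedAddCommGroup V] [NormedSpace ℂ V] [FiniteDimensional ℂ V]
  {U : TopologicalSpace.Opens V} {m r q : ℕ}

theorem exists_exactData {HE : V → Matrix (Fin m) (Fin m) ℂ} {HS : V → Matrix (Fin r) (Fin r) ℂ}
    {HQ : V → Matrix (Fin q) (Fin q) ℂ} {J : V → Matrix (Fin m) (Fin r) ℂ}
    {G : V → Matrix (Fin q) (Fin m) ℂ}
    (hHE : ∀ i j, ContDiffOn ℝ ∞ (fun z => HE z i j) U)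
    (hHS : ∀ i j, ContDiffOn ℝ ∞ (fun z => HS z i j) U)
    (hHQ : ∀ i j, ContDiffOn ℝ ∞ (fun z => HQ z i j) U)
    (hJ : ∀ i j, ContDiffOn ℂ ∞ (fun z => J z i j) U)
    (hG : ∀ i j, ContDiffOn ℂ ∞ (fun z => G z i j) U)
    (huE : ∀ z ∈ U, IsUnit (HE z).det) (huS : ∀ z ∈ U, IsUnit (HS z).det)
    (huQ : ∀ z ∈ U, IsUnit (HQ z).det)
    (hind : ∀ z ∈ U, HS z = (J z)ᴴ * HE z * J z) (hGJ : ∀ z ∈ U, G z * J z = 0)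
    (hQi : ∀ z ∈ U, (HQ z)⁻¹ = G z * (HE z)⁻¹ * (G z)ᴴ)
    (hsplit : ∀ z ∈ U, J z * ((HS z)⁻¹ * (J z)ᴴ * HE z) +
      ((HE z)⁻¹ * (G z)ᴴ * HQ z) * G z = 1) :
    ∃ (Hi Hm : Matrix (Fin m) (Fin m) (SmoothForms U))
      (HSi HSm : Matrix (Fin r) (Fin r) (SmoothForms U))
      (HQi HQm : Matrix (Fin q) (Fin q) (SmoothForms U))
      (Jm : Matrix (Fin m) (Fin r) (SmoothForms U)) (J' : Matrix (Fin r) (Fin m) (SmoothForms U))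
      (Gm : Matrix (Fin q) (Fin m) (SmoothForms U)) (G' : Matrix (Fin m) (Fin q) (SmoothForms U)),
      IsExactData Hi Hm HSi HSm HQi HQm Jm J' Gm G' ∧
      Represents Hi (fun z => (HE z)⁻¹) ∧ Represents Hm HE ∧
      Represents HSi (fun z => (HS z)⁻¹) ∧ Represents HSm HS ∧
      Represents HQi (fun z => (HQ z)⁻¹) ∧ Represents HQm HQ ∧
      Represents Jm J ∧ Represents J' (fun z => (J z)ᴴ) := by
  have r1 := represents_scalarMatrix _ (contDiffOn_inv hHE huE)
  have r2 := represents_scalarMatrix HE hHE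
  have r3 := represents_scalarMatrix _ (contDiffOn_inv hHS huS)
  have r4 := represents_scalarMatrix HS hHS
  have r5 := represents_scalarMatrix _ (contDiffOn_inv hHQ huQ)
  have r6 := represents_scalarMatrix HQ hHQ
  have r7 := represents_scalarMatrix J fun i j => (hJ i j).restrict_scalars ℝ
  have r8 := represents_scalarMatrix (fun z => (J z)ᴴ)
    fun i j => contDiffOn_star ((hJ j i).restrict_scalars ℝ)
  have r9 := represents_scalarMatrix G fun i j => (hG i j).restrict_scalars ℝ
  have r10 := represents_scalarMatrix (fun z => (G z)ᴴ)
    fun i j => contDiffOn_star ((hG j i).restrict_scalars ℝ)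
  refine ⟨_, _, _, _, _, _, _, _, scalarMatrix G fun i j => (hG i j).restrict_scalars ℝ,
    scalarMatrix (fun z => (G z)ᴴ) fun i j => contDiffOn_star ((hG j i).restrict_scalars ℝ), ?_, r1, r2, r3, r4, r5, r6, r7, r8⟩
  exact
    { metric := r2.isMetric r1 huE
      metricS := r4.isMetric r3 huS
      metricQ := r6.isMetric r5 huQ
      evenJ := r7.even
      evenJ' := r8.even
      evenG := r9.even
      evenG' := r10.even
      dbJ := scalarMatrix_db hJ
      dlJ' := scalarMatrix_conjTranspose_dl hJ
      dbG := scalarMatrix_db hG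
      dlG' := scalarMatrix_conjTranspose_dl hG
      HS_eq := r4.eq ((r8.mul r2).mul r7) hind
      HQi_eq := r5.eq ((r9.mul r1).mul r10) hQi
      GJ := (r9.mul r7).eq .zero hGJ
      J'G' := (r8.mul r10).eq .zero fun z hz => by
        rw [← Matrix.conjTranspose_mul, hGJ z hz, Matrix.conjTranspose_zero]
      split := ((r7.mul ((r3.mul r8).mul r2)).add (((r1.mul r10).mul r6).mul r9)).eq .one hsplit }

end SmoothForms

section Bundles

variable {V : Type*} [NormedAddCommGroup V] [NormedSpace ℂ V]
  {X : Type*} [TopologicalSpace X] [ChartedSpace V X]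

variable (V) in
/-- The points of the domain of the coordinates at `x` which lie in an open set of `X`. -/
def chartPreimage (x : X) (O : TopologicalSpace.Opens X) : TopologicalSpace.Opens V :=
  ⟨(chartAt V x).target ∩ (chartAt V x).symm ⁻¹' O,
    (chartAt V x).symm.isOpen_inter_preimage O.isOpen⟩

omit [NormedSpace ℂ V] in
theorem self_mem_chartPreimage {x : X} {O : TopologicalSpace.Opens X} (h : x ∈ O) :
    chartAt V x x ∈ chartPreimage V x O :=
  ⟨mem_chart_target V x, by
    rw [Set.mem_preimage, (chartAt V x).left_inv (mem_chart_source V x)]; exact h⟩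

/-- The domain of the preferred frame at `x`. -/
def baseOpens (m : ℕ) (E : X → Type*) [∀ x, TopologicalSpace (E x)]
    [TopologicalSpace (TotalSpace (Fin m → ℂ) E)] [FiberBundle (Fin m → ℂ) E] (x : X) :
    TopologicalSpace.Opens X :=
  ⟨(trivializationAt (Fin m → ℂ) E x).baseSet, (trivializationAt (Fin m → ℂ) E x).open_baseSet⟩

variable (V) in
/-- The domain of the coordinates at `x`, in `X`. -/
def sourceOpens (x : X) : TopologicalSpace.Opens X :=
  ⟨(chartAt V x).source, (chartAt V x).open_source⟩

variable [IsManifold 𝓘(ℂ, V) ω X]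
  {r m q : ℕ}
  {S : X → Type*} [∀ x, AddCommGroup (S x)] [∀ x, Module ℂ (S x)]
  [∀ x, TopologicalSpace (S x)] [TopologicalSpace (TotalSpace (Fin r → ℂ) S)]
  [FiberBundle (Fin r → ℂ) S] [VectorBundle ℂ (Fin r → ℂ) S]
  [ContMDiffVectorBundle ω (Fin r → ℂ) S 𝓘(ℂ, V)]
  {E : X → Type*} [∀ x, AddCommGroup (E x)] [∀ x, Module ℂ (E x)]
  [∀ x, TopologicalSpace (E x)] [TopologicalSpace (TotalSpace (Fin m → ℂ) E)]
  [FiberBundle (Fin m → ℂ) E] [VectorBundle ℂ (Fin m → ℂ) E]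
  [ContMDiffVectorBundle ω (Fin m → ℂ) E 𝓘(ℂ, V)]

variable (m E) in
/-- The change of frame from the preferred frame at `x` to the preferred frame at `p`, in the
coordinates at `x`. -/
def frameChange (x p : X) (z : V) : Matrix (Fin m) (Fin m) ℂ :=
  coeffMatrix (trivializationAt (Fin m → ℂ) E x) (trivializationAt (Fin m → ℂ) E p)
    (fun x => (LinearMap.id : E x →ₗ[ℂ] E x)) ((chartAt V x).symm z)

theorem contDiffOn_frameChange (x p : X) {W : TopologicalSpace.Opens V}
    (hW : W ≤ chartPreimage V x (baseOpens m E x ⊓ baseOpens m E p)) (i j) :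
    ContDiffOn ℂ ∞ (fun z => frameChange m E x p z i j) (W : Set V) :=
  contDiffOn_coeffMatrix _ _ isHolomorphicHom_id x (fun _ hz => (hW hz).1)
    (fun _ hz => (hW hz).2) i j

omit [NormedSpace ℂ V] [IsManifold 𝓘(ℂ, V) ω X]
  [ContMDiffVectorBundle ω (Fin m → ℂ) E 𝓘(ℂ, V)] in
theorem isUnit_frameChange {x p : X} {z : V}
    (hz : z ∈ chartPreimage V x (baseOpens m E x ⊓ baseOpens m E p)) :
    IsUnit (frameChange m E x p z).det := by
  have h := coeffMatrix_mul (e := trivializationAt (Fin m → ℂ) E x)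
    (e' := trivializationAt (Fin m → ℂ) E p) (e'' := trivializationAt (Fin m → ℂ) E x)
    (j := fun x => (LinearMap.id : E x →ₗ[ℂ] E x)) (g := fun x => (LinearMap.id : E x →ₗ[ℂ] E x))
    hz.2.1 hz.2.2 hz.2.1
  have h' := h.trans (coeffMatrix_id hz.2.1)
  have h2 := congrArg Matrix.det h'
  rw [Matrix.det_mul, Matrix.det_one] at h2
  exact IsUnit.of_mul_eq_one_right _ h2

omit [IsManifold 𝓘(ℂ, V) ω X] [ContMDiffVectorBundle ω (Fin m → ℂ) E 𝓘(ℂ, V)] in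
theorem gram_transition (h : HermitianMetric V m E) {x p : X} {z : V}
    (hz : z ∈ chartPreimage V x (baseOpens m E x ⊓ baseOpens m E p ⊓ sourceOpens V p)) :
    gram h x z = (frameChange m E x p z)ᴴ * gram h p (transition V x p z) *
      frameChange m E x p z := by
  rw [gram_eq_gramAt, gram_eq_gramAt, symm_transition (mem_transitionSource.2 ⟨hz.1, hz.2.2⟩)]
  exact gramAt_induced (j := fun x => (LinearMap.id : E x →ₗ[ℂ] E x)) (fun _ _ => rfl)
    hz.2.1.1 hz.2.1.2

omit [IsManifold 𝓘(ℂ, V) ω X] [ContMDiffVectorBundle ω (Fin m → ℂ) E 𝓘(ℂ, V)]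
  [ContMDiffVectorBundle ω (Fin r → ℂ) S 𝓘(ℂ, V)] in
theorem homMatrix_transition (j : ∀ x, S x →ₗ[ℂ] E x) {x p : X} {z : V}
    (hzS : z ∈ chartPreimage V x (baseOpens r S x ⊓ baseOpens r S p ⊓ sourceOpens V p))
    (hz : z ∈ chartPreimage V x (baseOpens m E x ⊓ baseOpens m E p ⊓ sourceOpens V p)) :
    frameChange m E x p z * homMatrix r m j x z =
      homMatrix r m j p (transition V x p z) * frameChange r S x p z := by
  rw [homMatrix_eq_coeffMatrix, homMatrix_eq_coeffMatrix,
    symm_transition (mem_transitionSource.2 ⟨hz.1, hz.2.2⟩)]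
  exact (coeffMatrix_mul (g := fun x => (LinearMap.id : E x →ₗ[ℂ] E x)) hzS.2.1.1 hz.2.1.1
    hz.2.1.2).trans (coeffMatrix_mul (j := fun x => (LinearMap.id : S x →ₗ[ℂ] S x))
    hzS.2.1.1 hzS.2.1.2 hz.2.1.2).symm

omit [IsManifold 𝓘(ℂ, V) ω X] [ContMDiffVectorBundle ω (Fin m → ℂ) E 𝓘(ℂ, V)] in
theorem isUnit_gram (h : HermitianMetric V m E) {x : X} {z : V}
    (hz : z ∈ chartPreimage V x (baseOpens m E x)) : IsUnit (gram h x z).det :=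
  isUnit_det_gramAt h hz.2

theorem contDiffOn_jjStar (hS : HermitianMetric V r S) (hE : HermitianMetric V m E)
    {j : ∀ x, S x →ₗ[ℂ] E x} (hj : IsHolomorphicHom V r m j) (x : X) (a b) :
    ContDiffOn ℝ ∞ (fun z => jjStar hS hE j x z a b)
      (chartPreimage V x (baseOpens r S x ⊓ baseOpens m E x)) := by
  have hJ : ∀ a b, ContDiffOn ℝ ∞ (fun z => homMatrix r m j x z a b)
      (chartPreimage V x (baseOpens r S x ⊓ baseOpens m E x)) := fun a b =>
    (contDiffOn_coeffMatrix _ _ hj x (fun _ hz => hz.1) (fun _ hz => hz.2) a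
      b).restrict_scalars ℝ
  exact contDiffOn_matrix_mul hJ (contDiffOn_matrix_mul (contDiffOn_matrix_mul
    (SmoothForms.contDiffOn_inv
      (contDiffOn_gram hS x (fun _ hz => hz.1) (fun _ hz => hz.2.1))
      (fun z hz => isUnit_gram hS ⟨hz.1, hz.2.1⟩))
    (fun a b => SmoothForms.contDiffOn_star (hJ b a)))
    (contDiffOn_gram hE x (fun _ hz => hz.1) (fun _ hz => hz.2.2))) a b

variable [FiniteDimensional ℂ V]

/-- The Chern form in coordinates. -/
theorem coordForm_chernForm (h : HermitianMetric V m E) {x : X} {z : V}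
    (hz : z ∈ chartPreimage V x (baseOpens m E x)) :
    coordForm (chernForm h) x z = chernFormL (gram h x) z := by
  set p := (chartAt V x).symm z with hp
  -- The value of the form at `p` is defined by the frame and chart at `p`. On `O` the frames at `x`
  -- and `p` and the chart at `p` are all available, so `SmoothForms.chernFormL_pull` can compare
  -- the two expressions.
  set O := baseOpens m E x ⊓ baseOpens m E p ⊓ sourceOpens V p with hO
  have hzW : z ∈ chartPreimage V x O :=
    ⟨hz.1, ⟨hz.2, mem_baseSet_trivializationAt _ _ p⟩, mem_chart_source V p⟩
  have hW : ∀ y ∈ chartPreimage V x O, y ∈ transitionSource V x p := fun y hy =>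
    mem_transitionSource.2 ⟨hy.1, hy.2.2⟩
  exact (SmoothForms.chernFormL_pull (U := chartPreimage V p (baseOpens m E p))
    ((contDiffOn_transition x p).mono hW)
    (fun y hy => ⟨transition_mem (hW y hy), by
      rw [Set.mem_preimage, symm_transition (hW y hy)]; exact hy.2.1.2⟩)
    (contDiffOn_frameChange x p (fun y hy => ⟨hy.1, hy.2.1⟩))
    (fun y hy => isUnit_frameChange ⟨hy.1, hy.2.1⟩)
    (contDiffOn_gram h p (fun _ hy => hy.1) (fun _ hy => hy.2))
    (fun y hy => isUnit_gram h hy) (fun y hy => gram_transition h hy) ⟨z, hzW⟩).symm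

section SubBundle

variable (hS : HermitianMetric V r S) (hE : HermitianMetric V m E)
    {j : ∀ x, S x →ₗ[ℂ] E x} (hj : IsHolomorphicHom V r m j) {x : X} {z : V}
    (hz : z ∈ chartPreimage V x (baseOpens r S x ⊓ baseOpens m E x))
include hj hz

/-- The forms `v` and `b` in coordinates. -/
theorem coordForm_vForm_bForm :
    coordForm (vForm hS hE j) x z = vFormL (gram hE x) (jjStar hS hE j x) z ∧
    coordForm (bForm hS hE j) x z = bFormL (gram hE x) (jjStar hS hE j x) z := by
  set p := (chartAt V x).symm z with hp
  set O := (baseOpens r S x ⊓ baseOpens m E x) ⊓ (baseOpens r S p ⊓ baseOpens m E p) ⊓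
    sourceOpens V p with hO
  have hzW : z ∈ chartPreimage V x O :=
    ⟨hz.1, ⟨hz.2, mem_baseSet_trivializationAt _ _ p, mem_baseSet_trivializationAt _ _ p⟩,
      mem_chart_source V p⟩
  have hW : ∀ y ∈ chartPreimage V x O, y ∈ transitionSource V x p := fun y hy =>
    mem_transitionSource.2 ⟨hy.1, hy.2.2⟩
  have h1 := (contDiffOn_transition (V := V) x p).mono hW
  have h2 : ∀ y ∈ chartPreimage V x O, transition V x p y ∈
      chartPreimage V p (baseOpens r S p ⊓ baseOpens m E p) := fun y hy =>
    ⟨transition_mem (hW y hy), by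
      rw [Set.mem_preimage, symm_transition (hW y hy)]; exact hy.2.1.2⟩
  have h3 := contDiffOn_frameChange (m := m) (E := E) x p (W := chartPreimage V x O)
    (fun y hy => ⟨hy.1, hy.2.1.1.2, hy.2.1.2.2⟩)
  have h4 : ∀ y ∈ chartPreimage V x O, IsUnit (frameChange m E x p y).det := fun y hy =>
    isUnit_frameChange ⟨hy.1, hy.2.1.1.2, hy.2.1.2.2⟩
  have h5 := contDiffOn_gram hE p
    (W := chartPreimage V p (baseOpens r S p ⊓ baseOpens m E p)) (fun _ hy => hy.1)
    (fun _ hy => hy.2.2)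
  have h6 : ∀ y ∈ chartPreimage V p (baseOpens r S p ⊓ baseOpens m E p),
      IsUnit (gram hE p y).det := fun y hy => isUnit_gram hE ⟨hy.1, hy.2.2⟩
  have h7 : ∀ y ∈ chartPreimage V x O, _ := fun y hy =>
    gram_transition hE (p := p) (x := x) (z := y) ⟨hy.1, ⟨hy.2.1.1.2, hy.2.1.2.2⟩, hy.2.2⟩
  have h8 : ∀ y ∈ chartPreimage V x O, jjStar hS hE j x y = (frameChange m E x p y)⁻¹ *
      jjStar hS hE j p (transition V x p y) * frameChange m E x p y := fun y hy =>
    proj_change (h4 y hy) (isUnit_frameChange ⟨hy.1, hy.2.1.1.1, hy.2.1.2.1⟩)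
      (homMatrix_transition j ⟨hy.1, ⟨hy.2.1.1.1, hy.2.1.2.1⟩, hy.2.2⟩
        ⟨hy.1, ⟨hy.2.1.1.2, hy.2.1.2.2⟩, hy.2.2⟩) (h7 y hy)
      (gram_transition hS ⟨hy.1, ⟨hy.2.1.1.1, hy.2.1.2.1⟩, hy.2.2⟩)
  exact ⟨(SmoothForms.vFormL_pull h1 h2 h3 h4 h5 h6 h7 (contDiffOn_jjStar hS hE hj p) h8
    ⟨z, hzW⟩).symm, (SmoothForms.bFormL_pull h1 h2 h3 h4 h5 h6 h7 (contDiffOn_jjStar hS hE hj p) h8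
    ⟨z, hzW⟩).symm⟩

end SubBundle

end Bundles

/-! ## The double transgression of a short exact sequence -/

section ChernForm

variable {V : Type*} [NormedAddCommGroup V] [NormedSpace ℂ V] [FiniteDimensional ℂ V]
  {X : Type*} [TopologicalSpace X] [ChartedSpace V X] [IsManifold 𝓘(ℂ, V) ω X] {m : ℕ}
  {E : X → Type*} [∀ x, AddCommGroup (E x)] [∀ x, Module ℂ (E x)]
  [∀ x, TopologicalSpace (E x)] [TopologicalSpace (TotalSpace (Fin m → ℂ) E)]
  [FiberBundle (Fin m → ℂ) E] [VectorBundle ℂ (Fin m → ℂ) E]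
  [ContMDiffVectorBundle ω (Fin m → ℂ) E 𝓘(ℂ, V)]

open SmoothForms

omit [FiniteDimensional ℂ V] [IsManifold 𝓘(ℂ, V) ω X] [∀ x, AddCommGroup (E x)]
  [∀ x, Module ℂ (E x)] [VectorBundle ℂ (Fin m → ℂ) E]
  [ContMDiffVectorBundle ω (Fin m → ℂ) E 𝓘(ℂ, V)] in
theorem mem_baseOpens_self (x : X) : x ∈ baseOpens m E x :=
  mem_baseSet_trivializationAt _ _ x

/-- The Chern form is a smooth closed form of type `(k, k)`. -/
theorem isClosedKK_chernForm (h : HermitianMetric V m E) : IsClosedKK (chernForm h) := by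
  have key : ∀ x, ∃ a : SmoothForms (chartPreimage V x (baseOpens m E x)),
      (∀ z, ev z a = coordForm (chernForm h) x z) ∧ (∀ z, ev z a ∈ formsKK V) ∧
        dl a = 0 ∧ db a = 0 := fun x => by
    have hs := contDiffOn_gram h x (W := chartPreimage V x (baseOpens m E x)) (fun _ hz => hz.1)
      (fun _ hz => hz.2)
    have hu : ∀ z ∈ chartPreimage V x (baseOpens m E x), IsUnit (gram h x z).det :=
      fun z hz => isUnit_gram h hz
    have r1 := represents_scalarMatrix _ hs
    have r2 := represents_scalarMatrix _ (contDiffOn_inv hs hu)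
    exact ⟨_, fun z => (ev_chernAbs r1 r2 hu z).trans (coordForm_chernForm h z.2).symm,
      chernAbs_mem r2.mem_bot r1.mem_bot, dl_chernAbs (r1.isMetric r2 hu),
      db_chernAbs (r1.isMetric r2 hu)⟩
  refine ⟨⟨isSmoothForm_of_local fun x => ?_, fun x => ?_⟩, ?_⟩
  · obtain ⟨a, ha, -⟩ := key x
    exact ⟨_, self_mem_chartPreimage (mem_baseOpens_self x), (contDiffOn a).congr fun z hz =>
      ((toFun_apply a ⟨z, hz⟩).trans (ha ⟨z, hz⟩)).symm⟩
  · obtain ⟨a, ha, hk, -⟩ := key x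
    rw [← coordForm_self (chernForm h) x,
      ← ha ⟨_, self_mem_chartPreimage (mem_baseOpens_self x)⟩]
    exact hk _
  · ext1 x
    obtain ⟨a, ha, -, hl, hb⟩ := key x
    have h1 := ev_d ha ⟨_, self_mem_chartPreimage (mem_baseOpens_self x)⟩
    rw [hl, hb, add_zero, map_zero] at h1
    exact h1.symm

end ChernForm

section ExactSequence

open SmoothForms

variable {V : Type*} [NormedAddCommGroup V] [NormedSpace ℂ V] [FiniteDimensional ℂ V]
    {X : Type*} [TopologicalSpace X] [ChartedSpace V X] [IsManifold 𝓘(ℂ, V) ω X]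
    {r m q : ℕ}
    {S : X → Type*} [∀ x, AddCommGroup (S x)] [∀ x, Module ℂ (S x)]
    [∀ x, TopologicalSpace (S x)] [TopologicalSpace (TotalSpace (Fin r → ℂ) S)]
    [FiberBundle (Fin r → ℂ) S] [VectorBundle ℂ (Fin r → ℂ) S]
    [ContMDiffVectorBundle ω (Fin r → ℂ) S 𝓘(ℂ, V)]
    {E : X → Type*} [∀ x, AddCommGroup (E x)] [∀ x, Module ℂ (E x)]
    [∀ x, TopologicalSpace (E x)] [TopologicalSpace (TotalSpace (Fin m → ℂ) E)]
    [FiberBundle (Fin m → ℂ) E] [VectorBundle ℂ (Fin m → ℂ) E]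
    [ContMDiffVectorBundle ω (Fin m → ℂ) E 𝓘(ℂ, V)]
    {Q : X → Type*} [∀ x, AddCommGroup (Q x)] [∀ x, Module ℂ (Q x)]
    [∀ x, TopologicalSpace (Q x)] [TopologicalSpace (TotalSpace (Fin q → ℂ) Q)]
    [FiberBundle (Fin q → ℂ) Q] [VectorBundle ℂ (Fin q → ℂ) Q]
    [ContMDiffVectorBundle ω (Fin q → ℂ) Q 𝓘(ℂ, V)]
    {hS : HermitianMetric V r S} {hE : HermitianMetric V m E}
    {hQ : HermitianMetric V q Q}
    {j : ∀ x, S x →ₗ[ℂ] E x} {g : ∀ x, E x →ₗ[ℂ] Q x}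

section Pointwise

omit [FiniteDimensional ℂ V] [IsManifold 𝓘(ℂ, V) ω X]
  [ContMDiffVectorBundle ω (Fin r → ℂ) S 𝓘(ℂ, V)]
  [ContMDiffVectorBundle ω (Fin m → ℂ) E 𝓘(ℂ, V)]
  [ContMDiffVectorBundle ω (Fin q → ℂ) Q 𝓘(ℂ, V)]

variable {e : Trivialization (Fin r → ℂ) (π (Fin r → ℂ) S)} [MemTrivializationAtlas e]
  {e' : Trivialization (Fin m → ℂ) (π (Fin m → ℂ) E)} [MemTrivializationAtlas e']
  {e'' : Trivialization (Fin q → ℂ) (π (Fin q → ℂ) Q)} [MemTrivializationAtlas e'']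
  {y : X} (hy : y ∈ e.baseSet) (hy' : y ∈ e'.baseSet) (hy'' : y ∈ e''.baseSet)
include hy hy' hy''

omit [NormedAddCommGroup V] [NormedSpace ℂ V] [ChartedSpace V X] in
theorem coeffMatrix_mul_eq_zero (hexact : Function.Exact (j y) (g y)) :
    coeffMatrix e' e'' (fun x => g x) y * coeffMatrix e e' (fun x => j x) y = 0 := by
  refine (coeffMatrix_mul hy hy' hy'').trans
    (coeffMatrix_eq (j := fun x => g x ∘ₗ j x) hy hy'' fun v => ?_)
  rw [LinearMap.comp_apply, hexact.apply_apply_eq_zero, Matrix.zero_mulVec,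
    ← e''.coe_symmₗ (R := ℂ) hy'', map_zero]

omit [NormedAddCommGroup V] [NormedSpace ℂ V] [ChartedSpace V X] hy in
theorem exists_rightInverse_coeffMatrix (hg : Function.Surjective (g y)) :
    ∃ L : Matrix (Fin m) (Fin q) ℂ, coeffMatrix e' e'' (fun x => g x) y * L = 1 := by
  rw [← Matrix.mulVec_surjective_iff_exists_right_inverse]
  intro v
  obtain ⟨u, hu⟩ := hg (e''.symm y v)
  refine ⟨(e' ⟨y, u⟩).2, symm_injective hy'' ?_⟩
  rw [← apply_symm hy' hy'', e'.symm_apply_apply_mk hy', hu]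

/-- Exactness gives G v = G(1 − P)v, and (1 − P)v is orthogonal to S. Hence `hQ_induced` evaluates
the metric of Q on G v and G w as that of E on (1 − P)v and (1 − P)w. -/
theorem quotient_metric (hS_induced : ∀ s t : S y, hS.form y s t = hE.form y (j y s) (j y t))
    (hQ_induced : ∀ u w : E y, (∀ s : S y, hE.form y u (j y s) = 0) →
      (∀ s : S y, hE.form y w (j y s) = 0) → hQ.form y (g y u) (g y w) = hE.form y u w)
    (hexact : Function.Exact (j y) (g y)) {P : Matrix (Fin m) (Fin m) ℂ}
    (hP : P = coeffMatrix e e' (fun x => j x) y *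
      ((gramAt e hS y)⁻¹ * (coeffMatrix e e' (fun x => j x) y)ᴴ * gramAt e' hE y)) :
    (coeffMatrix e' e'' (fun x => g x) y)ᴴ * gramAt e'' hQ y *
      coeffMatrix e' e'' (fun x => g x) y = (1 - P)ᴴ * gramAt e' hE y * (1 - P) := by
  set G := coeffMatrix e' e'' (fun x => g x) y with hG
  set J := coeffMatrix e e' (fun x => j x) y with hJ
  have hGP : ∀ v, G *ᵥ v = G *ᵥ ((1 - P) *ᵥ v) := fun v => by
    rw [Matrix.mulVec_mulVec, Matrix.mul_sub, hP, ← Matrix.mul_assoc G J,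
      coeffMatrix_mul_eq_zero hy hy' hy'' hexact, Matrix.zero_mul, Matrix.mul_one, sub_zero]
  have horth : ∀ v (s : S y), hE.form y (e'.symm y ((1 - P) *ᵥ v)) (j y s) = 0 := fun v s => by
    rw [← e.symm_apply_apply_mk hy s, apply_symm hy hy', form_symm hE hy', ← hJ,
      Matrix.star_mulVec, ← Matrix.dotProduct_mulVec, Matrix.mulVec_mulVec, Matrix.mulVec_mulVec,
      hP, orthogonal_proj (isUnit_det_gramAt hS hy)
        (gramAt_induced hS_induced hy hy'), Matrix.zero_mulVec, dotProduct_zero]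
  refine sesq_ext fun v w => ?_
  rw [← sesq_conjTranspose_mul, hGP v, hGP w, ← form_symm hQ hy'', ← apply_symm hy' hy'',
    ← apply_symm hy' hy'', hQ_induced _ _ (horth v) (horth w), form_symm hE hy',
    sesq_conjTranspose_mul]

end Pointwise

variable (hj : IsHolomorphicHom V r m j) (hg : IsHolomorphicHom V m q g)
    (hg_surj : ∀ x, Function.Surjective (g x))
    (hexact : ∀ x, Function.Exact (j x) (g x))
    (hS_induced : ∀ x (s t : S x), hS.form x s t = hE.form x (j x s) (j x t))
    (hQ_induced : ∀ x (u w : E x), (∀ s : S x, hE.form x u (j x s) = 0) →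
      (∀ s : S x, hE.form x w (j x s) = 0) → hQ.form x (g x u) (g x w) = hE.form x u w)
include hj hg hg_surj hexact hS_induced hQ_induced

/-- The forms `v` and `b` and the Chern forms near a point. -/
theorem exists_local_forms (x : X) : ∃ (U : TopologicalSpace.Opens V) (v b cE cS cQ : SmoothForms U),
    chartAt V x x ∈ U ∧
    (∀ z, ev z v = coordForm (vForm hS hE j) x z) ∧
    (∀ z, ev z b = coordForm (bForm hS hE j) x z) ∧
    (∀ z, ev z cE = coordForm (chernForm hE) x z) ∧
    (∀ z, ev z cS = coordForm (chernForm hS) x z) ∧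
    (∀ z, ev z cQ = coordForm (chernForm hQ) x z) ∧
    (∀ z, ev z v ∈ formsKK V) ∧ (2 * aleph) • dl v = b ∧ db b = cE - cS * cQ := by
  set U := chartPreimage V x (baseOpens r S x ⊓ baseOpens m E x ⊓ baseOpens q Q x) with hU
  have hJ : ∀ a b, ContDiffOn ℂ ∞ (fun z : V => homMatrix r m j x z a b) U :=
    contDiffOn_coeffMatrix _ _ hj x (W := U) (fun _ hz => hz.1) (fun _ hz => hz.2.1)
  have hG : ∀ a b, ContDiffOn ℂ ∞ (fun z : V => homMatrix m q g x z a b) U :=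
    contDiffOn_coeffMatrix _ _ hg x (W := U) (fun _ hz => hz.1) (fun _ hz => ⟨hz.2.1.2, hz.2.2⟩)
  have huE : ∀ z ∈ U, IsUnit (gram hE x z).det := fun z hz => isUnit_gram hE ⟨hz.1, hz.2.1.2⟩
  have huS : ∀ z ∈ U, IsUnit (gram hS x z).det := fun z hz => isUnit_gram hS ⟨hz.1, hz.2.1.1⟩
  have huQ : ∀ z ∈ U, IsUnit (gram hQ x z).det := fun z hz => isUnit_gram hQ ⟨hz.1, hz.2.2⟩
  have hind : ∀ z ∈ U, gram hS x z =
      (homMatrix r m j x z)ᴴ * gram hE x z * homMatrix r m j x z := fun z hz =>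
    gramAt_induced (hS_induced _) hz.2.1.1 hz.2.1.2
  have hGJ : ∀ z ∈ U, homMatrix m q g x z * homMatrix r m j x z = 0 := fun z hz =>
    coeffMatrix_mul_eq_zero hz.2.1.1 hz.2.1.2 hz.2.2 (hexact _)
  have hsplit : ∀ z ∈ U, homMatrix r m j x z * ((gram hS x z)⁻¹ * (homMatrix r m j x z)ᴴ *
      gram hE x z) + ((gram hE x z)⁻¹ * (homMatrix m q g x z)ᴴ * gram hQ x z) *
      homMatrix m q g x z = 1 := fun z hz =>
    split_of_quotient (gramAt_conjTranspose hE _) (gramAt_conjTranspose hS _) (huE z hz)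
      (huS z hz) (hind z hz) (quotient_metric hz.2.1.1 hz.2.1.2 hz.2.2 (hS_induced _)
        (hQ_induced _) (hexact _) rfl)
  -- Surjectivity of `g` provides a right inverse of its matrix, which turns the splitting into a
  -- formula for the inverse metric of Q.
  have hQi : ∀ z ∈ U, (gram hQ x z)⁻¹ =
      homMatrix m q g x z * (gram hE x z)⁻¹ * (homMatrix m q g x z)ᴴ := fun z hz => by
    obtain ⟨L, hL⟩ := exists_rightInverse_coeffMatrix
      (e' := trivializationAt (Fin m → ℂ) E x) (e'' := trivializationAt (Fin q → ℂ) Q x)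
      hz.2.1.2 hz.2.2 (hg_surj _)
    exact inv_of_split hL (hGJ z hz) (hsplit z hz)
  obtain ⟨Hi, Hm, HSi, HSm, HQi, HQm, Jm, J', Gm, G', hd, r1, r2, r3, r4, r5, r6, r7, r8⟩ :=
    exists_exactData (contDiffOn_gram hE x (W := U) (fun _ hz => hz.1) (fun _ hz => hz.2.1.2))
      (contDiffOn_gram hS x (W := U) (fun _ hz => hz.1) (fun _ hz => hz.2.1.1))
      (contDiffOn_gram hQ x (W := U) (fun _ hz => hz.1) (fun _ hz => hz.2.2)) hJ hG huE huS huQ hind hGJ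
      hQi hsplit
  have rP : Represents (Jm * (HSi * J' * Hm)) (jjStar hS hE j x) := r7.mul ((r3.mul r8).mul r2)
  refine ⟨U, vAbs Hi Hm (Jm * (HSi * J' * Hm)), bAbs Hi Hm (Jm * (HSi * J' * Hm)), chernAbs Hi Hm,
    chernAbs HSi HSm, chernAbs HQi HQm, self_mem_chartPreimage ⟨⟨mem_baseOpens_self x,
      mem_baseOpens_self x⟩, mem_baseOpens_self x⟩, fun z => ?_, fun z => ?_, fun z => ?_,
    fun z => ?_, fun z => ?_, ?_, ?_, ?_⟩
  · exact (ev_vAbs r2 r1 rP huE z).trans (coordForm_vForm_bForm hS hE hj ⟨z.2.1, z.2.2.1⟩).1.symm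
  · exact (ev_bAbs r2 r1 rP huE z).trans (coordForm_vForm_bForm hS hE hj ⟨z.2.1, z.2.2.1⟩).2.symm
  · exact (ev_chernAbs r2 r1 huE z).trans (coordForm_chernForm hE ⟨z.2.1, z.2.2.1.2⟩).symm
  · exact (ev_chernAbs r4 r3 huS z).trans (coordForm_chernForm hS ⟨z.2.1, z.2.2.1.1⟩).symm
  · exact (ev_chernAbs r6 r5 huQ z).trans (coordForm_chernForm hQ ⟨z.2.1, z.2.2.2⟩).symm
  · exact vAbs_mem r1.mem_bot r2.mem_bot rP.mem_bot
  · exact dl_vAbs hd.metric hd.even_proj hd.proj_mul_proj hd.proj_mul_gam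
  · rw [db_bAbs hd.metric hd.even_proj, hd.ldet_chernMatrix]
    rfl

theorem isSmoothKK_vForm : IsSmoothKK (vForm hS hE j) := by
  refine ⟨isSmoothForm_of_local fun x => ?_, fun x => ?_⟩
  · obtain ⟨U, v, b, cE, cS, cQ, hx, hv, -⟩ :=
      exists_local_forms hj hg hg_surj hexact hS_induced hQ_induced x
    exact ⟨U, hx, (contDiffOn v).congr fun z hz =>
      ((toFun_apply v ⟨z, hz⟩).trans (hv ⟨z, hz⟩)).symm⟩
  · obtain ⟨U, v, b, cE, cS, cQ, hx, hv, -, -, -, -, hk, -⟩ :=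
      exists_local_forms hj hg hg_surj hexact hS_induced hQ_induced x
    rw [← coordForm_self (vForm hS hE j) x, ← hv ⟨_, hx⟩]
    exact hk _

theorem isSmoothForm_bForm : IsSmoothForm (bForm hS hE j) :=
  isSmoothForm_of_local fun x => by
    obtain ⟨U, v, b, cE, cS, cQ, hx, -, hb, -⟩ :=
      exists_local_forms hj hg hg_surj hexact hS_induced hQ_induced x
    exact ⟨U, hx, (contDiffOn b).congr fun z hz =>
      ((toFun_apply b ⟨z, hz⟩).trans (hb ⟨z, hz⟩)).symm⟩

theorem del_vForm : (2 * aleph) • del (vForm hS hE j) = bForm hS hE j := by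
  ext1 x
  obtain ⟨U, v, b, cE, cS, cQ, hx, hv, hb, -, -, -, -, h, -⟩ :=
    exists_local_forms hj hg hg_surj hexact hS_induced hQ_induced x
  rw [← coordForm_self (bForm hS hE j) x, ← hb ⟨_, hx⟩, ← h, map_smul, ev_dl hv]
  rfl

theorem dbar_bForm : dbar (bForm hS hE j) = chernForm hE - chernForm hS * chernForm hQ := by
  ext1 x
  obtain ⟨U, v, b, cE, cS, cQ, hx, hv, hb, hcE, hcS, hcQ, -, -, h⟩ :=
    exists_local_forms hj hg hg_surj hexact hS_induced hQ_induced x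
  have h1 := ev_db hb ⟨_, hx⟩
  rw [h, map_sub, map_mul, hcE, hcS, hcQ, coordForm_self, coordForm_self, coordForm_self] at h1
  exact h1.symm

/-- `-dd^c v = c(D_E) - c(D_S) c(D_Q)`. -/
theorem neg_ddc_vForm :
    -ddc (vForm hS hE j) = chernForm hE - chernForm hS * chernForm hQ := by
  rw [neg_ddc (isSmoothKK_vForm hj hg hg_surj hexact hS_induced hQ_induced).1,
    del_vForm hj hg hg_surj hexact hS_induced hQ_induced,
    dbar_bForm hj hg hg_surj hexact hS_induced hQ_induced]

end ExactSequence

end BottChern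

end

theorem proposition3p2
    {V : Type*} [NormedAddCommGroup V] [NormedSpace ℂ V] [FiniteDimensional ℂ V]
    {X : Type*} [TopologicalSpace X] [ChartedSpace V X] [IsManifold 𝓘(ℂ, V) ω X]
    {r m q : ℕ}
    {S : X → Type*} [∀ x, AddCommGroup (S x)] [∀ x, Module ℂ (S x)]
    [∀ x, TopologicalSpace (S x)] [TopologicalSpace (TotalSpace (Fin r → ℂ) S)]
    [FiberBundle (Fin r → ℂ) S] [VectorBundle ℂ (Fin r → ℂ) S]
    [ContMDiffVectorBundle ω (Fin r → ℂ) S 𝓘(ℂ, V)]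
    {E : X → Type*} [∀ x, AddCommGroup (E x)] [∀ x, Module ℂ (E x)]
    [∀ x, TopologicalSpace (E x)] [TopologicalSpace (TotalSpace (Fin m → ℂ) E)]
    [FiberBundle (Fin m → ℂ) E] [VectorBundle ℂ (Fin m → ℂ) E]
    [ContMDiffVectorBundle ω (Fin m → ℂ) E 𝓘(ℂ, V)]
    {Q : X → Type*} [∀ x, AddCommGroup (Q x)] [∀ x, Module ℂ (Q x)]
    [∀ x, TopologicalSpace (Q x)] [TopologicalSpace (TotalSpace (Fin q → ℂ) Q)]
    [FiberBundle (Fin q → ℂ) Q] [VectorBundle ℂ (Fin q → ℂ) Q]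
    [ContMDiffVectorBundle ω (Fin q → ℂ) Q 𝓘(ℂ, V)]
    (hS : BottChern.HermitianMetric V r S) (hE : BottChern.HermitianMetric V m E)
    (hQ : BottChern.HermitianMetric V q Q)
    -- the short exact sequence `0 → S → E → Q → 0` of holomorphic bundles
    (j : ∀ x, S x →ₗ[ℂ] E x) (g : ∀ x, E x →ₗ[ℂ] Q x)
    (hj : BottChern.IsHolomorphicHom V r m j) (hg : BottChern.IsHolomorphicHom V m q g)
    (hj_inj : ∀ x, Function.Injective (j x)) (hg_surj : ∀ x, Function.Surjective (g x))
    (hexact : ∀ x, Function.Exact (j x) (g x))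
    -- `S` and `Q` carry the metrics induced by the metric of `E`
    (hS_induced : ∀ x (s t : S x), hS.form x s t = hE.form x (j x s) (j x t))
    (hQ_induced : ∀ x (u w : E x), (∀ s : S x, hE.form x u (j x s) = 0) →
      (∀ s : S x, hE.form x w (j x s) = 0) → hQ.form x (g x u) (g x w) = hE.form x u w) :
    -- `v` and `b` are smooth forms, and `v` lies in `⊕_k 𝓔_{k,k}(X)`
    BottChern.IsSmoothKK (BottChern.vForm hS hE j) ∧
    BottChern.IsSmoothForm (BottChern.bForm hS hE j) ∧
    -- `2ℵ∂v = b`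
    (2 * BottChern.aleph) • BottChern.del (BottChern.vForm hS hE j) =
      BottChern.bForm hS hE j ∧
    -- `-dd^c v = c(D_E) - c(D_S) c(D_Q)`
    -BottChern.ddc (BottChern.vForm hS hE j) =
      BottChern.chernForm hE - BottChern.chernForm hS * BottChern.chernForm hQ ∧
    -- the Chern forms define Bott-Chern classes, and `ĉ(E) = ĉ(S) ĉ(Q)`
    BottChern.IsClosedKK (BottChern.chernForm hE) ∧
    BottChern.IsClosedKK (BottChern.chernForm hS) ∧
    BottChern.IsClosedKK (BottChern.chernForm hQ) ∧
    BottChern.bottChernClass hE =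
      BottChern.bcMul (BottChern.bottChernClass hS) (BottChern.bottChernClass hQ) := by
  have hv := BottChern.isSmoothKK_vForm hj hg hg_surj hexact hS_induced hQ_induced
  have hddc := BottChern.neg_ddc_vForm hj hg hg_surj hexact hS_induced hQ_induced
  have hcS := BottChern.isClosedKK_chernForm hS
  have hcQ := BottChern.isClosedKK_chernForm hQ
  exact ⟨hv, BottChern.isSmoothForm_bForm hj hg hg_surj hexact hS_induced hQ_induced,
    BottChern.del_vForm hj hg hg_surj hexact hS_induced hQ_induced, hddc,
    BottChern.isClosedKK_chernForm hE, hcS, hcQ, BottChern.bcClass_eq_bcMul hcS hcQ hv hddc⟩
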